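/- Fix $n=m+2\ge 2$ and $\Lambda\in\mathbb C\setminus\{0\}$ with a square root $\sqrt\Lambda$. **Notation.** For spinors in $\mathbb C^2$ put $(ab)=\epsilon_{AB}a^Ab^B=a^0b^1-a^1b^0$, with $\epsilon^{AB}\epsilon_{BC}=\delta^A_C$. Supertwistor indices $I=(\alpha,a)$ consist of four bosonic and four odd values. The infinity twistors are $I_{IJ}=\mathrm{diag}(\epsilon^{AB},\Lambda\epsilon_{A'B'},\sqrt\Lambda\,\delta_{ab})$ and $I^{IJ}=\mathrm{diag}(\Lambda\epsilon_{AB},\epsilon^{A'B'},\sqrt\Lambda\,\delta^{ab})$. Let $X^{IA}$ be the eight bosonic and eight odd coordinates of degree-one maps $Z^I(\sigma)=X^I_A\sigma^A$, $X^I_A=\epsilon_{AB}X^{IB}$, and let $X^2=\tfrac12 I_{IJ}X^I_AX^{JA}$. Let $\sigma_1,\dots,\sigma_n\in\mathbb C^2$ be pairwise non-proportional, let $W_{1},\dots,W_{n}$ be dual supertwistors (with odd components $\eta_{ia}$), $[W_i,W_j]=I^{IJ}W_{jJ}W_{iI}$, $W_i\cdot Z=Z^IW_{iI}$, and let $e^{i\mathcal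 P\cdot X}=\exp\big(i\sum_iW_i\cdot Z(\sigma_i)\big)$ be the product of the dual twistor wavefunctions; $\mathcal P\cdot\xi=\sum_jW_j\,(\sigma_j\xi)$. Write $(ij)=(\sigma_i\sigma_j)$, $(\xi i)=(\xi\sigma_i)$. For a reference spinor $\xi\in\mathbb C^2$ with $(\xi i)\neq0$ for $i\ge3$, let $$\mathbb H_{ij}=-\frac{[W_i,W_j]}{(ij)}\ (i\ne j),\qquad \mathbb H_{ii}=-\sum_{j\ne i}\mathbb H_{ij}\frac{(\xi j)^2}{(\xi i)^2},$$ $$\psi^q_i=\frac{i\Lambda(\xi q)}{(qi)^2(\xi i)^2}\,W_i\cdot\big[(\xi i)Z(\sigma_q)+(qi)Z(\xi)\big],\qquad \omega^q_{ij}=\frac{\Lambda[W_i,W_j](q\xi)^4(ij)}{(qi)^2(qj)^2(\xi i)^2(\xi j)^2}\qquad(q=1,2).$$ $|\mathbb H^{S}|$ denotes the determinant of $\mathbb H$ with the rows and columns in $S$ removed. All sums below are over pairwise distinct indices in $\{3,\dots,n\}$. The integrand of the MHV amplitude is $F_\xi e^{i\mathcal P\cdot X}$ with $$F_\xi=(X^2)^2|\mathbb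 H^{12}|+X^2\sum_i(\psi^1_i+\psi^2_i)|\mathbb H^{12i}|+\tfrac12X^2\sum_{i,j}(\omega^1_{ij}+\omega^2_{ij})|\mathbb H^{12ij}|+\sum_{i,j}\psi^1_i\psi^2_j|\mathbb H^{12ij}|$$ $$\qquad+\tfrac12\sum_{i,j,k}(\psi^1_i\omega^2_{jk}+\psi^2_i\omega^1_{jk})|\mathbb H^{12ijk}|+\tfrac14\sum_{i,j,k,l}\omega^1_{ij}\omega^2_{kl}|\mathbb H^{12ijkl}|.$$ **(1) Variation of the integrand.** Let $\mathrm d_\xi=\mathrm d\xi^A\,\partial/\partial\xi^A$ and $\mathrm D\xi=(\xi\,\mathrm d\xi)$. Then $\mathrm d_\xi\big(F_\xi e^{i\mathcal P\cdot X}\big)=\sum_{k=3}^7\mathcal V_k$, where $\mathcal V_k$ collects the terms whose determinants have $k$ rows and columns removed, computed with $$\mathrm d_\xi\mathbb H_{ii}=\frac{2[W_i,\mathcal P\cdot\xi]}{(i\xi)^3}\mathrm D\xi,\qquad \mathrm d_\xi\psi^q_i=\frac{2i\Lambda\,Z(\xi)\cdot W_i}{(i\xi)^3}\mathrm D\xi,$$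 $$\mathrm d_\xi\omega^q_{ij}=\frac{2\Lambda[W_i,W_j](ij)(q\xi)^3}{(qi)^2(qj)^2(i\xi)^3(j\xi)^3}\big[(j\xi)(iq)+(i\xi)(jq)\big]\mathrm D\xi .$$ For $k=3,4,5,6$ the term $\mathcal V_k$ is the total divergence $\frac{\partial}{\partial X^{JA}}V_k^{JA}$ (left derivatives in the odd coordinates) of the vector field, smooth in $X$, $$V_k^{JA}=-2i\,\mathrm D\xi\;\sum_{l}\frac{I^{IJ}W_{lI}\,\xi^A}{(l\xi)^3}\;B_{k,l}\;e^{i\mathcal P\cdot X},\qquad\text{where}$$ $$B_{3,l}=(X^2)^2|\mathbb H^{12l}|,\qquad B_{4,l}=X^2\sum_i(\psi^1_i+\psi^2_i)|\mathbb H^{12il}|,$$ $$B_{5,l}=\sum_{i,j}\big(\tfrac12X^2(\omega^1_{ij}+\omega^2_{ij})+\psi^1_i\psi^2_j\big)|\mathbb H^{12ijl}|,\qquad B_{6,l}=\tfrac12\sum_{i,j,k}(\psi^1_i\omega^2_{jk}+\psi^2_i\omega^1_{jk})|\mathbb H^{12ijkl}|,$$ and $\mathcal V_7=\tfrac14\sum_{i,j,k,l,p}|\mathbb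 H^{12ijklp}|\,\omega^1_{ij}\omega^2_{kl}\,\mathrm d_\xi\mathbb H_{pp}\,e^{i\mathcal P\cdot X}$ contains the factors $[W_p,\mathcal P\cdot\xi]$. **(2) The amplitude.** On the real slice (real bosonic $X$, $W_i$ and real $\sigma_i$; $\xi$ complex) let $$\mathcal M_{n,0}(\xi)=\frac1\Lambda\int\frac{\mathrm d^{8|8}X\,\mathrm d^2\sigma}{\mathrm{vol}\,GL(2)}\,F_\xi\,e^{i\mathcal P\cdot X}$$ be smeared with a Schwartz function of the bosonic components of the $W_i$ and an arbitrary linear functional of their odd components, where $GL(2)$ is used to fix $\sigma_1,\sigma_2$ (Jacobian $(12)^2$), the odd integral is Berezin's, and $\sigma_3,\dots,\sigma_n$ are integrated over a contour, i.e. against a finite complex weight supported on a compact set of configurations on which $\sigma_1,\dots,\sigma_n$ are pairwise non-proportional and $(\xi i)\ne0$ for $i\ge3$. Then the integrals converge, in the order $W$, $X$, $\sigma$; for every configuration in the contour the $X$-integral of each smeared $\mathcal V_k$, $k=3,\dots,7$, converges and vanishes (for $k\le 6$ as the integral of a total divergence, for $k=7$ by momentum conservation); and $$\mathrm d_\xi\mathcal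 M_{n,0}=\frac1\Lambda\int\frac{\mathrm d^{8|8}X\,\mathrm d^2\sigma}{\mathrm{vol}\,GL(2)}\sum_{k=3}^7\mathcal V_k=0 .$$ Consequently $\mathcal M_{n,0}(\xi)=\mathcal M_{n,0}(\xi')$ for any two reference spinors $\xi,\xi'\in\mathbb C^2$ that are admissible for the contour. -/

import Mathlib

open MeasureTheory
open scoped SchwartzMap ContDiff

namespace MHV

noncomputable section

/-- The `n = m + 2` marked points: `Sum.inl 0`, `Sum.inl 1` are the two negative helicity
particles (called `1` and `2` in comments), `Sum.inr i` are the `m` positive helicity ones. -/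
abbrev Pt (m : ℕ) : Type := Fin 2 ⊕ Fin m

/-- Labels of the anticommuting generators: `Sum.inl (i, a)` is the odd component `η_{i a}` of the
dual twistor `W_i`; `Sum.inr (a, A)` is the odd coordinate `θ^{aA} = X^{aA}` of the moduli space. -/
abbrev OddVar (m : ℕ) : Type := (Pt m × Fin 4) ⊕ (Fin 4 × Fin 2)

/-- The Grassmann algebra in which all super-quantities take values. -/
abbrev Gr (m : ℕ) : Type := ExteriorAlgebra ℂ (OddVar m → ℂ)

/-- Commuting elements of the Grassmann algebra. Even elements are central, so determinants with
even entries are taken in this commutative ring. -/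
abbrev Bos (m : ℕ) : Type := Subalgebra.center ℂ (Gr m)

/-- Twistor index: `Sum.inl α` bosonic (`Z^α = (λ_0, λ_1, μ^{0'}, μ^{1'})`), `Sum.inr a` odd. -/
abbrev SIdx : Type := Fin 4 ⊕ Fin 4

/-- The bosonic coordinates `X^{αA}`. -/
abbrev BosX : Type := Fin 4 → Fin 2 → ℂ

/-- The anticommuting generator with a given label. -/
def gen {m : ℕ} (v : OddVar m) : Gr m := ExteriorAlgebra.ι ℂ (Pi.single v 1)

/-- `(a b) = ε_{AB} a^A b^B`. -/
def spin (a b : Fin 2 → ℂ) : ℂ := a 0 * b 1 - a 1 * b 0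

/-- `ε_{AB}`; the inverse is normalized by `ε^{AB} ε_{BC} = δ^A_C`. -/
def eps : Matrix (Fin 2) (Fin 2) ℂ := !![0, 1; -1, 0]

/-- The infinity twistor `I_{IJ} = diag(ε^{AB}, Λ ε_{A'B'}, √Λ δ_{ab})`, where `r` is `√Λ`. -/
def infLower (Λ r : ℂ) : Matrix SIdx SIdx ℂ :=
  Matrix.fromBlocks !![0, -1, 0, 0; 1, 0, 0, 0; 0, 0, 0, Λ; 0, 0, -Λ, 0] 0 0 (r • 1)

/-- The infinity twistor `I^{IJ} = diag(Λ ε_{AB}, ε^{A'B'}, √Λ δ^{ab})`, where `r` is `√Λ`. -/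
def infUpper (Λ r : ℂ) : Matrix SIdx SIdx ℂ :=
  Matrix.fromBlocks !![0, Λ, 0, 0; -Λ, 0, 0, 0; 0, 0, 0, -1; 0, 0, 1, 0] 0 0 (r • 1)

/-- The kinematic data: cosmological constant `Λ`, a square root `r` of it, homogeneous
coordinates `σ i` of the marked points of `ℂℙ¹`, bosonic parts `w i` of the dual twistors. -/
structure Kin (m : ℕ) where
  Λ : ℂ
  r : ℂ
  σ : Pt m → Fin 2 → ℂ
  w : Pt m → Fin 4 → ℂ

variable {m : ℕ}

/-- The coordinates `X^{IA}`, as elements of the Grassmann algebra. -/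
def Xup (m : ℕ) (x : BosX) : SIdx → Fin 2 → Gr m
  | Sum.inl α, A => algebraMap ℂ (Gr m) (x α A)
  | Sum.inr a, A => gen (Sum.inr (a, A))

/-- `X^I_A = ε_{AB} X^{IB}`. -/
def Xlow (m : ℕ) (x : BosX) (I : SIdx) (A : Fin 2) : Gr m := ∑ B, eps A B • Xup m x I B

/-- The degree one map `Z^I(s) = X^I_A s^A`. -/
def Zmap (m : ℕ) (x : BosX) (s : Fin 2 → ℂ) (I : SIdx) : Gr m := ∑ A, s A • Xlow m x I A

/-- The dual supertwistor `W_{i I}`. -/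
def Kin.W (D : Kin m) (i : Pt m) : SIdx → Gr m
  | Sum.inl α => algebraMap ℂ (Gr m) (D.w i α)
  | Sum.inr a => gen (Sum.inl (i, a))

/-- A supervector with scalar bosonic components and fermionic components of degree one. -/
def IsSVec (u : SIdx → Gr m) : Prop :=
  (∀ α, ∃ c : ℂ, u (Sum.inl α) = algebraMap ℂ (Gr m) c) ∧
    ∀ a, ∃ v : OddVar m → ℂ, u (Sum.inr a) = ExteriorAlgebra.ι ℂ v

theorem ι_mul_ι_mem (u v : OddVar m → ℂ) :
    ExteriorAlgebra.ι ℂ u * ExteriorAlgebra.ι ℂ v ∈ Subalgebra.center ℂ (Gr m) := by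
  rw [Subalgebra.mem_center_iff]
  have anti : ∀ a b : OddVar m → ℂ, ExteriorAlgebra.ι ℂ a * ExteriorAlgebra.ι ℂ b
      = -(ExteriorAlgebra.ι ℂ b * ExteriorAlgebra.ι ℂ a) := fun a b =>
    eq_neg_of_add_eq_zero_left (ExteriorAlgebra.ι_add_mul_swap a b)
  intro b
  induction b using ExteriorAlgebra.induction with
  | algebraMap c => exact Algebra.commutes c _
  | ι x =>
    rw [← mul_assoc, anti x u, neg_mul, mul_assoc, anti x v, mul_neg, neg_neg, mul_assoc]
  | mul a b ha hb => rw [mul_assoc, hb, ← mul_assoc, ha, mul_assoc]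
  | add a b ha hb => rw [add_mul, mul_add, ha, hb]

theorem IsSVec.contract_mem {u v : SIdx → Gr m} (hu : IsSVec u) (hv : IsSVec v)
    {M : Matrix SIdx SIdx ℂ} (h₁ : ∀ α a, M (Sum.inl α) (Sum.inr a) = 0)
    (h₂ : ∀ α a, M (Sum.inr a) (Sum.inl α) = 0) (I J : SIdx) :
    M I J • (u I * v J) ∈ Subalgebra.center ℂ (Gr m) := by
  rcases I with α | a <;> rcases J with β | b
  · obtain ⟨c, hc⟩ := hu.1 α
    obtain ⟨d, hd⟩ := hv.1 β
    rw [hc, hd]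
    exact Subalgebra.smul_mem _ (mul_mem (Subalgebra.algebraMap_mem _ _)
      (Subalgebra.algebraMap_mem _ _)) _
  · rw [h₁, zero_smul]; exact zero_mem _
  · rw [h₂, zero_smul]; exact zero_mem _
  · obtain ⟨c, hc⟩ := hu.2 a
    obtain ⟨d, hd⟩ := hv.2 b
    rw [hc, hd]
    exact Subalgebra.smul_mem _ (ι_mul_ι_mem c d) _

theorem Kin.isSVec_W (D : Kin m) (i : Pt m) : IsSVec (D.W i) :=
  ⟨fun _ => ⟨_, rfl⟩, fun _ => ⟨_, rfl⟩⟩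

theorem isSVec_Xup (x : BosX) (A : Fin 2) : IsSVec fun I => Xup m x I A :=
  ⟨fun _ => ⟨_, rfl⟩, fun _ => ⟨_, rfl⟩⟩

theorem IsSVec.sum_smul {ι : Type*} (s : Finset ι) (c : ι → ℂ) (u : ι → SIdx → Gr m)
    (hu : ∀ k, IsSVec (u k)) : IsSVec fun I => ∑ k ∈ s, c k • u k I := by
  constructor
  · intro α
    choose d hd using fun k => (hu k).1 α
    exact ⟨∑ k ∈ s, c k • d k, by simp [hd, Algebra.smul_def]⟩
  · intro a
    choose d hd using fun k => (hu k).2 a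
    exact ⟨∑ k ∈ s, c k • d k, by simp [hd]⟩

theorem isSVec_Xlow (x : BosX) (A : Fin 2) : IsSVec fun I => Xlow m x I A :=
  IsSVec.sum_smul _ (fun B => eps A B) (fun B I => Xup m x I B) fun B => isSVec_Xup x B

theorem isSVec_Zmap (x : BosX) (s : Fin 2 → ℂ) : IsSVec (Zmap m x s) :=
  IsSVec.sum_smul _ s (fun A I => Xlow m x I A) fun A => isSVec_Xlow x A

/-- `[W_i, W_j] = I^{IJ} W_{iI} W_{jJ}`. For the odd components the order of the factors matters:
it is the order `I^{IJ} W_{jJ} W_{iI}` in which the Hamiltonian vector field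
`I^{IJ} (∂_J h_j) ∂_I` acts on `h_i`. -/
def Kin.brW (D : Kin m) (i j : Pt m) : Bos m :=
  ⟨∑ I, ∑ J, infUpper D.Λ D.r I J • (D.W j J * D.W i I), by
    refine Subalgebra.sum_mem _ fun I _ => Subalgebra.sum_mem _ fun J _ => ?_
    exact (D.isSVec_W j).contract_mem (D.isSVec_W i) (M := (infUpper D.Λ D.r).transpose)
      (by simp [infUpper]) (by simp [infUpper]) J I⟩

/-- `Z(s) · W_i = Z^I(s) W_{iI}`. -/
def Kin.ZW (D : Kin m) (x : BosX) (s : Fin 2 → ℂ) (i : Pt m) : Bos m :=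
  ⟨∑ I, Zmap m x s I * D.W i I, by
    refine Subalgebra.sum_mem _ fun I _ => ?_
    have h := (isSVec_Zmap x s).contract_mem (D.isSVec_W i) (M := (1 : Matrix SIdx SIdx ℂ))
      (by simp) (by simp) I I
    simpa using h⟩

/-- `X² = ½ I_{IJ} X^I_A X^{JA}`; with this normalization the contact form
`I_{IJ} Z^I dZ^J` on the line is `X²` times `σ_A dσ^A = ε_{AB} σ^B dσ^A`. -/
def Kin.X2 (D : Kin m) (x : BosX) : Bos m :=
  ⟨(1 / 2 : ℂ) • ∑ I, ∑ J, ∑ A, infLower D.Λ D.r I J • (Xlow m x I A * Xup m x J A), by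
    refine Subalgebra.smul_mem _ (Subalgebra.sum_mem _ fun I _ => Subalgebra.sum_mem _ fun J _ =>
      Subalgebra.sum_mem _ fun A _ => ?_) _
    exact (isSVec_Xlow x A).contract_mem (isSVec_Xup x A) (M := infLower D.Λ D.r)
      (by simp [infLower]) (by simp [infLower]) I J⟩

/-- The body (degree zero part) of an element of the Grassmann algebra. -/
def body (s : Gr m) : ℂ := ExteriorAlgebra.algebraMapInv s

/-- The exponential of an even element: the ordinary exponential of its body times the
(terminating) exponential series of its nilpotent part. -/
def superExp (s : Gr m) : Gr m :=
  Complex.exp (body s) • IsNilpotent.exp (s - algebraMap ℂ (Gr m) (body s))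

/-- The product of the dual twistor wavefunctions, `exp (i 𝒫·X)` with
`𝒫·X = ∑ i, Z(σ_i) · W_i`. -/
def Kin.wave (D : Kin m) (x : BosX) : Gr m :=
  superExp (Complex.I • ((∑ i, D.ZW x (D.σ i) i : Bos m) : Gr m))

/-- The Hodges matrix on dual twistor wavefunctions, with reference spinor `ξ`. -/
def Kin.hodges (D : Kin m) (ξ : Fin 2 → ℂ) : Matrix (Pt m) (Pt m) (Bos m) := fun i j =>
  if i = j then
    -∑ k ∈ Finset.univ.erase i,
      ((spin ξ (D.σ k)) ^ 2 / (spin ξ (D.σ i)) ^ 2) • (-(1 / spin (D.σ i) (D.σ k)) • D.brW i k)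
  else -(1 / spin (D.σ i) (D.σ j)) • D.brW i j

/-- The reduced determinant: the rows and columns of `1`, `2` and of all `p t` are removed. -/
def Kin.redDet (D : Kin m) (ξ : Fin 2 → ℂ) {k : ℕ} (p : Fin k → Fin m) : Bos m :=
  ((D.hodges ξ).submatrix (fun j : {j : Fin m // ∀ t, p t ≠ j} => (Sum.inr j.1 : Pt m))
    (fun j => (Sum.inr j.1 : Pt m))).det

/-- `ψ^q_i`, one propagator ending on the contact structure at the point `q ∈ {1, 2}`. -/
def Kin.psi (D : Kin m) (ξ : Fin 2 → ℂ) (x : BosX) (q : Fin 2) (i : Fin m) : Bos m :=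
  let a := D.σ (Sum.inl q)
  let s := D.σ (Sum.inr i)
  (Complex.I * D.Λ * spin ξ a / ((spin a s) ^ 2 * (spin ξ s) ^ 2)) •
    (spin ξ s • D.ZW x a (Sum.inr i) + spin a s • D.ZW x ξ (Sum.inr i))

/-- `ω^q_{ij}`, two propagators ending on the contact structure at the point `q ∈ {1, 2}`. -/
def Kin.omega (D : Kin m) (ξ : Fin 2 → ℂ) (q : Fin 2) (i j : Fin m) : Bos m :=
  let a := D.σ (Sum.inl q)
  let s := D.σ (Sum.inr i)
  let t := D.σ (Sum.inr j)
  (D.Λ * (spin a ξ) ^ 4 * spin s t /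
      ((spin a s) ^ 2 * (spin a t) ^ 2 * (spin ξ s) ^ 2 * (spin ξ t) ^ 2)) •
    D.brW (Sum.inr i) (Sum.inr j)

/-- The integrand of `Λ 𝓜_{n,0}`. Sums over `Fin k ↪ Fin m` run over `k` distinct positive
helicity particles; every unordered pair in an `ω` is counted once, whence the factors `1/2`. -/
def Kin.integrand (D : Kin m) (x : BosX) (ξ : Fin 2 → ℂ) : Gr m :=
  ((D.X2 x ^ 2 * D.redDet ξ ![]
    + D.X2 x * ∑ p : Fin 1 ↪ Fin m, (D.psi ξ x 0 (p 0) + D.psi ξ x 1 (p 0)) * D.redDet ξ p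
    + D.X2 x * ∑ p : Fin 2 ↪ Fin m,
        (1 / 2 : ℂ) • ((D.omega ξ 0 (p 0) (p 1) + D.omega ξ 1 (p 0) (p 1)) * D.redDet ξ p)
    + ∑ p : Fin 2 ↪ Fin m, D.psi ξ x 0 (p 0) * D.psi ξ x 1 (p 1) * D.redDet ξ p
    + ∑ p : Fin 3 ↪ Fin m,
        (1 / 2 : ℂ) • ((D.psi ξ x 0 (p 0) * D.omega ξ 1 (p 1) (p 2)
          + D.psi ξ x 1 (p 0) * D.omega ξ 0 (p 1) (p 2)) * D.redDet ξ p)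
    + ∑ p : Fin 4 ↪ Fin m,
        (1 / 4 : ℂ) • (D.omega ξ 0 (p 0) (p 1) * D.omega ξ 1 (p 2) (p 3) * D.redDet ξ p)
    : Bos m) : Gr m) * D.wave x

/-- The variation of `ℍ_{ii}` in the direction `ζ = dξ`, which is
`2 [W_i, 𝒫·ξ] (ξ dξ) / (i ξ)³` with `𝒫·ξ = ∑ j, W_j (j ξ)`. -/
def Kin.dHodges (D : Kin m) (ξ ζ : Fin 2 → ℂ) (i : Fin m) : Bos m :=
  (2 * spin ξ ζ / (spin (D.σ (Sum.inr i)) ξ) ^ 3) •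
    ∑ j, spin (D.σ j) ξ • D.brW (Sum.inr i) j

/-- The variation of `ψ^1_i` and of `ψ^2_i`. -/
def Kin.dPsi (D : Kin m) (ξ ζ : Fin 2 → ℂ) (x : BosX) (i : Fin m) : Bos m :=
  (2 * Complex.I * D.Λ * spin ξ ζ / (spin (D.σ (Sum.inr i)) ξ) ^ 3) • D.ZW x ξ (Sum.inr i)

/-- The variation of `ω^q_{ij}`. -/
def Kin.dOmega (D : Kin m) (ξ ζ : Fin 2 → ℂ) (q : Fin 2) (i j : Fin m) : Bos m :=
  let a := D.σ (Sum.inl q)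
  let s := D.σ (Sum.inr i)
  let t := D.σ (Sum.inr j)
  (2 * D.Λ * spin s t * (spin a ξ) ^ 3 /
      ((spin a s) ^ 2 * (spin a t) ^ 2 * (spin s ξ) ^ 3 * (spin t ξ) ^ 3) *
      (spin t ξ * spin s a + spin s ξ * spin t a) * spin ξ ζ) •
    D.brW (Sum.inr i) (Sum.inr j)

/-- The part of `d_ξ` of the integrand whose reduced determinants have `k` rows and columns
removed, `k = 3, …, 7`. -/
def Kin.variation (D : Kin m) (ξ ζ : Fin 2 → ℂ) (k : ℕ) (x : BosX) : Gr m :=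
  ((match k with
    | 3 => ∑ p : Fin 1 ↪ Fin m, D.redDet ξ p *
        (D.X2 x ^ 2 * D.dHodges ξ ζ (p 0) + 2 * (D.X2 x * D.dPsi ξ ζ x (p 0)))
    | 4 => ∑ p : Fin 2 ↪ Fin m, D.redDet ξ p *
        (D.X2 x * (D.psi ξ x 0 (p 0) + D.psi ξ x 1 (p 0)) * D.dHodges ξ ζ (p 1)
          + (1 / 2 : ℂ) • (D.X2 x *
              (D.dOmega ξ ζ 0 (p 0) (p 1) + D.dOmega ξ ζ 1 (p 0) (p 1)))
          + D.dPsi ξ ζ x (p 0) * D.psi ξ x 1 (p 1) + D.psi ξ x 0 (p 0) * D.dPsi ξ ζ x (p 1))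
    | 5 => ∑ p : Fin 3 ↪ Fin m, D.redDet ξ p *
        ((1 / 2 : ℂ) • (D.X2 x * (D.omega ξ 0 (p 0) (p 1) + D.omega ξ 1 (p 0) (p 1))
              * D.dHodges ξ ζ (p 2))
          + D.psi ξ x 0 (p 0) * D.psi ξ x 1 (p 1) * D.dHodges ξ ζ (p 2)
          + (1 / 2 : ℂ) • (D.dPsi ξ ζ x (p 0) *
              (D.omega ξ 1 (p 1) (p 2) + D.omega ξ 0 (p 1) (p 2)))
          + (1 / 2 : ℂ) • (D.psi ξ x 0 (p 0) * D.dOmega ξ ζ 1 (p 1) (p 2)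
              + D.psi ξ x 1 (p 0) * D.dOmega ξ ζ 0 (p 1) (p 2)))
    | 6 => ∑ p : Fin 4 ↪ Fin m, D.redDet ξ p *
        ((1 / 2 : ℂ) • ((D.psi ξ x 0 (p 0) * D.omega ξ 1 (p 1) (p 2)
              + D.psi ξ x 1 (p 0) * D.omega ξ 0 (p 1) (p 2)) * D.dHodges ξ ζ (p 3))
          + (1 / 4 : ℂ) • (D.dOmega ξ ζ 0 (p 0) (p 1) * D.omega ξ 1 (p 2) (p 3)
              + D.omega ξ 0 (p 0) (p 1) * D.dOmega ξ ζ 1 (p 2) (p 3)))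
    | 7 => ∑ p : Fin 5 ↪ Fin m, D.redDet ξ p *
        (1 / 4 : ℂ) • (D.omega ξ 0 (p 0) (p 1) * D.omega ξ 1 (p 2) (p 3) * D.dHodges ξ ζ (p 4))
    | _ => 0 : Bos m) : Gr m) * D.wave x

/-- The constant supervector `-2i (ξ dξ) I^{IJ} W_{iI} ξ^A / (i ξ)³`. -/
def Kin.dir (D : Kin m) (ξ ζ : Fin 2 → ℂ) (i : Fin m) (J : SIdx) (A : Fin 2) : Gr m :=
  (-2 * Complex.I * spin ξ ζ * ξ A / (spin (D.σ (Sum.inr i)) ξ) ^ 3) •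
    ∑ I, infUpper D.Λ D.r I J • D.W (Sum.inr i) I

/-- The vector field `V^{JA}` of order `k = 3, 4, 5, 6`. -/
def Kin.field (D : Kin m) (ξ ζ : Fin 2 → ℂ) (k : ℕ) (x : BosX) (J : SIdx) (A : Fin 2) : Gr m :=
  (match k with
    | 3 => ∑ p : Fin 1 ↪ Fin m, D.dir ξ ζ (p 0) J A *
        ((D.redDet ξ p * D.X2 x ^ 2 : Bos m) : Gr m)
    | 4 => ∑ p : Fin 2 ↪ Fin m, D.dir ξ ζ (p 1) J A *
        ((D.redDet ξ p * (D.X2 x * (D.psi ξ x 0 (p 0) + D.psi ξ x 1 (p 0))) : Bos m) : Gr m)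
    | 5 => ∑ p : Fin 3 ↪ Fin m, D.dir ξ ζ (p 2) J A *
        ((D.redDet ξ p *
          ((1 / 2 : ℂ) • (D.X2 x * (D.omega ξ 0 (p 0) (p 1) + D.omega ξ 1 (p 0) (p 1)))
            + D.psi ξ x 0 (p 0) * D.psi ξ x 1 (p 1)) : Bos m) : Gr m)
    | 6 => ∑ p : Fin 4 ↪ Fin m, D.dir ξ ζ (p 3) J A *
        ((D.redDet ξ p *
          (1 / 2 : ℂ) • (D.psi ξ x 0 (p 0) * D.omega ξ 1 (p 1) (p 2)
            + D.psi ξ x 1 (p 0) * D.omega ξ 0 (p 1) (p 2)) : Bos m) : Gr m)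
    | _ => 0) * D.wave x

/-- The left derivative `∂/∂θ^{aA}` on the Grassmann algebra. -/
def dTheta (a : Fin 4) (A : Fin 2) : Gr m →ₗ[ℂ] Gr m :=
  CliffordAlgebra.contractLeft (LinearMap.proj (Sum.inr (a, A)))

/-- The Berezin integral over the eight odd coordinates `θ^{aA}`. -/
def berezin : Gr m →ₗ[ℂ] Gr m :=
  ((List.finRange 4).flatMap fun a =>
    [(dTheta a 0 : Module.End ℂ (Gr m)), (dTheta a 1 : Module.End ℂ (Gr m))]).prod

/-- The complex derivative of a function with values in the (finite-dimensional) Grassmann algebra,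
taken in every linear coordinate. -/
def HasGrDerivAt (f : ℂ → Gr m) (f' : Gr m) (t : ℂ) : Prop :=
  ∀ l : Gr m →ₗ[ℂ] ℂ, HasDerivAt (fun s => l (f s)) (l f') t

/-- `d` is the divergence `∂V^{IA}/∂X^{IA}` at `x`, summed over all bosonic and odd
coordinates. -/
def HasSuperDivAt (V : BosX → SIdx → Fin 2 → Gr m) (d : Gr m) (x : BosX) : Prop :=
  ∃ V' : Fin 4 → Fin 2 → Gr m,
    (∀ α A, HasGrDerivAt
      (fun t => V (Function.update x α (Function.update (x α) A t)) (Sum.inl α) A)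
      (V' α A) (x α A)) ∧
    d = ∑ α, ∑ A, V' α A + ∑ a, ∑ A, dTheta a A (V x (Sum.inr a) A)

/-- The points `σ i` are pairwise distinct in `ℂℙ¹` and `ξ` is none of the positive helicity
points. -/
def Regular (σ : Pt m → Fin 2 → ℂ) (ξ : Fin 2 → ℂ) : Prop :=
  (∀ i j, i ≠ j → spin (σ i) (σ j) ≠ 0) ∧ ∀ i : Fin m, spin ξ (σ (Sum.inr i)) ≠ 0

/-- Marked points on the real slice: the first two are the gauge-fixed `s`. -/
def points (s : Fin 2 → Fin 2 → ℝ) (σ : Fin m → Fin 2 → ℝ) : Pt m → Fin 2 → ℂ :=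
  fun i A => (Sum.elim s σ i A : ℂ)

/-- Integration of a super-quantity `F` against a wave packet of dual twistor states and over the
odd coordinates: `φ` is the profile in the bosonic components of the `W_i`, and the linear
functional `l` the profile in the odd components `η_{i a}`. -/
def smear (Λ r : ℂ) (s : Fin 2 → Fin 2 → ℝ) (φ : 𝓢(Pt m → Fin 4 → ℝ, ℂ)) (l : Gr m →ₗ[ℂ] ℂ)
    (F : Kin m → BosX → Gr m) (σ : Fin m → Fin 2 → ℝ) (x : Fin 4 → Fin 2 → ℝ) : ℂ :=
  ∫ w : Pt m → Fin 4 → ℝ,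
    φ w * l (berezin (F ⟨Λ, r, points s σ, fun i α => (w i α : ℂ)⟩ fun α A => (x α A : ℂ)))

/-- `(1/Λ) ∫ d^{8|8}X d²σ_1 ⋯ d²σ_n / vol GL(2)` of `F`, for the wave packet `φ`, `l`. The group
`GL(2)` is used to fix `σ_1 = s 0`, `σ_2 = s 1`, with Jacobian `(1 2)²`; the other points are
integrated over the contour that is given by the measure `ν` with weight `ρ`. -/
def moduliIntegral (Λ r : ℂ) (s : Fin 2 → Fin 2 → ℝ) (φ : 𝓢(Pt m → Fin 4 → ℝ, ℂ))
    (l : Gr m →ₗ[ℂ] ℂ) (ν : Measure (Fin m → Fin 2 → ℝ)) (ρ : (Fin m → Fin 2 → ℝ) → ℂ)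
    (F : Kin m → BosX → Gr m) : ℂ :=
  1 / Λ * ((s 0 0 * s 1 1 - s 0 1 * s 1 0 : ℝ) : ℂ) ^ 2 *
    ∫ σ, ρ σ * (∫ x : Fin 4 → Fin 2 → ℝ, smear Λ r s φ l F σ x) ∂ν

/-- The MHV amplitude `𝓜_{n,0}`, `n = m + 2`, computed with the reference spinor `ξ`. -/
def amplitude (Λ r : ℂ) (s : Fin 2 → Fin 2 → ℝ) (φ : 𝓢(Pt m → Fin 4 → ℝ, ℂ))
    (l : Gr m →ₗ[ℂ] ℂ) (ν : Measure (Fin m → Fin 2 → ℝ)) (ρ : (Fin m → Fin 2 → ℝ) → ℂ)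
    (ξ : Fin 2 → ℂ) : ℂ :=
  moduliIntegral Λ r s φ l ν ρ fun D x => D.integrand x ξ

end

end MHV

open MHV

namespace MHV

noncomputable section

variable {m : ℕ}

/-! A change of the reference spinor is compensated by a shift of X. To a positive helicity particle
l belongs the constant supervector u_l = -2i (ξ dξ) I^{IJ} W_{lI} ξ^A / (lξ)³ (`Kin.dir`), and
differentiation along u_l imitates d_ξ. It multiplies e^{i𝒫·X} by d_ξ ℍ_ll
(`Kin.hasSuperDerivAt_wave`). It sends X² to d_ξ ψ^q_l, which is the same for both q, because the
two infinity twistors multiply to Λ times the identity (`Kin.hasSuperDerivAt_X2`). It sends ψ^q_i to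
a multiple κ^q_{il} of [W_l, W_i] whose symmetrization in i, l is d_ξ ω^q_{il}
(`Kin.kappa_add_kappa`). The ω and the reduced determinants do not contain X.

On the other side, ξ enters ℍ only through the diagonal, so d_ξ of a reduced determinant is the sum
over l of d_ξ ℍ_ll times the determinant with l removed as well (`HasBosDerivAt.det`). A reduced
determinant depends only on the set of removed indices, so sums over distinct indices may be
relabelled (`sum_mul_eq_of_perm`). After relabelling, both computations agree order by order: 𝒱_k is
the divergence of ∑_l u_l B_{k,l} e^{i𝒫·X}. For k = 7 the prefactor ωω is constant in X, so 𝒱_7 is a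
divergence for the same reason; momentum conservation is used in this form.

For the integrals, every linear coordinate of the Berezin integral is the oscillating factor times a
polynomial in W and X whose coefficients are holomorphic in (σ, ξ) at regular configurations
(`paramPolynomials`). Integration over W against a Schwartz function is a Fourier transform, and
among its frequencies are the contractions of X with σ_1 and σ_2, which determine X because (12) ≠
0. Hence the W-integral decreases rapidly in X, uniformly in the other points
(`exists_oscInt_decay`). The X-integrals therefore converge and divergences integrate to zero, the
odd derivatives being annihilated by the Berezin integral (`integral_wInt_variationCoord`). Since ξ
occurs only in finitely many coefficients outside the integrals, the ξ-derivative of the X-integral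
exists, equals the integral of ∑ 𝒱_k, and vanishes.

Finally, the complex line through two admissible spinors has only finitely many inadmissible
parameters, and the complement of a finite set in ℂ is connected. So the X-integral takes the same
value at both spinors, for each configuration separately (`integral_smear_integrand_eq`).
Integration over the contour gives the independence of the amplitude, and its differentiability
follows from local constancy. -/

instance finite_gr : Module.Finite ℂ (Gr m) :=
  Module.Finite.of_basis
    (((Pi.basisFun ℂ (OddVar m)).reindex (Fintype.equivFin _)).ExteriorAlgebra)

/-! ### Algebra-valued functions tested by linear coordinates -/

/-- Multiplication is bilinear, so in a basis each coordinate of a product is a combination of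
products of coordinates. This carries closure under products and the Leibniz rule from scalar
functions to algebra-valued ones, without a norm on the algebra. -/
theorem linear_mul_eq_sum {A ι : Type*} [Ring A] [Algebra ℂ A] [Fintype ι]
    (b : Module.Basis ι ℂ A) (l : A →ₗ[ℂ] ℂ) (x y : A) :
    l (x * y) = ∑ i, ∑ j, b.coord i x * b.coord j y * l (b i * b j) := by
  conv_lhs => rw [← b.sum_repr x, ← b.sum_repr y, Finset.sum_mul_sum]
  simp only [map_sum, smul_mul_smul_comm, map_smul, smul_eq_mul, Module.Basis.coord_apply]

/-- The functions with values in a finite-dimensional algebra all of whose linear coordinates belong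
to a given algebra of scalar functions. -/
def coordFunctions {P : Type*} (A : Type*) [Ring A] [Algebra ℂ A] [Module.Finite ℂ A]
    (S : Subalgebra ℂ (P → ℂ)) : Subalgebra ℂ (P → A) where
  carrier := {F | ∀ l : A →ₗ[ℂ] ℂ, (fun p => l (F p)) ∈ S}
  mul_mem' {F G} hF hG l := by
    let b := Module.finBasis ℂ A
    have : (fun p => l ((F * G) p))
        = ∑ i, ∑ j, l (b i * b j) • ((fun p => b.coord i (F p)) * fun p => b.coord j (G p)) := by
      funext p
      rw [Pi.mul_apply, linear_mul_eq_sum b]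
      simp only [Finset.sum_apply, Pi.smul_apply, Pi.mul_apply, smul_eq_mul, mul_comm]
    rw [this]
    exact sum_mem fun i _ => sum_mem fun j _ => S.smul_mem (mul_mem (hF _) (hG _)) _
  add_mem' {F G} hF hG l := by
    simp only [Pi.add_apply, map_add]
    exact add_mem (hF l) (hG l)
  algebraMap_mem' c l := by
    have : (fun p => l ((algebraMap ℂ (P → A)) c p)) = (c * l 1) • (1 : P → ℂ) := by
      funext p
      simp [Algebra.algebraMap_eq_smul_one]
    rw [this]
    exact S.smul_mem (one_mem S) _

theorem smul_mem_coordFunctions {P A : Type*} [Ring A] [Algebra ℂ A] [Module.Finite ℂ A]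
    {S : Subalgebra ℂ (P → ℂ)} {c : P → ℂ} {F : P → A}
    (hc : c ∈ S) (hF : F ∈ coordFunctions A S) : (fun p => c p • F p) ∈ coordFunctions A S := by
  intro l
  simp only [map_smul, smul_eq_mul]
  exact mul_mem hc (hF l)

theorem const_mem_coordFunctions {P A : Type*} [Ring A] [Algebra ℂ A] [Module.Finite ℂ A]
    {S : Subalgebra ℂ (P → ℂ)} (g : A) : (fun _ => g) ∈ coordFunctions A S := by
  intro l
  exact S.algebraMap_mem (l g)

/-- The functions with values in the Grassmann algebra all of whose linear coordinates belong to a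
given algebra of scalar functions. -/
def grFunctions {P : Type*} (m : ℕ) (S : Subalgebra ℂ (P → ℂ)) : Subalgebra ℂ (P → Gr m) :=
  coordFunctions (Gr m) S

/-- The functions with values in the center, all of whose linear coordinates belong to a given
algebra of scalar functions. -/
def bosFunctions {P : Type*} (m : ℕ) (S : Subalgebra ℂ (P → ℂ)) : Subalgebra ℂ (P → Bos m) :=
  (grFunctions m S).comap ((Subalgebra.center ℂ (Gr m)).val.compLeft P)

theorem mem_bosFunctions {P : Type*} {S : Subalgebra ℂ (P → ℂ)} {F : P → Bos m} :
    F ∈ bosFunctions m S ↔ (fun p => (F p : Gr m)) ∈ grFunctions m S := Iff.rfl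

theorem smul_mem_grFunctions {P : Type*} {S : Subalgebra ℂ (P → ℂ)} {c : P → ℂ} {F : P → Gr m}
    (hc : c ∈ S) (hF : F ∈ grFunctions m S) : (fun p => c p • F p) ∈ grFunctions m S :=
  smul_mem_coordFunctions hc hF

theorem const_mem_grFunctions {P : Type*} {S : Subalgebra ℂ (P → ℂ)} (g : Gr m) :
    (fun _ => g) ∈ grFunctions m S :=
  const_mem_coordFunctions g

theorem algebraMap_mem_grFunctions {P : Type*} {S : Subalgebra ℂ (P → ℂ)} {c : P → ℂ}
    (hc : c ∈ S) : (fun p => algebraMap ℂ (Gr m) (c p)) ∈ grFunctions m S := by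
  simpa [Algebra.algebraMap_eq_smul_one] using
    smul_mem_grFunctions hc (const_mem_grFunctions (1 : Gr m))

theorem smul_mem_bosFunctions {P : Type*} {S : Subalgebra ℂ (P → ℂ)} {c : P → ℂ} {F : P → Bos m}
    (hc : c ∈ S) (hF : F ∈ bosFunctions m S) : (fun p => c p • F p) ∈ bosFunctions m S :=
  smul_mem_grFunctions hc hF

theorem det_mem_bosFunctions {P n : Type*} [Fintype n] [DecidableEq n]
    {S : Subalgebra ℂ (P → ℂ)} {M : P → Matrix n n (Bos m)}
    (hM : ∀ i j, (fun p => M p i j) ∈ bosFunctions m S) :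
    (fun p => (M p).det) ∈ bosFunctions m S := by
  have : (fun p => (M p).det) = ∑ π : Equiv.Perm n,
      algebraMap ℂ (P → Bos m) ((Equiv.Perm.sign π : ℤ) : ℂ) * ∏ i, fun p => M p (π i) i := by
    funext p
    rw [Matrix.det_apply', Finset.sum_apply]
    refine Finset.sum_congr rfl fun π _ => ?_
    rw [Pi.mul_apply, Finset.prod_apply, Pi.algebraMap_apply, map_intCast]
  rw [this]
  exact sum_mem fun π _ => mul_mem (Subalgebra.algebraMap_mem _ _) (prod_mem fun i _ => hM _ _)

/-! ### Derivatives of functions with values in the Grassmann algebra -/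

theorem HasGrDerivAt.const (g : Gr m) (t : ℂ) : HasGrDerivAt (fun _ => g) 0 t := fun l => by
  simpa using hasDerivAt_const t (l g)

theorem HasGrDerivAt.add {f g : ℂ → Gr m} {f' g' : Gr m} {t : ℂ} (hf : HasGrDerivAt f f' t)
    (hg : HasGrDerivAt g g' t) : HasGrDerivAt (fun s => f s + g s) (f' + g') t := fun l => by
  simpa using (hf l).fun_add (hg l)

theorem HasGrDerivAt.mul {f g : ℂ → Gr m} {f' g' : Gr m} {t : ℂ} (hf : HasGrDerivAt f f' t)
    (hg : HasGrDerivAt g g' t) : HasGrDerivAt (fun s => f s * g s) (f' * g t + f t * g') t := by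
  intro l
  let b := Module.finBasis ℂ (Gr m)
  have h : l (f' * g t + f t * g') = ∑ i, ∑ j, (b.coord i f' * b.coord j (g t)
      + b.coord i (f t) * b.coord j g') * l (b i * b j) := by
    rw [map_add, linear_mul_eq_sum b l f', linear_mul_eq_sum b l (f t)]
    simp only [← Finset.sum_add_distrib, ← add_mul]
  rw [h, funext fun s => linear_mul_eq_sum b l (f s) (g s)]
  exact HasDerivAt.fun_sum fun i _ => HasDerivAt.fun_sum fun j _ =>
    ((hf _).fun_mul (hg _)).mul_const _

theorem HasGrDerivAt.smul {c : ℂ → ℂ} {f : ℂ → Gr m} {c' : ℂ} {f' : Gr m} {t : ℂ}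
    (hc : HasDerivAt c c' t) (hf : HasGrDerivAt f f' t) :
    HasGrDerivAt (fun s => c s • f s) (c' • f t + c t • f') t := fun l => by
  simpa using hc.fun_mul (hf l)

theorem HasGrDerivAt.sum {ι : Type*} {u : Finset ι} {f : ι → ℂ → Gr m} {f' : ι → Gr m} {t : ℂ}
    (hf : ∀ i ∈ u, HasGrDerivAt (f i) (f' i) t) :
    HasGrDerivAt (fun s => ∑ i ∈ u, f i s) (∑ i ∈ u, f' i) t := fun l => by
  simpa using HasDerivAt.fun_sum fun i hi => hf i hi l

/-! ### Left derivatives on even elements -/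

/-- The elements on which all left odd derivatives obey the ungraded Leibniz rule. -/
def leibniz (m : ℕ) : Subalgebra ℂ (Gr m) where
  carrier := {g | ∀ a A, ∀ c, dTheta a A (g * c) = dTheta a A g * c + g * dTheta a A c}
  mul_mem' {x y} hx hy a A c := by
    rw [mul_assoc, hx, hy, hx, mul_add, add_mul]
    simp only [mul_assoc, add_assoc]
  add_mem' {x y} hx hy a A c := by
    rw [add_mul, map_add, hx, hy, map_add, add_mul, add_mul]
    abel
  algebraMap_mem' r a A c := by
    rw [dTheta, CliffordAlgebra.contractLeft_algebraMap_mul,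
      CliffordAlgebra.contractLeft_algebraMap, zero_mul, zero_add]

theorem dTheta_ι_mul (a : Fin 4) (A : Fin 2) (u : OddVar m → ℂ) (c : Gr m) :
    dTheta a A (ExteriorAlgebra.ι ℂ u * c)
      = u (Sum.inr (a, A)) • c - ExteriorAlgebra.ι ℂ u * dTheta a A c :=
  CliffordAlgebra.contractLeft_ι_mul (Q := 0) _ _ _

theorem dTheta_ι (a : Fin 4) (A : Fin 2) (u : OddVar m → ℂ) :
    dTheta a A (ExteriorAlgebra.ι ℂ u) = algebraMap ℂ (Gr m) (u (Sum.inr (a, A))) :=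
  CliffordAlgebra.contractLeft_ι (Q := 0) _ _

theorem dTheta_algebraMap (a : Fin 4) (A : Fin 2) (c : ℂ) :
    dTheta a A (algebraMap ℂ (Gr m) c) = 0 :=
  CliffordAlgebra.contractLeft_algebraMap (Q := 0) _ _

/-- The signs from passing two odd vectors cancel. Together with scalars these products generate the
exponent, X², the brackets and Z·W, so this is the only case that has to be checked. -/
theorem ι_mul_ι_mem_leibniz (u v : OddVar m → ℂ) :
    ExteriorAlgebra.ι ℂ u * ExteriorAlgebra.ι ℂ v ∈ leibniz m := by
  intro a A c
  rw [mul_assoc, dTheta_ι_mul, dTheta_ι_mul, dTheta_ι_mul, dTheta_ι, mul_sub, sub_mul,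
    smul_mul_assoc, mul_smul_comm, mul_assoc, mul_assoc, ← Algebra.smul_def, mul_smul_comm]
  abel

/-- The Berezin integral is the product of all eight odd derivatives. These anticommute and square
to zero, so one more derivative can be moved next to its own copy. -/
theorem berezin_dTheta (a : Fin 4) (A : Fin 2) (g : Gr m) : berezin (dTheta a A g) = 0 := by
  have hc (a b : Fin 4) (A B : Fin 2) (g : Gr m) :
      dTheta a A (dTheta b B g) = -dTheta b B (dTheta a A g) :=
    CliffordAlgebra.contractLeft_comm _ _ _
  have hs (a : Fin 4) (A : Fin 2) (g : Gr m) : dTheta a A (dTheta a A g) = 0 :=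
    CliffordAlgebra.contractLeft_contractLeft _ _
  have key : ∀ L : List (Fin 4 × Fin 2), (a, A) ∈ L → ∀ g : Gr m,
      (L.map fun v => (dTheta v.1 v.2 : Module.End ℂ (Gr m))).prod (dTheta a A g) = 0 := by
    intro L
    induction L with
    | nil => intro h; simp at h
    | cons v L ih =>
      intro h g
      rw [List.map_cons, List.prod_cons, Module.End.mul_apply]
      by_cases hL : (a, A) ∈ L
      · rw [ih hL, map_zero]
      · have hv : (a, A) = v := by simpa [hL] using h
        subst hv
        -- Pulling the derivative through the tail to the left costs only signs, which are absorbed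
        -- into `g'`; it then meets the equal head of the list.
        have : ∀ (L : List (Fin 4 × Fin 2)) (g : Gr m), ∃ g' : Gr m,
            (L.map fun v => (dTheta v.1 v.2 : Module.End ℂ (Gr m))).prod (dTheta a A g)
              = dTheta a A g' := by
          intro L
          induction L with
          | nil => intro g; exact ⟨g, rfl⟩
          | cons v L ih =>
            intro g
            obtain ⟨g', hg'⟩ := ih g
            exact ⟨-dTheta v.1 v.2 g', by
              rw [List.map_cons, List.prod_cons, Module.End.mul_apply, hg', hc, map_neg]⟩
        obtain ⟨g', hg'⟩ := this L g
        rw [hg', hs]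
  have : (berezin : Gr m →ₗ[ℂ] Gr m)
      = (((List.finRange 4).flatMap fun a => [(a, (0 : Fin 2)), (a, 1)]).map
          fun v => (dTheta v.1 v.2 : Module.End ℂ (Gr m))).prod := by
    simp [berezin, List.map_flatMap]
  rw [this]
  refine key _ ?_ g
  fin_cases A <;> simp

/-! ### Derivatives of functions with values in the center -/

/-- The complex derivative of a function with values in the commuting elements. -/
def HasBosDerivAt (f : ℂ → Bos m) (f' : Bos m) (t : ℂ) : Prop :=
  HasGrDerivAt (fun s => (f s : Gr m)) (f' : Gr m) t

theorem HasBosDerivAt.const (g : Bos m) (t : ℂ) : HasBosDerivAt (fun _ => g) 0 t :=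
  HasGrDerivAt.const _ _

theorem HasBosDerivAt.congr_deriv {f : ℂ → Bos m} {f' g' : Bos m} {t : ℂ}
    (hf : HasBosDerivAt f f' t) (h : f' = g') : HasBosDerivAt f g' t :=
  h ▸ hf

theorem HasBosDerivAt.add {f g : ℂ → Bos m} {f' g' : Bos m} {t : ℂ} (hf : HasBosDerivAt f f' t)
    (hg : HasBosDerivAt g g' t) : HasBosDerivAt (fun s => f s + g s) (f' + g') t :=
  HasGrDerivAt.add hf hg

theorem HasBosDerivAt.mul {f g : ℂ → Bos m} {f' g' : Bos m} {t : ℂ} (hf : HasBosDerivAt f f' t)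
    (hg : HasBosDerivAt g g' t) : HasBosDerivAt (fun s => f s * g s) (f' * g t + f t * g') t :=
  HasGrDerivAt.mul hf hg

theorem HasBosDerivAt.smul {c : ℂ → ℂ} {f : ℂ → Bos m} {c' : ℂ} {f' : Bos m} {t : ℂ}
    (hc : HasDerivAt c c' t) (hf : HasBosDerivAt f f' t) :
    HasBosDerivAt (fun s => c s • f s) (c' • f t + c t • f') t :=
  HasGrDerivAt.smul hc hf

theorem HasBosDerivAt.smul_const {c : ℂ → ℂ} {c' : ℂ} {t : ℂ} (hc : HasDerivAt c c' t)
    (g : Bos m) : HasBosDerivAt (fun s => c s • g) (c' • g) t := by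
  have h := HasBosDerivAt.smul hc (.const g t)
  rwa [smul_zero, add_zero] at h

theorem HasBosDerivAt.const_smul {f : ℂ → Bos m} {f' : Bos m} {t : ℂ} (c : ℂ)
    (hf : HasBosDerivAt f f' t) : HasBosDerivAt (fun s => c • f s) (c • f') t := by
  have h := HasBosDerivAt.smul (hasDerivAt_const t c) hf
  rwa [zero_smul, zero_add] at h

theorem HasBosDerivAt.const_mul {f : ℂ → Bos m} {f' : Bos m} {t : ℂ} (c : Bos m)
    (hf : HasBosDerivAt f f' t) : HasBosDerivAt (fun s => c * f s) (c * f') t := by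
  have h := HasBosDerivAt.mul (.const c t) hf
  rwa [zero_mul, zero_add] at h

theorem HasBosDerivAt.sum {ι : Type*} {u : Finset ι} {f : ι → ℂ → Bos m} {f' : ι → Bos m} {t : ℂ}
    (hf : ∀ i ∈ u, HasBosDerivAt (f i) (f' i) t) :
    HasBosDerivAt (fun s => ∑ i ∈ u, f i s) (∑ i ∈ u, f' i) t := by
  have h := HasGrDerivAt.sum hf
  simpa only [HasBosDerivAt, AddSubmonoidClass.coe_finsetSum] using h

theorem HasBosDerivAt.prod {ι : Type*} [DecidableEq ι] {u : Finset ι} {f : ι → ℂ → Bos m}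
    {f' : ι → Bos m} {t : ℂ} (hf : ∀ i ∈ u, HasBosDerivAt (f i) (f' i) t) :
    HasBosDerivAt (fun s => ∏ i ∈ u, f i s) (∑ i ∈ u, (∏ j ∈ u.erase i, f j t) * f' i) t := by
  induction u using Finset.induction_on with
  | empty => simpa using HasBosDerivAt.const (1 : Bos m) t
  | insert a u ha ih =>
    have h := (hf a (by simp)).mul (ih fun i hi => hf i (by simp [hi]))
    simp only [Finset.prod_insert ha]
    convert h using 1
    rw [Finset.sum_insert ha, Finset.erase_insert ha, mul_comm, Finset.mul_sum]
    refine congrArg _ (Finset.sum_congr rfl fun i hi => ?_)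
    have hai : a ≠ i := fun h => ha (h ▸ hi)
    rw [Finset.erase_insert_of_ne hai, Finset.prod_insert (by simp [ha]), mul_assoc]

/-! ### Determinants whose diagonal varies -/

/-- Replacing column i by the i-th unit vector makes the matrix block triangular with a block 1, so
its determinant is the principal minor. The permutation expansion of that determinant keeps only the
permutations that fix i. -/
theorem det_minor_eq_sum {n R : Type*} [Fintype n] [DecidableEq n] [CommRing R] (M : Matrix n n R)
    (i : n) :
    (M.submatrix (Subtype.val : {j // j ≠ i} → n) Subtype.val).det
      = ∑ π : Equiv.Perm n, ((Equiv.Perm.sign π : ℤ) : R) *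
          ((∏ j ∈ Finset.univ.erase i, M (π j) j) * if π i = i then 1 else 0) := by
  have h := Matrix.twoBlockTriangular_det (M.updateCol i (Pi.single i 1)) (fun j => j = i) (by
    rintro j hj k rfl
    simp [hj])
  have h₂ : (M.updateCol i (Pi.single i 1)).toSquareBlockProp (fun j => ¬j = i)
      = M.submatrix (Subtype.val : {j // j ≠ i} → n) Subtype.val := by
    ext a b
    simp [Matrix.toSquareBlockProp, Matrix.updateCol_ne b.2]
  have h₁ (_ : Fintype {j // j = i}) (_ : DecidableEq {j // j = i}) :
      ((M.updateCol i (Pi.single i 1)).toSquareBlockProp fun j => j = i).det = 1 := by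
    rw [Matrix.det_eq_elem_of_subsingleton _ ⟨i, rfl⟩]
    simp [Matrix.toSquareBlockProp]
  rw [h₁, one_mul, h₂] at h
  rw [← h, Matrix.det_apply']
  refine Finset.sum_congr rfl fun π _ => ?_
  congr 1
  rw [← Finset.mul_prod_erase _ _ (Finset.mem_univ i), mul_comm]
  congr 1
  · refine Finset.prod_congr rfl fun j hj => ?_
    rw [Matrix.updateCol_ne (Finset.ne_of_mem_erase hj)]
  · simp [Pi.single_apply]

/-- Brings the sum of principal minors into the shape that the product rule produces from the
permutation expansion of the full determinant. -/
theorem sum_det_minor_mul {n R : Type*} [Fintype n] [DecidableEq n] [CommRing R]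
    (M : Matrix n n R) (d : n → R) :
    ∑ i, (M.submatrix (Subtype.val : {j // j ≠ i} → n) Subtype.val).det * d i
      = ∑ π : Equiv.Perm n, ((Equiv.Perm.sign π : ℤ) : R) *
          ∑ i, (∏ j ∈ Finset.univ.erase i, M (π j) j) * if π i = i then d i else 0 := by
  simp only [Finset.mul_sum, det_minor_eq_sum, Finset.sum_mul]
  rw [Finset.sum_comm]
  refine Finset.sum_congr rfl fun π _ => Finset.sum_congr rfl fun i _ => ?_
  split_ifs <;> ring

/-- Jacobi's formula: off-diagonal entries are stationary, so of all cofactors only the principal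
minors survive. -/
theorem HasBosDerivAt.det {n : Type*} [Fintype n] [DecidableEq n] {M : ℂ → Matrix n n (Bos m)}
    {d : n → Bos m} {t : ℂ}
    (hM : ∀ i j, HasBosDerivAt (fun s => M s i j) (if i = j then d j else 0) t) :
    HasBosDerivAt (fun s => (M s).det)
      (∑ i, ((M t).submatrix (Subtype.val : {j // j ≠ i} → n) Subtype.val).det * d i) t := by
  have h := HasBosDerivAt.sum (u := Finset.univ) fun (π : Equiv.Perm n) _ =>
    (HasBosDerivAt.prod (u := Finset.univ) fun i _ => hM (π i) i).const_mul
      ((Equiv.Perm.sign π : ℤ) : Bos m)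
  rw [funext fun s => Matrix.det_apply' (M s), sum_det_minor_mul (M t) d]
  exact h

/-! ### Sums over distinct indices -/

/-- An injective (k+1)-tuple is an injective k-tuple together with one index outside its range. The
index newly removed by differentiating a determinant is thereby stored in the last place. -/
theorem sum_embedding_succ {R : Type*} [AddCommMonoid R] {k n : ℕ}
    (f : (Fin k ↪ Fin n) → Fin n → R) :
    ∑ p : Fin k ↪ Fin n, ∑ j : {j : Fin n // ∀ t, p t ≠ j}, f p j
      = ∑ p : Fin (k + 1) ↪ Fin n, f (Fin.castSuccEmb.trans p) (p (Fin.last k)) := by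
  rw [← Fintype.sum_sigma' fun (p : Fin k ↪ Fin n) (j : {j : Fin n // ∀ t, p t ≠ j}) => f p j]
  refine (Fintype.sum_bijective (fun p : Fin (k + 1) ↪ Fin n =>
    (⟨Fin.castSuccEmb.trans p, ⟨p (Fin.last k), fun t h =>
      (Fin.castSucc_lt_last t).ne (p.injective h)⟩⟩ :
        Σ p : Fin k ↪ Fin n, {j : Fin n // ∀ t, p t ≠ j})) ⟨?_, ?_⟩ _ _ fun p => rfl).symm
  · intro p q h
    have h₁ := congrArg (fun z => (z.1 : Fin k → Fin n)) h
    have h₂ := congrArg (fun z => (z.2 : Fin n)) h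
    ext t
    refine Fin.lastCases ?_ (fun s => ?_) t
    · exact congrArg Fin.val h₂
    · exact congrArg Fin.val (congrFun h₁ s)
  · rintro ⟨p, j, hj⟩
    refine ⟨⟨Fin.snoc p j, Fin.snoc_injective_iff.2 ⟨p.injective, ?_⟩⟩, ?_⟩
    · rintro ⟨t, ht⟩
      exact hj t ht
    · refine Sigma.ext ?_ ?_
      · ext t
        simp
      · have : (Fin.castSuccEmb.trans ⟨Fin.snoc p j, Fin.snoc_injective_iff.2 ⟨p.injective, by
            rintro ⟨t, ht⟩; exact hj t ht⟩⟩ : Fin k ↪ Fin n) = p := by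
          ext t
          simp
        refine (Subtype.heq_iff_coe_eq fun x => ?_).2 ?_
        · simp
        · simp

theorem sum_embedding_perm {R : Type*} [AddCommMonoid R] {k n : ℕ} (π : Equiv.Perm (Fin k))
    (f : (Fin k ↪ Fin n) → R) :
    ∑ p : Fin k ↪ Fin n, f (π.toEmbedding.trans p) = ∑ p : Fin k ↪ Fin n, f p :=
  Fintype.sum_equiv (π.symm.embeddingCongr (Equiv.refl _)) _ _ fun p => congrArg f (by
    ext; simp)

/-- Only the set of removed indices matters; this symmetry justifies every relabelling below. -/
theorem Kin.redDet_perm (D : Kin m) (ξ : Fin 2 → ℂ) {k : ℕ} (π : Equiv.Perm (Fin k))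
    (p : Fin k → Fin m) : D.redDet ξ (p ∘ π) = D.redDet ξ p := by
  let e : {j : Fin m // ∀ t, (p ∘ π) t ≠ j} ≃ {j : Fin m // ∀ t, p t ≠ j} :=
    Equiv.subtypeEquivRight fun j => by
      rw [π.forall_congr_left]
      simp
  exact Matrix.det_submatrix_equiv_self e ((D.hodges ξ).submatrix
    (fun j : {j : Fin m // ∀ t, p t ≠ j} => (Sum.inr j.1 : Pt m)) fun j => (Sum.inr j.1 : Pt m))

theorem Kin.redDet_succ (D : Kin m) (ξ : Fin 2 → ℂ) {k : ℕ} (p : Fin k → Fin m)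
    (p' : Fin (k + 1) → Fin m) (j : {j : Fin m // ∀ t, p t ≠ j}) (hp : ∀ t, p' t.castSucc = p t)
    (hj : p' (Fin.last k) = j) :
    (((D.hodges ξ).submatrix (fun j : {j : Fin m // ∀ t, p t ≠ j} => (Sum.inr j.1 : Pt m))
      (fun j => (Sum.inr j.1 : Pt m))).submatrix (Subtype.val : {i // i ≠ j} → _)
        Subtype.val).det = D.redDet ξ p' := by
  let e : {i : {j : Fin m // ∀ t, p t ≠ j} // i ≠ j} ≃ {i : Fin m // ∀ t, p' t ≠ i} :=
    { toFun := fun i => ⟨i.1.1, fun t => by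
        refine Fin.lastCases ?_ (fun s => ?_) t
        · rw [hj]
          exact fun h => i.2 (Subtype.ext h.symm)
        · rw [hp]
          exact i.1.2 s⟩
      invFun := fun i => ⟨⟨i.1, fun t => by rw [← hp]; exact i.2 _⟩, fun h =>
        i.2 (Fin.last k) (by rw [hj, ← h])⟩
      left_inv := fun _ => rfl
      right_inv := fun _ => rfl }
  exact Matrix.det_submatrix_equiv_self e ((D.hodges ξ).submatrix
    (fun j : {j : Fin m // ∀ t, p' t ≠ j} => (Sum.inr j.1 : Pt m)) fun j => (Sum.inr j.1 : Pt m))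

/-! ### Variation of the reference spinor -/

theorem spin_swap (a b : Fin 2 → ℂ) : spin a b = -spin b a := by
  simp only [spin]
  ring

theorem spin_ne_zero_swap {a b : Fin 2 → ℂ} (h : spin a b ≠ 0) : spin b a ≠ 0 := by
  rw [spin_swap]
  exact neg_ne_zero.2 h

theorem hasDerivAt_spinor (ξ ζ : Fin 2 → ℂ) (A : Fin 2) :
    HasDerivAt (fun t : ℂ => (ξ + t • ζ) A) (ζ A) 0 := by
  simpa using ((hasDerivAt_id (0 : ℂ)).mul_const (ζ A)).const_add (ξ A)

theorem hasDerivAt_spin (ξ ζ a : Fin 2 → ℂ) :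
    HasDerivAt (fun t : ℂ => spin (ξ + t • ζ) a) (spin ζ a) 0 :=
  ((hasDerivAt_spinor ξ ζ 0).mul_const _).sub ((hasDerivAt_spinor ξ ζ 1).mul_const _)

theorem hasDerivAt_spin' (ξ ζ a : Fin 2 → ℂ) :
    HasDerivAt (fun t : ℂ => spin a (ξ + t • ζ)) (spin a ζ) 0 :=
  ((hasDerivAt_spinor ξ ζ 1).const_mul _).sub ((hasDerivAt_spinor ξ ζ 0).const_mul _)

/-- This coefficient and the two that follow are homogeneous of degree zero in ξ, so their
derivatives vanish along ξ and are multiples of (ξζ). Here the Schouten identity (ζb)(ξa) - (ξb)(ζa)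
= (ξζ)(ab) also cancels the pole in (ab). -/
theorem hasDerivAt_hodgesCoeff (ξ ζ a b : Fin 2 → ℂ) (ha : spin ξ a ≠ 0) (hab : spin a b ≠ 0) :
    HasDerivAt (fun t : ℂ => -((spin (ξ + t • ζ) b) ^ 2 / (spin (ξ + t • ζ) a) ^ 2
      * -(1 / spin a b))) (2 * spin ξ ζ / (spin a ξ) ^ 3 * spin b ξ) 0 := by
  have ha' := spin_ne_zero_swap ha
  have h := ((((hasDerivAt_spin ξ ζ b).fun_pow 2).fun_div ((hasDerivAt_spin ξ ζ a).fun_pow 2)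
    (by simpa using ha)).mul_const (-(1 / spin a b))).fun_neg
  refine h.congr_deriv ?_
  simp only [zero_smul, add_zero, Nat.cast_ofNat, Nat.add_one_sub_one, pow_one]
  rw [spin_swap a ξ, spin_swap b ξ]
  symm
  field_simp
  simp only [spin]
  ring

/-- The result does not depend on a, which makes the variations of ψ^1 and ψ^2 equal. Indeed (ξa)s =
(ξs)a - (as)ξ, so the symmetric product of s with the differentiated spinor is c (aa/(as)² -
ξξ/(ξs)²), where a enters through a constant only. -/
theorem hasDerivAt_psiCoeff (c : ℂ) (ξ ζ a s : Fin 2 → ℂ) (A : Fin 2) (hs : spin ξ s ≠ 0)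
    (ha : spin a s ≠ 0) :
    HasDerivAt (fun t : ℂ => c * spin (ξ + t • ζ) a / ((spin a s) ^ 2 * (spin (ξ + t • ζ) s) ^ 2)
      * (spin (ξ + t • ζ) s * a A + spin a s * (ξ + t • ζ) A))
      (2 * c * spin ξ ζ / (spin s ξ) ^ 3 * ξ A) 0 := by
  have h := (((hasDerivAt_spin ξ ζ a).const_mul c).fun_div
    (((hasDerivAt_spin ξ ζ s).fun_pow 2).const_mul ((spin a s) ^ 2))
    (by simpa using ⟨ha, hs⟩)).fun_mul
    (((hasDerivAt_spin ξ ζ s).mul_const (a A)).fun_add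
      ((hasDerivAt_spinor ξ ζ A).const_mul (spin a s)))
  refine h.congr_deriv ?_
  simp only [zero_smul, add_zero, Nat.cast_ofNat, Nat.add_one_sub_one, pow_one]
  rw [spin_swap s ξ]
  symm
  field_simp
  fin_cases A <;> simp [spin] <;> ring

theorem hasDerivAt_omegaCoeff (c : ℂ) (ξ ζ a s t : Fin 2 → ℂ) (hs : spin ξ s ≠ 0)
    (ht : spin ξ t ≠ 0) (has : spin a s ≠ 0) (hat : spin a t ≠ 0) :
    HasDerivAt (fun u : ℂ => c * (spin a (ξ + u • ζ)) ^ 4 * spin s t /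
        ((spin a s) ^ 2 * (spin a t) ^ 2 * (spin (ξ + u • ζ) s) ^ 2 * (spin (ξ + u • ζ) t) ^ 2))
      (2 * c * spin s t * (spin a ξ) ^ 3 /
        ((spin a s) ^ 2 * (spin a t) ^ 2 * (spin s ξ) ^ 3 * (spin t ξ) ^ 3) *
        (spin t ξ * spin s a + spin s ξ * spin t a) * spin ξ ζ) 0 := by
  have h := ((((hasDerivAt_spin' ξ ζ a).fun_pow 4).const_mul c).mul_const (spin s t)).fun_div
    ((((hasDerivAt_spin ξ ζ s).fun_pow 2).const_mul ((spin a s) ^ 2 * (spin a t) ^ 2)).fun_mul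
      ((hasDerivAt_spin ξ ζ t).fun_pow 2)) (by simpa using ⟨⟨⟨has, hat⟩, hs⟩, ht⟩)
  refine h.congr_deriv ?_
  simp only [zero_smul, add_zero, Nat.cast_ofNat, Nat.add_one_sub_one, pow_one]
  rw [spin_swap s ξ, spin_swap t ξ, spin_swap s a, spin_swap t a]
  symm
  field_simp
  simp only [spin]
  ring

/-- Lets 𝒫·ξ in `Kin.dHodges` run over all particles although the diagonal entry of the Hodges
matrix omits k = i. -/
theorem Kin.brW_self (D : Kin m) (i : Pt m) : D.brW i i = 0 := by
  refine Subtype.ext ?_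
  have h (a : Fin 4) : D.W i (Sum.inr a) * D.W i (Sum.inr a) = 0 := ExteriorAlgebra.ι_sq_zero _
  have hc (α β : Fin 4) : D.W i (Sum.inl α) * D.W i (Sum.inl β)
      = D.W i (Sum.inl β) * D.W i (Sum.inl α) := Algebra.commutes _ _
  change ∑ I, ∑ J, infUpper D.Λ D.r I J • (D.W i J * D.W i I) = 0
  simp only [Fintype.sum_sum_type, infUpper, Matrix.fromBlocks_apply₁₁, Matrix.fromBlocks_apply₁₂,
    Matrix.fromBlocks_apply₂₁, Matrix.fromBlocks_apply₂₂, Matrix.zero_apply, zero_smul,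
    Finset.sum_const_zero, add_zero, Matrix.smul_apply, Matrix.one_apply, smul_eq_mul,
    mul_ite, mul_one, mul_zero, ite_smul, Finset.sum_ite_eq, Finset.mem_univ, if_true, h, smul_zero]
  simp only [Fin.sum_univ_four, Matrix.of_apply, Matrix.cons_val, zero_smul, add_zero, zero_add,
    neg_smul, one_smul, hc 1 0, hc 3 2]
  abel

theorem Kin.ZW_eq (D : Kin m) (x : BosX) (s : Fin 2 → ℂ) (i : Pt m) :
    D.ZW x s i = s 0 • D.ZW x ![1, 0] i + s 1 • D.ZW x ![0, 1] i := by
  refine Subtype.ext ?_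
  change ∑ I, Zmap m x s I * D.W i I = s 0 • (∑ I, Zmap m x ![1, 0] I * D.W i I)
    + s 1 • ∑ I, Zmap m x ![0, 1] I * D.W i I
  rw [Finset.smul_sum, Finset.smul_sum, ← Finset.sum_add_distrib]
  refine Finset.sum_congr rfl fun I _ => ?_
  simp only [Zmap, Fin.sum_univ_two, Matrix.cons_val_zero, Matrix.cons_val_one, one_smul,
    zero_smul, add_zero, zero_add, add_mul, smul_mul_assoc]

theorem Kin.hasBosDerivAt_hodges (D : Kin m) (ξ ζ : Fin 2 → ℂ) (h : Regular D.σ ξ)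
    (i j : Fin m) :
    HasBosDerivAt (fun t : ℂ => D.hodges (ξ + t • ζ) (Sum.inr i) (Sum.inr j))
      (if i = j then D.dHodges ξ ζ j else 0) 0 := by
  by_cases hij : i = j
  · subst hij
    simp only [if_true, Kin.hodges, Kin.dHodges]
    have hd := HasBosDerivAt.sum (u := Finset.univ.erase (Sum.inr i : Pt m)) fun k hk =>
      HasBosDerivAt.smul_const (hasDerivAt_hodgesCoeff ξ ζ (D.σ (Sum.inr i)) (D.σ k) (h.2 i)
        (h.1 _ _ (Finset.ne_of_mem_erase hk).symm)) (D.brW (Sum.inr i) k)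
    rw [Finset.smul_sum, ← Finset.add_sum_erase _ _ (Finset.mem_univ (Sum.inr i : Pt m)),
      D.brW_self, smul_zero, smul_zero, zero_add]
    simp only [← Finset.sum_neg_distrib, smul_smul, ← neg_smul]
    exact hd
  · have : (Sum.inr i : Pt m) ≠ Sum.inr j := fun h => hij (Sum.inr_injective h)
    simp only [Kin.hodges, if_neg hij, if_neg this]
    exact HasBosDerivAt.const _ _

theorem Kin.hasBosDerivAt_psi (D : Kin m) (ξ ζ : Fin 2 → ℂ) (h : Regular D.σ ξ) (x : BosX)
    (q : Fin 2) (i : Fin m) :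
    HasBosDerivAt (fun t : ℂ => D.psi (ξ + t • ζ) x q i) (D.dPsi ξ ζ x i) 0 := by
  have hd (A : Fin 2) := hasDerivAt_psiCoeff (Complex.I * D.Λ) ξ ζ (D.σ (Sum.inl q))
    (D.σ (Sum.inr i)) A (h.2 i) (h.1 _ _ (by simp))
  have hs := (HasBosDerivAt.smul_const (hd 0) (D.ZW x ![1, 0] (Sum.inr i))).add
    (HasBosDerivAt.smul_const (hd 1) (D.ZW x ![0, 1] (Sum.inr i)))
  have e (t : ℂ) := D.ZW_eq x (ξ + t • ζ) (Sum.inr i)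
  simp only [Kin.psi, Kin.dPsi]
  rw [D.ZW_eq x (D.σ (Sum.inl q)), D.ZW_eq x ξ]
  simp only [e]
  convert hs using 1
  · funext t
    module
  · module

theorem Kin.hasBosDerivAt_omega (D : Kin m) (ξ ζ : Fin 2 → ℂ) (h : Regular D.σ ξ)
    (q : Fin 2) (i j : Fin m) :
    HasBosDerivAt (fun t : ℂ => D.omega (ξ + t • ζ) q i j) (D.dOmega ξ ζ q i j) 0 :=
  HasBosDerivAt.smul_const (hasDerivAt_omegaCoeff D.Λ ξ ζ (D.σ (Sum.inl q)) (D.σ (Sum.inr i))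
    (D.σ (Sum.inr j)) (h.2 i) (h.2 j) (h.1 _ _ (by simp)) (h.1 _ _ (by simp))) _

theorem Kin.hasBosDerivAt_redDet (D : Kin m) (ξ ζ : Fin 2 → ℂ) (h : Regular D.σ ξ) {k : ℕ}
    (p : Fin k → Fin m) :
    HasBosDerivAt (fun t : ℂ => D.redDet (ξ + t • ζ) p)
      (∑ j : {j : Fin m // ∀ t, p t ≠ j},
        D.redDet ξ (Fin.snoc p j.1 : Fin (k + 1) → Fin m) * D.dHodges ξ ζ j) 0 := by
  have hd := HasBosDerivAt.det (m := m) (t := 0) (n := {j : Fin m // ∀ t, p t ≠ j})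
    (M := fun t => (D.hodges (ξ + t • ζ)).submatrix
      (fun j : {j : Fin m // ∀ t, p t ≠ j} => (Sum.inr j.1 : Pt m))
      (fun j => (Sum.inr j.1 : Pt m))) (d := fun j => D.dHodges ξ ζ j) (by
    intro i j
    have := D.hasBosDerivAt_hodges ξ ζ h i j
    simpa only [Matrix.submatrix_apply, Subtype.ext_iff] using this)
  refine hd.congr_deriv (Finset.sum_congr rfl fun j _ => ?_)
  rw [zero_smul, add_zero, D.redDet_succ ξ p (Fin.snoc p j.1) j (by simp) (by simp)]

/-- The product rule for one sum of the integrand. Varying the prefactor keeps the number of removed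
rows; varying the determinant raises it by one and produces d_ξ ℍ at the new index. -/
theorem Kin.hasBosDerivAt_sum_redDet (D : Kin m) (ξ ζ : Fin 2 → ℂ) (h : Regular D.σ ξ) {k : ℕ}
    {G : (Fin k ↪ Fin m) → ℂ → Bos m} {G' : (Fin k ↪ Fin m) → Bos m}
    (hG : ∀ p, HasBosDerivAt (G p) (G' p) 0) :
    HasBosDerivAt (fun t : ℂ => ∑ p : Fin k ↪ Fin m, G p t * D.redDet (ξ + t • ζ) p)
      (∑ p : Fin k ↪ Fin m, G' p * D.redDet ξ p
        + ∑ p : Fin (k + 1) ↪ Fin m, G (Fin.castSuccEmb.trans p) 0 *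
            (D.redDet ξ p * D.dHodges ξ ζ (p (Fin.last k)))) 0 := by
  have hd := HasBosDerivAt.sum (u := Finset.univ) fun p _ =>
    (hG p).mul (D.hasBosDerivAt_redDet ξ ζ h p)
  have e (p : Fin (k + 1) ↪ Fin m) :
      (Fin.snoc (Fin.castSuccEmb.trans p : Fin k ↪ Fin m) (p (Fin.last k)) :
        Fin (k + 1) → Fin m) = p := Fin.snoc_init_self (α := fun _ => Fin m) p
  have hs := sum_embedding_succ fun (p : Fin k ↪ Fin m) j =>
    G p 0 * (D.redDet ξ (Fin.snoc p j : Fin (k + 1) → Fin m) * D.dHodges ξ ζ j)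
  simp only [e] at hs
  refine hd.congr_deriv ?_
  rw [← hs, ← Finset.sum_add_distrib]
  refine Finset.sum_congr rfl fun p _ => ?_
  rw [zero_smul, add_zero, Finset.mul_sum]

theorem sum_embedding_zero {R : Type*} [AddCommMonoid R] {n : ℕ} (f : (Fin 0 → Fin n) → R) :
    ∑ p : Fin 0 ↪ Fin n, f p = f ![] := by
  rw [Fintype.sum_subsingleton _ (⟨![], fun i => i.elim0⟩ : Fin 0 ↪ Fin n)]
  rfl

/-- Pure bookkeeping over a commutative ring: the product rules for the six sums of the integrand,
sorted by the number of removed rows. No relabelling of indices is needed here. -/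
theorem sum_variations {R : Type*} [CommRing R] [Algebra ℂ R] (X : R) (ψ : Fin 2 → Fin m → R)
    (dψ dH : Fin m → R) (om dom : Fin 2 → Fin m → Fin m → R) (Δ : ∀ {k : ℕ}, (Fin k → Fin m) → R) :
    (∑ p : Fin 0 ↪ Fin m, 0 * Δ p + ∑ p : Fin 1 ↪ Fin m, X ^ 2 * (Δ p * dH (p (Fin.last 0))))
    + X * (∑ p : Fin 1 ↪ Fin m, (dψ (p 0) + dψ (p 0)) * Δ p
      + ∑ p : Fin 2 ↪ Fin m, (ψ 0 (Fin.castSuccEmb.trans p 0) + ψ 1 (Fin.castSuccEmb.trans p 0))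
        * (Δ p * dH (p (Fin.last 1))))
    + X * (∑ p : Fin 2 ↪ Fin m, (1 / 2 : ℂ) • (dom 0 (p 0) (p 1) + dom 1 (p 0) (p 1)) * Δ p
      + ∑ p : Fin 3 ↪ Fin m, (1 / 2 : ℂ) •
        (om 0 (Fin.castSuccEmb.trans p 0) (Fin.castSuccEmb.trans p 1)
          + om 1 (Fin.castSuccEmb.trans p 0) (Fin.castSuccEmb.trans p 1))
        * (Δ p * dH (p (Fin.last 2))))
    + (∑ p : Fin 2 ↪ Fin m, (dψ (p 0) * ψ 1 (p 1) + ψ 0 (p 0) * dψ (p 1)) * Δ p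
      + ∑ p : Fin 3 ↪ Fin m, ψ 0 (Fin.castSuccEmb.trans p 0) * ψ 1 (Fin.castSuccEmb.trans p 1)
        * (Δ p * dH (p (Fin.last 2))))
    + (∑ p : Fin 3 ↪ Fin m, (1 / 2 : ℂ) • (dψ (p 0) * om 1 (p 1) (p 2) + ψ 0 (p 0) * dom 1 (p 1) (p 2)
          + (dψ (p 0) * om 0 (p 1) (p 2) + ψ 1 (p 0) * dom 0 (p 1) (p 2))) * Δ p
      + ∑ p : Fin 4 ↪ Fin m, (1 / 2 : ℂ) • (ψ 0 (Fin.castSuccEmb.trans p 0)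
            * om 1 (Fin.castSuccEmb.trans p 1) (Fin.castSuccEmb.trans p 2)
          + ψ 1 (Fin.castSuccEmb.trans p 0)
            * om 0 (Fin.castSuccEmb.trans p 1) (Fin.castSuccEmb.trans p 2))
        * (Δ p * dH (p (Fin.last 3))))
    + (∑ p : Fin 4 ↪ Fin m, (1 / 4 : ℂ) • (dom 0 (p 0) (p 1) * om 1 (p 2) (p 3)
          + om 0 (p 0) (p 1) * dom 1 (p 2) (p 3)) * Δ p
      + ∑ p : Fin 5 ↪ Fin m, (1 / 4 : ℂ) •
        (om 0 (Fin.castSuccEmb.trans p 0) (Fin.castSuccEmb.trans p 1)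
          * om 1 (Fin.castSuccEmb.trans p 2) (Fin.castSuccEmb.trans p 3))
        * (Δ p * dH (p (Fin.last 4))))
    = ∑ p : Fin 1 ↪ Fin m, Δ p * (X ^ 2 * dH (p 0) + 2 * (X * dψ (p 0)))
    + ∑ p : Fin 2 ↪ Fin m, Δ p * (X * (ψ 0 (p 0) + ψ 1 (p 0)) * dH (p 1)
          + (1 / 2 : ℂ) • (X * (dom 0 (p 0) (p 1) + dom 1 (p 0) (p 1)))
          + dψ (p 0) * ψ 1 (p 1) + ψ 0 (p 0) * dψ (p 1))
    + ∑ p : Fin 3 ↪ Fin m, Δ p *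
        ((1 / 2 : ℂ) • (X * (om 0 (p 0) (p 1) + om 1 (p 0) (p 1)) * dH (p 2))
          + ψ 0 (p 0) * ψ 1 (p 1) * dH (p 2)
          + (1 / 2 : ℂ) • (dψ (p 0) * (om 1 (p 1) (p 2) + om 0 (p 1) (p 2)))
          + (1 / 2 : ℂ) • (ψ 0 (p 0) * dom 1 (p 1) (p 2) + ψ 1 (p 0) * dom 0 (p 1) (p 2)))
    + ∑ p : Fin 4 ↪ Fin m, Δ p *
        ((1 / 2 : ℂ) • ((ψ 0 (p 0) * om 1 (p 1) (p 2) + ψ 1 (p 0) * om 0 (p 1) (p 2)) * dH (p 3))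
          + (1 / 4 : ℂ) • (dom 0 (p 0) (p 1) * om 1 (p 2) (p 3)
              + om 0 (p 0) (p 1) * dom 1 (p 2) (p 3)))
    + ∑ p : Fin 5 ↪ Fin m, Δ p *
        (1 / 4 : ℂ) • (om 0 (p 0) (p 1) * om 1 (p 2) (p 3) * dH (p 4)) := by
  have e₁ : ∀ {k : ℕ} (p : Fin (k + 2) ↪ Fin m), Fin.castSuccEmb.trans p 0 = p 0 := fun _ => rfl
  have e₂ : ∀ {k : ℕ} (p : Fin (k + 3) ↪ Fin m), Fin.castSuccEmb.trans p 1 = p 1 := fun _ => rfl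
  have e₃ : ∀ {k : ℕ} (p : Fin (k + 4) ↪ Fin m), Fin.castSuccEmb.trans p 2 = p 2 := fun _ => rfl
  have e₄ : ∀ (p : Fin 5 ↪ Fin m), Fin.castSuccEmb.trans p 3 = p 3 := fun _ => rfl
  simp only [e₁, e₂, e₃, e₄, Fin.reduceLast, Algebra.smul_def, zero_mul, Finset.sum_const_zero,
    zero_add, mul_add X (Finset.sum _ _), Finset.mul_sum _ _ X]
  have comb₂ : ∀ {k : ℕ} {f g h : (Fin k ↪ Fin m) → R}, (∀ p, h p = f p + g p) →
      ∑ p, h p = ∑ p, f p + ∑ p, g p := fun H => by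
    rw [← Finset.sum_add_distrib]
    exact Finset.sum_congr rfl fun p _ => H p
  have comb₃ : ∀ {k : ℕ} {f g h u : (Fin k ↪ Fin m) → R}, (∀ p, u p = f p + g p + h p) →
      ∑ p, u p = ∑ p, f p + ∑ p, g p + ∑ p, h p := fun H => by
    rw [← Finset.sum_add_distrib, ← Finset.sum_add_distrib]
    exact Finset.sum_congr rfl fun p _ => H p
  rw [comb₂ (h := fun p : Fin 1 ↪ Fin m => Δ p * (X ^ 2 * dH (p 0) + 2 * (X * dψ (p 0))))
      (f := fun p => X ^ 2 * (Δ p * dH (p 0))) (g := fun p => X * ((dψ (p 0) + dψ (p 0)) * Δ p))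
      fun p => by ring,
    comb₃ (u := fun p : Fin 2 ↪ Fin m => Δ p * (X * (ψ 0 (p 0) + ψ 1 (p 0)) * dH (p 1)
        + algebraMap ℂ R (1 / 2) * (X * (dom 0 (p 0) (p 1) + dom 1 (p 0) (p 1)))
        + dψ (p 0) * ψ 1 (p 1) + ψ 0 (p 0) * dψ (p 1)))
      (f := fun p => X * ((ψ 0 (p 0) + ψ 1 (p 0)) * (Δ p * dH (p 1))))
      (g := fun p => X * (algebraMap ℂ R (1 / 2)
        * (dom 0 (p 0) (p 1) + dom 1 (p 0) (p 1)) * Δ p))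
      (h := fun p => (dψ (p 0) * ψ 1 (p 1) + ψ 0 (p 0) * dψ (p 1)) * Δ p) fun p => by ring,
    comb₃ (u := fun p : Fin 3 ↪ Fin m => Δ p *
        (algebraMap ℂ R (1 / 2) * (X * (om 0 (p 0) (p 1) + om 1 (p 0) (p 1)) * dH (p 2))
          + ψ 0 (p 0) * ψ 1 (p 1) * dH (p 2)
          + algebraMap ℂ R (1 / 2) * (dψ (p 0) * (om 1 (p 1) (p 2) + om 0 (p 1) (p 2)))
          + algebraMap ℂ R (1 / 2) *
            (ψ 0 (p 0) * dom 1 (p 1) (p 2) + ψ 1 (p 0) * dom 0 (p 1) (p 2))))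
      (f := fun p => X * (algebraMap ℂ R (1 / 2) * (om 0 (p 0) (p 1) + om 1 (p 0) (p 1))
        * (Δ p * dH (p 2))))
      (g := fun p => ψ 0 (p 0) * ψ 1 (p 1) * (Δ p * dH (p 2)))
      (h := fun p => algebraMap ℂ R (1 / 2) * (dψ (p 0) * om 1 (p 1) (p 2)
          + ψ 0 (p 0) * dom 1 (p 1) (p 2)
          + (dψ (p 0) * om 0 (p 1) (p 2) + ψ 1 (p 0) * dom 0 (p 1) (p 2))) * Δ p) fun p => by ring,
    comb₂ (h := fun p : Fin 4 ↪ Fin m => Δ p * (algebraMap ℂ R (1 / 2) *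
          ((ψ 0 (p 0) * om 1 (p 1) (p 2) + ψ 1 (p 0) * om 0 (p 1) (p 2)) * dH (p 3))
          + algebraMap ℂ R (1 / 4) * (dom 0 (p 0) (p 1) * om 1 (p 2) (p 3)
              + om 0 (p 0) (p 1) * dom 1 (p 2) (p 3))))
      (f := fun p => algebraMap ℂ R (1 / 2) * (ψ 0 (p 0) * om 1 (p 1) (p 2)
          + ψ 1 (p 0) * om 0 (p 1) (p 2)) * (Δ p * dH (p 3)))
      (g := fun p => algebraMap ℂ R (1 / 4) * (dom 0 (p 0) (p 1) * om 1 (p 2) (p 3)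
          + om 0 (p 0) (p 1) * dom 1 (p 2) (p 3)) * Δ p) fun p => by ring,
    Finset.sum_congr rfl fun (p : Fin 5 ↪ Fin m) _ => show Δ p * (algebraMap ℂ R (1 / 4) *
        (om 0 (p 0) (p 1) * om 1 (p 2) (p 3) * dH (p 4))) = algebraMap ℂ R (1 / 4) *
        (om 0 (p 0) (p 1) * om 1 (p 2) (p 3)) * (Δ p * dH (p 4)) by ring]
  ring

/-- The polynomial factor of `Kin.variation`. -/
def Kin.variationFactor (D : Kin m) (ξ ζ : Fin 2 → ℂ) (k : ℕ) (x : BosX) : Bos m :=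
  match k with
    | 3 => ∑ p : Fin 1 ↪ Fin m, D.redDet ξ p *
        (D.X2 x ^ 2 * D.dHodges ξ ζ (p 0) + 2 * (D.X2 x * D.dPsi ξ ζ x (p 0)))
    | 4 => ∑ p : Fin 2 ↪ Fin m, D.redDet ξ p *
        (D.X2 x * (D.psi ξ x 0 (p 0) + D.psi ξ x 1 (p 0)) * D.dHodges ξ ζ (p 1)
          + (1 / 2 : ℂ) • (D.X2 x *
              (D.dOmega ξ ζ 0 (p 0) (p 1) + D.dOmega ξ ζ 1 (p 0) (p 1)))
          + D.dPsi ξ ζ x (p 0) * D.psi ξ x 1 (p 1) + D.psi ξ x 0 (p 0) * D.dPsi ξ ζ x (p 1))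
    | 5 => ∑ p : Fin 3 ↪ Fin m, D.redDet ξ p *
        ((1 / 2 : ℂ) • (D.X2 x * (D.omega ξ 0 (p 0) (p 1) + D.omega ξ 1 (p 0) (p 1))
              * D.dHodges ξ ζ (p 2))
          + D.psi ξ x 0 (p 0) * D.psi ξ x 1 (p 1) * D.dHodges ξ ζ (p 2)
          + (1 / 2 : ℂ) • (D.dPsi ξ ζ x (p 0) *
              (D.omega ξ 1 (p 1) (p 2) + D.omega ξ 0 (p 1) (p 2)))
          + (1 / 2 : ℂ) • (D.psi ξ x 0 (p 0) * D.dOmega ξ ζ 1 (p 1) (p 2)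
              + D.psi ξ x 1 (p 0) * D.dOmega ξ ζ 0 (p 1) (p 2)))
    | 6 => ∑ p : Fin 4 ↪ Fin m, D.redDet ξ p *
        ((1 / 2 : ℂ) • ((D.psi ξ x 0 (p 0) * D.omega ξ 1 (p 1) (p 2)
              + D.psi ξ x 1 (p 0) * D.omega ξ 0 (p 1) (p 2)) * D.dHodges ξ ζ (p 3))
          + (1 / 4 : ℂ) • (D.dOmega ξ ζ 0 (p 0) (p 1) * D.omega ξ 1 (p 2) (p 3)
              + D.omega ξ 0 (p 0) (p 1) * D.dOmega ξ ζ 1 (p 2) (p 3)))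
    | 7 => ∑ p : Fin 5 ↪ Fin m, D.redDet ξ p *
        (1 / 4 : ℂ) • (D.omega ξ 0 (p 0) (p 1) * D.omega ξ 1 (p 2) (p 3) * D.dHodges ξ ζ (p 4))
    | _ => 0

theorem Kin.variation_eq (D : Kin m) (ξ ζ : Fin 2 → ℂ) (k : ℕ) (x : BosX) :
    D.variation ξ ζ k x = (D.variationFactor ξ ζ k x : Gr m) * D.wave x := rfl

/-- The polynomial factor of `Kin.integrand`. -/
def Kin.integrandFactor (D : Kin m) (x : BosX) (ξ : Fin 2 → ℂ) : Bos m :=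
  D.X2 x ^ 2 * D.redDet ξ ![]
    + D.X2 x * ∑ p : Fin 1 ↪ Fin m, (D.psi ξ x 0 (p 0) + D.psi ξ x 1 (p 0)) * D.redDet ξ p
    + D.X2 x * ∑ p : Fin 2 ↪ Fin m,
        (1 / 2 : ℂ) • ((D.omega ξ 0 (p 0) (p 1) + D.omega ξ 1 (p 0) (p 1)) * D.redDet ξ p)
    + ∑ p : Fin 2 ↪ Fin m, D.psi ξ x 0 (p 0) * D.psi ξ x 1 (p 1) * D.redDet ξ p
    + ∑ p : Fin 3 ↪ Fin m,
        (1 / 2 : ℂ) • ((D.psi ξ x 0 (p 0) * D.omega ξ 1 (p 1) (p 2)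
          + D.psi ξ x 1 (p 0) * D.omega ξ 0 (p 1) (p 2)) * D.redDet ξ p)
    + ∑ p : Fin 4 ↪ Fin m,
        (1 / 4 : ℂ) • (D.omega ξ 0 (p 0) (p 1) * D.omega ξ 1 (p 2) (p 3) * D.redDet ξ p)

theorem Kin.integrand_eq (D : Kin m) (x : BosX) (ξ : Fin 2 → ℂ) :
    D.integrand x ξ = (D.integrandFactor x ξ : Gr m) * D.wave x := rfl

theorem Kin.hasBosDerivAt_integrandFactor (D : Kin m) (ξ ζ : Fin 2 → ℂ) (h : Regular D.σ ξ)
    (x : BosX) :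
    HasBosDerivAt (fun t : ℂ => D.integrandFactor x (ξ + t • ζ))
      (D.variationFactor ξ ζ 3 x + D.variationFactor ξ ζ 4 x + D.variationFactor ξ ζ 5 x
        + D.variationFactor ξ ζ 6 x + D.variationFactor ξ ζ 7 x) 0 := by
  have hψ := D.hasBosDerivAt_psi ξ ζ h x
  have hω := D.hasBosDerivAt_omega ξ ζ h
  -- The leading term is read as a sum over the single empty tuple, so that it obeys the same rule
  -- as the others.
  have h₀ := D.hasBosDerivAt_sum_redDet ξ ζ h (k := 0) (G := fun _ _ => D.X2 x ^ 2)
    fun _ => .const _ _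
  have h₁ := (D.hasBosDerivAt_sum_redDet ξ ζ h (k := 1)
    fun p => (hψ 0 (p 0)).add (hψ 1 (p 0))).const_mul (D.X2 x)
  have h₂ := (D.hasBosDerivAt_sum_redDet ξ ζ h (k := 2)
    fun p => ((hω 0 (p 0) (p 1)).add (hω 1 (p 0) (p 1))).const_smul (1 / 2)).const_mul (D.X2 x)
  have h₃ := D.hasBosDerivAt_sum_redDet ξ ζ h (k := 2)
    fun p => (hψ 0 (p 0)).mul (hψ 1 (p 1))
  have h₄ := D.hasBosDerivAt_sum_redDet ξ ζ h (k := 3)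
    fun p => (((hψ 0 (p 0)).mul (hω 1 (p 1) (p 2))).add
      ((hψ 1 (p 0)).mul (hω 0 (p 1) (p 2)))).const_smul (1 / 2)
  have h₅ := D.hasBosDerivAt_sum_redDet ξ ζ h (k := 4)
    fun p => ((hω 0 (p 0) (p 1)).mul (hω 1 (p 2) (p 3))).const_smul (1 / 4)
  have hsum := ((((h₀.add h₁).add h₂).add h₃).add h₄).add h₅
  have e (t : ℂ) := sum_embedding_zero fun p => D.X2 x ^ 2 * D.redDet (ξ + t • ζ) p
  have hv := sum_variations (D.X2 x) (D.psi ξ x) (D.dPsi ξ ζ x) (D.dHodges ξ ζ) (D.omega ξ)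
    (D.dOmega ξ ζ) (D.redDet ξ)
  simp only [zero_smul, add_zero] at hsum
  rw [hv] at hsum
  simp only [e, smul_mul_assoc] at hsum
  exact hsum

theorem Kin.hasGrDerivAt_integrand (D : Kin m) (ξ ζ : Fin 2 → ℂ) (h : Regular D.σ ξ) (x : BosX) :
    HasGrDerivAt (fun t : ℂ => D.integrand x (ξ + t • ζ))
      (∑ k ∈ Finset.Icc 3 7, D.variation ξ ζ k x) 0 := by
  have hw := HasGrDerivAt.mul (D.hasBosDerivAt_integrandFactor ξ ζ h x) (.const (D.wave x) 0)
  rw [mul_zero, add_zero] at hw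
  have e : ∑ k ∈ Finset.Icc 3 7, D.variation ξ ζ k x
      = ((D.variationFactor ξ ζ 3 x + D.variationFactor ξ ζ 4 x + D.variationFactor ξ ζ 5 x
        + D.variationFactor ξ ζ 6 x + D.variationFactor ξ ζ 7 x : Bos m) : Gr m) * D.wave x := by
    rw [show Finset.Icc 3 7 = {3, 4, 5, 6, 7} from rfl]
    rw [Finset.sum_insert (by decide), Finset.sum_insert (by decide), Finset.sum_insert (by decide),
      Finset.sum_insert (by decide), Finset.sum_singleton]
    simp only [D.variation_eq, ← add_mul, ← add_assoc]
    rfl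
  rw [e]
  exact hw

/-! ### The wave function -/

theorem nilpotentExp_eq_sum {A : Type*} [Ring A] [Algebra ℂ A] [Module ℚ A] {a : A} {k : ℕ}
    (h : a ^ k = 0) :
    IsNilpotent.exp a = ∑ i ∈ Finset.range k, ((i.factorial : ℂ)⁻¹) • a ^ i := by
  rw [IsNilpotent.exp_eq_sum h]
  refine Finset.sum_congr rfl fun i _ => ?_
  rw [← Rat.cast_smul_eq_qsmul ℂ]
  simp

/-- Cayley–Hamilton for left multiplication. The exponent is the same for all nilpotent elements, so
the exponential of the soul is one fixed polynomial in it for all parameter values. -/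
theorem pow_finrank_eq_zero {A : Type*} [Ring A] [Algebra ℂ A] [Module.Finite ℂ A] {a : A}
    (h : IsNilpotent a) : a ^ Module.finrank ℂ A = 0 := by
  have hn : IsNilpotent (Algebra.lmul ℂ A a) := h.map (Algebra.lmul ℂ A)
  have hc := LinearMap.aeval_self_charpoly (Algebra.lmul ℂ A a)
  rw [IsNilpotent.charpoly_eq_X_pow_finrank hn, map_pow, Polynomial.aeval_X,
    ← map_pow] at hc
  simpa using congrArg (fun f : Module.End ℂ A => f 1) hc

theorem ι_mul_ι_sq (u v : OddVar m → ℂ) :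
    (ExteriorAlgebra.ι ℂ u * ExteriorAlgebra.ι ℂ v) ^ 2 = (0 : Gr m) := by
  have h : ExteriorAlgebra.ι ℂ v * ExteriorAlgebra.ι ℂ u
      = -(ExteriorAlgebra.ι ℂ u * ExteriorAlgebra.ι ℂ v : Gr m) :=
    eq_neg_of_add_eq_zero_left (ExteriorAlgebra.ι_add_mul_swap v u)
  rw [sq, mul_assoc, ← mul_assoc (ExteriorAlgebra.ι ℂ v), h, neg_mul, mul_neg, mul_assoc,
    ExteriorAlgebra.ι_sq_zero, mul_zero, mul_zero, neg_zero]

/-- The exponent of the body of the wave function. -/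
def Kin.phase (D : Kin m) (x : BosX) : ℂ :=
  Complex.I * ∑ j, ∑ α, (D.σ j 0 * x α 1 - D.σ j 1 * x α 0) * D.w j α

/-- The nilpotent part of the exponent of the wave function. -/
def Kin.soul (D : Kin m) : Gr m :=
  Complex.I • ∑ j, ∑ a, (ExteriorAlgebra.ι ℂ
    (D.σ j 0 • Pi.single (Sum.inr (a, 1)) 1 - D.σ j 1 • Pi.single (Sum.inr (a, 0)) 1) *
      gen (Sum.inl (j, a)))

theorem Zmap_inl (x : BosX) (s : Fin 2 → ℂ) (α : Fin 4) :
    Zmap m x s (Sum.inl α) = algebraMap ℂ (Gr m) (s 0 * x α 1 - s 1 * x α 0) := by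
  simp only [Zmap, Xlow, Xup, eps, Fin.sum_univ_two, Matrix.of_apply, Matrix.cons_val',
    Matrix.cons_val_zero, Matrix.cons_val_one, Matrix.cons_val_fin_one, zero_smul, zero_add,
    add_zero, one_smul, neg_smul, smul_neg]
  rw [map_sub, map_mul, map_mul, Algebra.smul_def, Algebra.smul_def, sub_eq_add_neg]

theorem Zmap_inr (x : BosX) (s : Fin 2 → ℂ) (a : Fin 4) :
    Zmap m x s (Sum.inr a) = ExteriorAlgebra.ι ℂ
      (s 0 • Pi.single (Sum.inr (a, 1)) 1 - s 1 • Pi.single (Sum.inr (a, 0)) 1) := by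
  simp only [Zmap, Xlow, Xup, eps, Fin.sum_univ_two, Matrix.of_apply, Matrix.cons_val',
    Matrix.cons_val_zero, Matrix.cons_val_one, Matrix.cons_val_fin_one, zero_smul, zero_add,
    add_zero, one_smul, neg_smul, smul_neg, gen]
  rw [map_sub, map_smul, map_smul, sub_eq_add_neg]

theorem Kin.coe_ZW (D : Kin m) (x : BosX) (s : Fin 2 → ℂ) (i : Pt m) :
    (D.ZW x s i : Gr m) = algebraMap ℂ (Gr m) (∑ α, (s 0 * x α 1 - s 1 * x α 0) * D.w i α)
      + ∑ a, ExteriorAlgebra.ι ℂ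
          (s 0 • Pi.single (Sum.inr (a, 1)) 1 - s 1 • Pi.single (Sum.inr (a, 0)) 1) *
        gen (Sum.inl (i, a)) := by
  change ∑ I, Zmap m x s I * D.W i I = _
  rw [Fintype.sum_sum_type]
  simp only [Zmap_inl, Zmap_inr, Kin.W, map_sum, map_mul]

theorem Kin.exponent_eq (D : Kin m) (x : BosX) :
    Complex.I • ((∑ i, D.ZW x (D.σ i) i : Bos m) : Gr m)
      = algebraMap ℂ (Gr m) (D.phase x) + D.soul := by
  rw [AddSubmonoidClass.coe_finsetSum]
  rw [Finset.sum_congr rfl fun i _ => D.coe_ZW x (D.σ i) i, Finset.sum_add_distrib, smul_add,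
    ← map_sum, Algebra.smul_def Complex.I (algebraMap ℂ (Gr m) _), ← map_mul]
  rfl

theorem Kin.body_soul (D : Kin m) : body D.soul = 0 := by
  simp [body, Kin.soul, ExteriorAlgebra.algebraMapInv]

/-- The bosonic coordinates enter only through the scalar phase; the nilpotent factor is constant in
`x`. The analysis therefore concerns a scalar oscillating factor times polynomials. -/
theorem Kin.wave_eq (D : Kin m) (x : BosX) :
    D.wave x = Complex.exp (D.phase x) • IsNilpotent.exp D.soul := by
  have hb : body (algebraMap ℂ (Gr m) (D.phase x) + D.soul) = D.phase x := by
    have := D.body_soul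
    simp only [body] at this ⊢
    rw [map_add, this, ExteriorAlgebra.algebraMapInv]
    simp
  rw [Kin.wave, superExp, D.exponent_eq, hb, add_sub_cancel_left]

theorem Kin.soul_mem_center (D : Kin m) : D.soul ∈ Subalgebra.center ℂ (Gr m) :=
  Subalgebra.smul_mem _ (sum_mem fun _ _ => sum_mem fun _ _ => ι_mul_ι_mem _ _) _

theorem Kin.soul_mem_leibniz (D : Kin m) : D.soul ∈ leibniz m :=
  Subalgebra.smul_mem _ (sum_mem fun _ _ => sum_mem fun _ _ => ι_mul_ι_mem_leibniz _ _) _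

/-- A finite sum of elements of square zero in the commutative center. -/
theorem Kin.isNilpotent_soul (D : Kin m) : IsNilpotent D.soul := by
  have h : IsNilpotent (∑ j, ∑ a, (⟨_, ι_mul_ι_mem
      (D.σ j 0 • Pi.single (Sum.inr (a, 1)) 1 - D.σ j 1 • Pi.single (Sum.inr (a, 0)) 1)
      (Pi.single (Sum.inl (j, a)) 1)⟩ : Bos m)) :=
    isNilpotent_sum fun j _ => isNilpotent_sum fun a _ => ⟨2, Subtype.ext (ι_mul_ι_sq _ _)⟩
  obtain ⟨n, hn⟩ := h.map (Subalgebra.center ℂ (Gr m)).val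
  refine ⟨n, ?_⟩
  rw [Kin.soul, smul_pow]
  convert smul_zero _
  rw [← hn, map_sum]
  simp only [map_sum]
  rfl

/-! ### Differentiation along a supervector -/

/-- Even elements that do not depend on the odd coordinates. -/
def thetaFree (m : ℕ) : Subalgebra ℂ (Bos m) where
  carrier := {g | (g : Gr m) ∈ leibniz m ∧ ∀ a A, dTheta a A (g : Gr m) = 0}
  mul_mem' {g h} hg hh := ⟨mul_mem hg.1 hh.1, fun a A => by
    rw [MulMemClass.coe_mul, hg.1, hg.2, hh.2, zero_mul, mul_zero, add_zero]⟩
  add_mem' {g h} hg hh := ⟨add_mem hg.1 hh.1, fun a A => by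
    rw [AddMemClass.coe_add, map_add, hg.2, hh.2, add_zero]⟩
  algebraMap_mem' c := ⟨(leibniz m).algebraMap_mem c, fun a A => dTheta_algebraMap a A c⟩

/-- `G'` is the derivative of the even function `G` along the constant supervector `u`. -/
def HasSuperDerivAt (u : SIdx → Fin 2 → Gr m) (G : BosX → Bos m) (G' : Bos m) (x : BosX) : Prop :=
  (G x : Gr m) ∈ leibniz m ∧ ∃ Gd : Fin 4 → Fin 2 → Gr m,
    (∀ α A, HasGrDerivAt
      (fun t => (G (Function.update x α (Function.update (x α) A t)) : Gr m)) (Gd α A) (x α A)) ∧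
    (G' : Gr m) = ∑ α, ∑ A, u (Sum.inl α) A * Gd α A
      - ∑ a, ∑ A, u (Sum.inr a) A * dTheta a A (G x : Gr m)

theorem HasSuperDerivAt.const {u : SIdx → Fin 2 → Gr m} {g : Bos m} (hg : g ∈ thetaFree m)
    (x : BosX) : HasSuperDerivAt u (fun _ => g) 0 x := by
  refine ⟨hg.1, fun _ _ => 0, fun _ _ => HasGrDerivAt.const _ _, ?_⟩
  simp only [hg.2, mul_zero, Finset.sum_const_zero, sub_zero]
  rfl

theorem HasSuperDerivAt.congr_deriv {u : SIdx → Fin 2 → Gr m} {G : BosX → Bos m} {G' H' : Bos m}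
    {x : BosX} (hG : HasSuperDerivAt u G G' x) (h : G' = H') : HasSuperDerivAt u G H' x :=
  h ▸ hG

theorem HasSuperDerivAt.add {u : SIdx → Fin 2 → Gr m} {G H : BosX → Bos m} {G' H' : Bos m}
    {x : BosX} (hG : HasSuperDerivAt u G G' x) (hH : HasSuperDerivAt u H H' x) :
    HasSuperDerivAt u (fun y => G y + H y) (G' + H') x := by
  obtain ⟨hG₁, Gd, hG₂, hG₃⟩ := hG
  obtain ⟨hH₁, Hd, hH₂, hH₃⟩ := hH
  refine ⟨add_mem hG₁ hH₁, fun α A => Gd α A + Hd α A, fun α A => (hG₂ α A).add (hH₂ α A), ?_⟩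
  rw [AddMemClass.coe_add, hG₃, hH₃]
  simp only [AddMemClass.coe_add, map_add, mul_add, Finset.sum_add_distrib]
  abel

theorem sum_mul_leibniz {A ι κ : Type*} [Ring A] [Fintype ι] [Fintype κ] (u f g : ι → κ → A)
    (a b : A) (ha : ∀ z, a * z = z * a) :
    ∑ i, ∑ k, u i k * (f i k * b + a * g i k)
      = (∑ i, ∑ k, u i k * f i k) * b + a * ∑ i, ∑ k, u i k * g i k := by
  simp only [Finset.sum_mul, Finset.mul_sum, ← Finset.sum_add_distrib]
  refine Finset.sum_congr rfl fun i _ => Finset.sum_congr rfl fun k _ => ?_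
  rw [mul_add, ← mul_assoc, ← mul_assoc, ← mul_assoc, ha (u i k)]

theorem HasSuperDerivAt.mul {u : SIdx → Fin 2 → Gr m} {G H : BosX → Bos m} {G' H' : Bos m}
    {x : BosX} (hG : HasSuperDerivAt u G G' x) (hH : HasSuperDerivAt u H H' x) :
    HasSuperDerivAt u (fun y => G y * H y) (G' * H x + G x * H') x := by
  obtain ⟨hG₁, Gd, hG₂, hG₃⟩ := hG
  obtain ⟨hH₁, Hd, hH₂, hH₃⟩ := hH
  refine ⟨mul_mem hG₁ hH₁, fun α A => Gd α A * H x + G x * Hd α A, fun α A => ?_, ?_⟩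
  · have h := (hG₂ α A).mul (hH₂ α A)
    simp only [Function.update_eq_self] at h
    exact h
  · have hc (z : Gr m) : (G x : Gr m) * z = z * G x := (Subalgebra.mem_center_iff.1 (G x).2 z).symm
    have e (a : Fin 4) (A : Fin 2) : dTheta a A ((G x * H x : Bos m) : Gr m)
        = dTheta a A (G x : Gr m) * H x + G x * dTheta a A (H x : Gr m) := hG₁ a A _
    simp only [e]
    rw [sum_mul_leibniz _ _ _ _ _ hc, sum_mul_leibniz _ _ _ _ _ hc]
    rw [AddMemClass.coe_add, MulMemClass.coe_mul, MulMemClass.coe_mul, hG₃, hH₃, sub_mul, mul_sub]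
    abel

theorem HasSuperDerivAt.const_mul {u : SIdx → Fin 2 → Gr m} {g : Bos m} (hg : g ∈ thetaFree m)
    {H : BosX → Bos m} {H' : Bos m} {x : BosX} (hH : HasSuperDerivAt u H H' x) :
    HasSuperDerivAt u (fun y => g * H y) (g * H') x := by
  have h := (HasSuperDerivAt.const (u := u) hg x).mul hH
  rwa [zero_mul, zero_add] at h

theorem HasSuperDerivAt.mul_const {u : SIdx → Fin 2 → Gr m} {g : Bos m} (hg : g ∈ thetaFree m)
    {H : BosX → Bos m} {H' : Bos m} {x : BosX} (hH : HasSuperDerivAt u H H' x) :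
    HasSuperDerivAt u (fun y => H y * g) (H' * g) x := by
  have h := hH.mul (HasSuperDerivAt.const (u := u) hg x)
  rwa [mul_zero, add_zero] at h

theorem HasSuperDerivAt.const_smul {u : SIdx → Fin 2 → Gr m} (c : ℂ) {H : BosX → Bos m}
    {H' : Bos m} {x : BosX} (hH : HasSuperDerivAt u H H' x) :
    HasSuperDerivAt u (fun y => c • H y) (c • H') x := by
  have h := hH.const_mul ((thetaFree m).algebraMap_mem c)
  simpa only [← Algebra.smul_def] using h

theorem HasSuperDerivAt.sum {ι : Type*} {s : Finset ι} {u : SIdx → Fin 2 → Gr m}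
    {G : ι → BosX → Bos m} {G' : ι → Bos m} {x : BosX}
    (hG : ∀ i ∈ s, HasSuperDerivAt u (G i) (G' i) x) :
    HasSuperDerivAt u (fun y => ∑ i ∈ s, G i y) (∑ i ∈ s, G' i) x := by
  classical
  induction s using Finset.induction_on with
  | empty => simpa using HasSuperDerivAt.const (u := u) (zero_mem (thetaFree m)) x
  | insert a s ha ih =>
    simp only [Finset.sum_insert ha]
    exact (hG a (by simp)).add (ih fun i hi => hG i (by simp [hi]))

/-- The odd components of the supervector `u` have degree one and do not involve the odd
coordinates. -/
def IsThetaFreeDir (u : SIdx → Fin 2 → Gr m) : Prop :=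
  ∀ a A, ∃ v : OddVar m → ℂ, u (Sum.inr a) A = ExteriorAlgebra.ι ℂ v ∧ ∀ b, v (Sum.inr b) = 0

/-- Because `u` is constant, the divergence of u·G is the derivative of G along u. Moving an odd
derivative past an odd component of `u` costs a sign, which is why the odd part is subtracted in
`HasSuperDerivAt`. -/
theorem HasSuperDerivAt.hasSuperDivAt {u : SIdx → Fin 2 → Gr m} (hu : IsThetaFreeDir u)
    {G : BosX → Bos m} {G' : Bos m} {x : BosX} (hG : HasSuperDerivAt u G G' x) :
    HasSuperDivAt (fun y J A => u J A * (G y : Gr m)) (G' : Gr m) x := by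
  obtain ⟨hG₁, Gd, hG₂, hG₃⟩ := hG
  refine ⟨fun α A => u (Sum.inl α) A * Gd α A, fun α A => ?_, ?_⟩
  · have h := (HasGrDerivAt.const (u (Sum.inl α) A) (x α A)).mul (hG₂ α A)
    rwa [zero_mul, zero_add] at h
  · rw [hG₃, sub_eq_add_neg, ← Finset.sum_neg_distrib]
    refine congrArg _ (Finset.sum_congr rfl fun a _ => ?_)
    rw [← Finset.sum_neg_distrib]
    refine Finset.sum_congr rfl fun A _ => ?_
    obtain ⟨v, hv, hv'⟩ := hu a A
    beta_reduce
    rw [hv, dTheta_ι_mul, hv', zero_smul, zero_sub]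

theorem HasSuperDivAt.sum {ι : Type*} {s : Finset ι} {V : ι → BosX → SIdx → Fin 2 → Gr m}
    {d : ι → Gr m} {x : BosX} (hV : ∀ i ∈ s, HasSuperDivAt (V i) (d i) x) :
    HasSuperDivAt (fun y J A => ∑ i ∈ s, V i y J A) (∑ i ∈ s, d i) x := by
  choose! V' hV' hd using hV
  refine ⟨fun α A => ∑ i ∈ s, V' i α A, fun α A => HasGrDerivAt.sum fun i hi => hV' i hi α A, ?_⟩
  rw [Finset.sum_congr rfl hd, Finset.sum_add_distrib]
  congr 1
  · rw [Finset.sum_comm]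
    exact Finset.sum_congr rfl fun α _ => Finset.sum_comm
  · rw [Finset.sum_comm]
    refine Finset.sum_congr rfl fun a _ => ?_
    rw [Finset.sum_comm]
    exact Finset.sum_congr rfl fun A _ => (map_sum _ _ _).symm

theorem HasGrDerivAt.unique {f : ℂ → Gr m} {f' g' : Gr m} {t : ℂ} (hf : HasGrDerivAt f f' t)
    (hg : HasGrDerivAt f g' t) : f' = g' := by
  rw [← sub_eq_zero, ← Module.forall_dual_apply_eq_zero_iff ℂ]
  intro l
  rw [map_sub, (hf l).unique (hg l), sub_self]

theorem HasGrDerivAt.algebraMap {f : ℂ → ℂ} {f' t : ℂ} (hf : HasDerivAt f f' t) :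
    HasGrDerivAt (fun s => algebraMap ℂ (Gr m) (f s)) (algebraMap ℂ (Gr m) f') t := by
  have h := HasGrDerivAt.smul hf (HasGrDerivAt.const (1 : Gr m) t)
  simpa only [smul_zero, add_zero, ← Algebra.algebraMap_eq_smul_one] using h

/-! ### Derivatives of the building blocks along the Hamiltonian directions -/

theorem hasDerivAt_coord (x : BosX) (α β : Fin 4) (A B : Fin 2) :
    HasDerivAt (fun t : ℂ => Function.update x α (Function.update (x α) A t) β B)
      (if β = α ∧ B = A then 1 else 0) (x α A) := by
  by_cases h : β = α
  · subst h
    by_cases h' : B = A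
    · subst h'
      simpa using hasDerivAt_id' (x β B)
    · simpa [h'] using hasDerivAt_const (x β A) (x β B)
  · simpa [h] using hasDerivAt_const (x α A) (x β B)

theorem Kin.coe_brW (D : Kin m) (i j : Pt m) :
    (D.brW i j : Gr m) = algebraMap ℂ (Gr m) (D.Λ * (D.w j 1 * D.w i 0 - D.w j 0 * D.w i 1)
        - D.w j 3 * D.w i 2 + D.w j 2 * D.w i 3)
      + D.r • ∑ a, gen (Sum.inl (j, a)) * gen (Sum.inl (i, a)) := by
  change ∑ I, ∑ J, infUpper D.Λ D.r I J • (D.W j J * D.W i I) = _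
  simp only [Fintype.sum_sum_type, infUpper, Matrix.fromBlocks_apply₁₁, Matrix.fromBlocks_apply₁₂,
    Matrix.fromBlocks_apply₂₁, Matrix.fromBlocks_apply₂₂, Matrix.zero_apply, zero_smul,
    Finset.sum_const_zero, add_zero, zero_add, Matrix.smul_apply, Matrix.one_apply, smul_eq_mul,
    mul_ite, mul_one, mul_zero, ite_smul, Finset.sum_ite_eq, Finset.mem_univ, if_true, Kin.W,
    ← Finset.smul_sum]
  congr 1
  simp only [Fin.sum_univ_four, Matrix.of_apply, Matrix.cons_val, ← map_mul, Algebra.smul_def,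
    ← map_add]
  congr 1
  ring

theorem gen_mul_gen (v w : OddVar m) : (gen v * gen w : Gr m) = -(gen w * gen v) :=
  eq_neg_of_add_eq_zero_left (ExteriorAlgebra.ι_add_mul_swap _ _)

theorem Kin.brW_swap (D : Kin m) (i j : Pt m) : D.brW i j = -D.brW j i := by
  refine Subtype.ext ?_
  rw [NegMemClass.coe_neg, D.coe_brW, D.coe_brW, neg_add, ← map_neg, ← smul_neg,
    ← Finset.sum_neg_distrib]
  congr 2
  · ring
  · exact Finset.sum_congr rfl fun a _ => gen_mul_gen _ _

theorem Kin.brW_mem_thetaFree (D : Kin m) (i j : Pt m) : D.brW i j ∈ thetaFree m := by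
  refine ⟨?_, fun a A => ?_⟩
  · rw [D.coe_brW]
    exact add_mem (Subalgebra.algebraMap_mem _ _)
      (Subalgebra.smul_mem _ (sum_mem fun a _ => ι_mul_ι_mem_leibniz _ _) _)
  · rw [D.coe_brW, map_add, dTheta_algebraMap, map_smul, map_sum, zero_add]
    convert smul_zero D.r
    refine Finset.sum_eq_zero fun b _ => ?_
    rw [gen, gen, dTheta_ι_mul, dTheta_ι]
    simp

theorem Kin.redDet_mem_thetaFree (D : Kin m) (ξ : Fin 2 → ℂ) {k : ℕ} (p : Fin k → Fin m) :
    D.redDet ξ p ∈ thetaFree m := by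
  have hodges_mem (i j : Pt m) : D.hodges ξ i j ∈ thetaFree m := by
    unfold Kin.hodges
    split_ifs
    · exact neg_mem (sum_mem fun k _ => Subalgebra.smul_mem _
        (Subalgebra.smul_mem _ (D.brW_mem_thetaFree i k) _) _)
    · exact Subalgebra.smul_mem _ (D.brW_mem_thetaFree i j) _
  rw [Kin.redDet, Matrix.det_apply']
  refine sum_mem fun π _ => mul_mem ?_ (prod_mem fun i _ => hodges_mem _ _)
  rw [← map_intCast (algebraMap ℂ (Bos m))]
  exact Subalgebra.algebraMap_mem _ _

theorem Kin.omega_mem_thetaFree (D : Kin m) (ξ : Fin 2 → ℂ) (q : Fin 2) (i j : Fin m) :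
    D.omega ξ q i j ∈ thetaFree m :=
  Subalgebra.smul_mem _ (D.brW_mem_thetaFree _ _) _

/-- The scalar factor of `Kin.dir`, without the spinor `ξ^A`. -/
def Kin.dirScale (D : Kin m) (ξ ζ : Fin 2 → ℂ) (i : Fin m) : ℂ :=
  -2 * Complex.I * spin ξ ζ / (spin (D.σ (Sum.inr i)) ξ) ^ 3

/-- The bosonic components `I^{IJ} W_{iI}`. -/
def Kin.raised (D : Kin m) (i : Fin m) : Fin 4 → ℂ :=
  ![-D.Λ * D.w (Sum.inr i) 1, D.Λ * D.w (Sum.inr i) 0, D.w (Sum.inr i) 3, -D.w (Sum.inr i) 2]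

theorem Kin.dir_inl (D : Kin m) (ξ ζ : Fin 2 → ℂ) (i : Fin m) (α : Fin 4) (A : Fin 2) :
    D.dir ξ ζ i (Sum.inl α) A
      = algebraMap ℂ (Gr m) (D.dirScale ξ ζ i * ξ A * D.raised i α) := by
  have h : ∑ I, infUpper D.Λ D.r I (Sum.inl α) • D.W (Sum.inr i) I
      = algebraMap ℂ (Gr m) (D.raised i α) := by
    simp only [Fintype.sum_sum_type, infUpper, Matrix.fromBlocks_apply₁₁,
      Matrix.fromBlocks_apply₂₁, Matrix.zero_apply, zero_smul, Finset.sum_const_zero, add_zero,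
      Kin.W, Kin.raised]
    fin_cases α <;>
      simp [Fin.sum_univ_four, Algebra.smul_def]
  rw [Kin.dir, h, Algebra.smul_def, ← map_mul, Kin.dirScale]
  congr 1
  ring

theorem Kin.dir_inr (D : Kin m) (ξ ζ : Fin 2 → ℂ) (i : Fin m) (a : Fin 4) (A : Fin 2) :
    D.dir ξ ζ i (Sum.inr a) A
      = (D.dirScale ξ ζ i * ξ A * D.r) • gen (Sum.inl (Sum.inr i, a)) := by
  have h : ∑ I, infUpper D.Λ D.r I (Sum.inr a) • D.W (Sum.inr i) I
      = D.r • gen (Sum.inl (Sum.inr i, a)) := by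
    simp only [Fintype.sum_sum_type, infUpper, Matrix.fromBlocks_apply₁₂,
      Matrix.fromBlocks_apply₂₂, Matrix.zero_apply, zero_smul, Finset.sum_const_zero, zero_add,
      Matrix.smul_apply, Matrix.one_apply, smul_eq_mul, mul_ite, mul_one, mul_zero, ite_smul,
      Finset.sum_ite_eq', Finset.mem_univ, if_true, Kin.W]
  rw [Kin.dir, h, smul_smul, Kin.dirScale]
  congr 1
  ring

theorem Kin.isThetaFreeDir (D : Kin m) (ξ ζ : Fin 2 → ℂ) (i : Fin m) :
    IsThetaFreeDir (D.dir ξ ζ i) := fun a A =>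
  ⟨(D.dirScale ξ ζ i * ξ A * D.r) • Pi.single (Sum.inl (Sum.inr i, a)) 1, by
    rw [D.dir_inr, map_smul, gen], fun b => by simp⟩

/-- The covector `ε_{BA} s^B`. -/
def lowered (s : Fin 2 → ℂ) : Fin 2 → ℂ := ![-s 1, s 0]

theorem Kin.hasGrDerivAt_ZW (D : Kin m) (x : BosX) (s : Fin 2 → ℂ) (i : Pt m) (α : Fin 4)
    (A : Fin 2) :
    HasGrDerivAt (fun t => (D.ZW (Function.update x α (Function.update (x α) A t)) s i : Gr m))
      (algebraMap ℂ (Gr m) (lowered s A * D.w i α)) (x α A) := by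
  simp only [D.coe_ZW]
  have h : HasDerivAt (fun t => ∑ β, (s 0 * Function.update x α (Function.update (x α) A t) β 1
      - s 1 * Function.update x α (Function.update (x α) A t) β 0) * D.w i β)
      (∑ β, (s 0 * (if β = α ∧ 1 = A then 1 else 0) - s 1 * (if β = α ∧ 0 = A then 1 else 0))
        * D.w i β) (x α A) :=
    HasDerivAt.fun_sum fun β _ => (((hasDerivAt_coord x α β A 1).const_mul _).fun_sub
      ((hasDerivAt_coord x α β A 0).const_mul _)).mul_const _
  have h' := (HasGrDerivAt.algebraMap (m := m) h).add (HasGrDerivAt.const (∑ a, ExteriorAlgebra.ι ℂ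
    (s 0 • Pi.single (Sum.inr (a, 1)) 1 - s 1 • Pi.single (Sum.inr (a, 0)) 1) *
        gen (Sum.inl (i, a))) (x α A))
  rw [add_zero] at h'
  convert h' using 2
  rw [Finset.sum_eq_single α]
  · fin_cases A <;> simp [lowered]
  · intro β _ hβ
    simp [hβ]
  · simp

theorem Kin.ZW_mem_leibniz (D : Kin m) (x : BosX) (s : Fin 2 → ℂ) (i : Pt m) :
    (D.ZW x s i : Gr m) ∈ leibniz m := by
  rw [D.coe_ZW]
  exact add_mem (Subalgebra.algebraMap_mem _ _) (sum_mem fun a _ => ι_mul_ι_mem_leibniz _ _)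

theorem Kin.dTheta_ZW (D : Kin m) (x : BosX) (s : Fin 2 → ℂ) (i : Pt m) (a : Fin 4) (A : Fin 2) :
    dTheta a A (D.ZW x s i : Gr m) = lowered s A • gen (Sum.inl (i, a)) := by
  rw [D.coe_ZW, map_add, dTheta_algebraMap, zero_add, map_sum, Finset.sum_eq_single a]
  · rw [gen, dTheta_ι_mul, dTheta_ι]
    fin_cases A <;> simp [lowered]
  · intro b _ hb
    rw [gen, dTheta_ι_mul, dTheta_ι]
    simp [hb.symm]
  · simp

theorem sum_lowered (s ξ : Fin 2 → ℂ) : ∑ A, ξ A * lowered s A = spin s ξ := by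
  simp [lowered, spin, Fin.sum_univ_two]
  ring

/-- Z(s)·W_i is linear in X. Its increment pairs the raised W_l with W_i, which gives the bracket,
and contracts ξ with s. In particular Z(ξ) is left unchanged. -/
theorem Kin.hasSuperDerivAt_ZW (D : Kin m) (ξ ζ : Fin 2 → ℂ) (l : Fin m) (s : Fin 2 → ℂ)
    (i : Pt m) (x : BosX) :
    HasSuperDerivAt (D.dir ξ ζ l) (fun y => D.ZW y s i)
      ((D.dirScale ξ ζ l * spin s ξ) • D.brW (Sum.inr l) i) x := by
  refine ⟨D.ZW_mem_leibniz x s i, _, D.hasGrDerivAt_ZW x s i, ?_⟩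
  simp only [D.dTheta_ZW, D.dir_inl, D.dir_inr]
  rw [sub_eq_add_neg, SetLike.val_smul, D.coe_brW, smul_add]
  refine congrArg₂ (· + ·) ?_ ?_
  · simp only [← map_mul, ← map_sum, Algebra.smul_def]
    congr 1
    simp only [Fin.sum_univ_four, Fin.sum_univ_two, Kin.raised, lowered, spin, Matrix.cons_val]
    ring
  · rw [smul_smul, Finset.smul_sum, ← Finset.sum_neg_distrib]
    refine Finset.sum_congr rfl fun a _ => ?_
    rw [gen_mul_gen (Sum.inl (i, a)), smul_neg, ← sum_lowered, Finset.mul_sum, Finset.sum_mul,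
      Finset.sum_smul]
    congr 1
    refine Finset.sum_congr rfl fun A _ => ?_
    rw [smul_mul_smul_comm]
    congr 1
    ring

theorem Kin.coe_X2 (D : Kin m) (x : BosX) :
    (D.X2 x : Gr m) = algebraMap ℂ (Gr m) (x 0 0 * x 1 1 - x 0 1 * x 1 0
        + D.Λ * (x 2 1 * x 3 0 - x 3 1 * x 2 0))
      + D.r • ∑ a, gen (Sum.inr (a, 1)) * gen (Sum.inr (a, 0)) := by
  have hl (α : Fin 4) (A : Fin 2) : Xlow m x (Sum.inl α) A
      = algebraMap ℂ (Gr m) (![x α 1, -x α 0] A) := by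
    fin_cases A <;> simp [Xlow, eps, Fin.sum_univ_two, Xup]
  have hr (a : Fin 4) (A : Fin 2) : Xlow m x (Sum.inr a) A
      = ![gen (Sum.inr (a, 1)), -gen (Sum.inr (a, 0))] A := by
    fin_cases A <;> simp [Xlow, eps, Fin.sum_univ_two, Xup]
  change (1 / 2 : ℂ) • ∑ I, ∑ J, ∑ A, infLower D.Λ D.r I J • (Xlow m x I A * Xup m x J A) = _
  simp only [Fintype.sum_sum_type, infLower, Matrix.fromBlocks_apply₁₁, Matrix.fromBlocks_apply₁₂,
    Matrix.fromBlocks_apply₂₁, Matrix.fromBlocks_apply₂₂, Matrix.zero_apply, zero_smul,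
    Finset.sum_const_zero, add_zero, zero_add, ← Finset.smul_sum, Matrix.smul_apply,
    Matrix.one_apply, smul_eq_mul, mul_ite, mul_one, mul_zero, ite_smul, Finset.sum_ite_eq,
    Finset.mem_univ, if_true, Xup, hl, hr]
  rw [smul_add]
  refine congrArg₂ (· + ·) ?_ ?_
  · simp only [← map_mul, ← map_sum, Algebra.smul_def]
    congr 1
    simp only [Fin.sum_univ_four, Fin.sum_univ_two, Matrix.of_apply, Matrix.cons_val]
    ring
  · rw [smul_comm]
    congr 1
    rw [Finset.smul_sum]
    refine Finset.sum_congr rfl fun a _ => ?_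
    simp only [Fin.sum_univ_two, Matrix.cons_val_zero, Matrix.cons_val_one]
    rw [neg_mul, gen_mul_gen (Sum.inr (a, 0)), neg_neg, ← two_smul ℂ, smul_smul]
    norm_num

theorem Kin.X2_mem_leibniz (D : Kin m) (x : BosX) : (D.X2 x : Gr m) ∈ leibniz m := by
  rw [D.coe_X2]
  exact add_mem (Subalgebra.algebraMap_mem _ _)
    (Subalgebra.smul_mem _ (sum_mem fun a _ => ι_mul_ι_mem_leibniz _ _) _)

theorem Kin.dTheta_X2 (D : Kin m) (x : BosX) (a : Fin 4) (A : Fin 2) :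
    dTheta a A (D.X2 x : Gr m)
      = D.r • ![-gen (Sum.inr (a, 1)), gen (Sum.inr (a, 0))] A := by
  rw [D.coe_X2, map_add, dTheta_algebraMap, zero_add, map_smul, map_sum, Finset.sum_eq_single a]
  · rw [gen, gen, dTheta_ι_mul, dTheta_ι]
    fin_cases A <;> simp
  · intro b _ hb
    rw [gen, gen, dTheta_ι_mul, dTheta_ι]
    simp [hb.symm]
  · simp

/-- The bosonic gradient of `X²`. -/
def Kin.gradX2 (D : Kin m) (x : BosX) (α : Fin 4) (A : Fin 2) : ℂ :=
  (![![x 1 1, -x 1 0], ![-x 0 1, x 0 0], ![-D.Λ * x 3 1, D.Λ * x 3 0],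
    ![D.Λ * x 2 1, -D.Λ * x 2 0]] : Fin 4 → Fin 2 → ℂ) α A

theorem Kin.hasGrDerivAt_X2 (D : Kin m) (x : BosX) (α : Fin 4) (A : Fin 2) :
    HasGrDerivAt (fun t => (D.X2 (Function.update x α (Function.update (x α) A t)) : Gr m))
      (algebraMap ℂ (Gr m) (D.gradX2 x α A)) (x α A) := by
  simp only [D.coe_X2]
  have c (β : Fin 4) (B : Fin 2) := hasDerivAt_coord x α β A B
  have h := (((c 0 0).fun_mul (c 1 1)).fun_sub ((c 0 1).fun_mul (c 1 0))).fun_add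
    ((((c 2 1).fun_mul (c 3 0)).fun_sub ((c 3 1).fun_mul (c 2 0))).const_mul D.Λ)
  have h' := (HasGrDerivAt.algebraMap (m := m) h).add
    (HasGrDerivAt.const (D.r • ∑ a, gen (Sum.inr (a, 1)) * gen (Sum.inr (a, 0))) (x α A))
  rw [add_zero] at h'
  convert h' using 2
  simp only [Function.update_eq_self]
  fin_cases α <;> fin_cases A <;> simp [Kin.gradX2]

/-- The gradient of X² lowers an index with I_{IJ} and the direction raises one with I^{IJ}; the
product is Λ times the identity and leaves Λ Z(ξ)·W_l. In the odd block the product is r², so `hr`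
enters here. -/
theorem Kin.hasSuperDerivAt_X2 (D : Kin m) (hr : D.r ^ 2 = D.Λ) (ξ ζ : Fin 2 → ℂ) (l : Fin m)
    (x : BosX) : HasSuperDerivAt (D.dir ξ ζ l) (fun y => D.X2 y) (D.dPsi ξ ζ x l) x := by
  refine ⟨D.X2_mem_leibniz x, _, D.hasGrDerivAt_X2 x, ?_⟩
  have hs : 2 * Complex.I * D.Λ * spin ξ ζ / (spin (D.σ (Sum.inr l)) ξ) ^ 3
      = -D.dirScale ξ ζ l * D.Λ := by
    rw [Kin.dirScale]
    ring
  simp only [D.dTheta_X2, D.dir_inl, D.dir_inr, Kin.dPsi, hs]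
  rw [sub_eq_add_neg, SetLike.val_smul, D.coe_ZW, smul_add]
  refine congrArg₂ (· + ·) ?_ ?_
  · simp only [← map_mul, ← map_sum, Algebra.smul_def]
    congr 1
    simp only [Fin.sum_univ_four, Fin.sum_univ_two, Kin.raised, Kin.gradX2, Matrix.cons_val]
    ring
  · rw [Finset.smul_sum, ← Finset.sum_neg_distrib]
    refine Finset.sum_congr rfl fun a _ => ?_
    have e : ExteriorAlgebra.ι ℂ (ξ 0 • Pi.single (Sum.inr (a, 1)) 1
        - ξ 1 • Pi.single (Sum.inr (a, 0)) 1 : OddVar m → ℂ)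
        = ξ 0 • gen (Sum.inr (a, 1)) - ξ 1 • gen (Sum.inr (a, 0)) := by
      rw [map_sub, map_smul, map_smul]
      rfl
    simp only [e, Fin.sum_univ_two, Matrix.cons_val_zero, Matrix.cons_val_one, sub_mul,
      smul_mul_assoc, mul_smul_comm, mul_neg, smul_smul,
      gen_mul_gen (Sum.inl (Sum.inr l, a)), ← hr]
    module

/-- The variation of `ψ^q_i` along the supervector attached to `l`. -/
def Kin.kappa (D : Kin m) (ξ ζ : Fin 2 → ℂ) (q : Fin 2) (i l : Fin m) : Bos m :=
  let a := D.σ (Sum.inl q)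
  let s := D.σ (Sum.inr i)
  (Complex.I * D.Λ * spin ξ a / ((spin a s) ^ 2 * (spin ξ s) ^ 2) *
    (spin ξ s * (D.dirScale ξ ζ l * spin a ξ))) • D.brW (Sum.inr l) (Sum.inr i)

theorem Kin.hasSuperDerivAt_psi (D : Kin m) (ξ ζ : Fin 2 → ℂ) (l : Fin m) (q : Fin 2) (i : Fin m)
    (x : BosX) :
    HasSuperDerivAt (D.dir ξ ζ l) (fun y => D.psi ξ y q i) (D.kappa ξ ζ q i l) x := by
  have h := (((D.hasSuperDerivAt_ZW ξ ζ l (D.σ (Sum.inl q)) (Sum.inr i) x).const_smul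
    (spin ξ (D.σ (Sum.inr i)))).add ((D.hasSuperDerivAt_ZW ξ ζ l ξ (Sum.inr i) x).const_smul
    (spin (D.σ (Sum.inl q)) (D.σ (Sum.inr i))))).const_smul
    (Complex.I * D.Λ * spin ξ (D.σ (Sum.inl q)) / ((spin (D.σ (Sum.inl q)) (D.σ (Sum.inr i))) ^ 2 *
      (spin ξ (D.σ (Sum.inr i))) ^ 2))
  refine h.congr_deriv ?_
  have h0 : spin ξ ξ = 0 := by
    simp only [spin]
    ring
  rw [h0, mul_zero, zero_smul, smul_zero, add_zero, smul_smul, smul_smul, Kin.kappa,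
    mul_assoc _ (spin ξ _)]

/-- Since [W_l, W_i] is antisymmetric, the symmetrization becomes the bracket times a difference of
two scalar coefficients, and over a common denominator this is d_ξ ω. The symmetrized identity
suffices because the determinants are symmetric in the removed indices. -/
theorem Kin.kappa_add_kappa (D : Kin m) (ξ ζ : Fin 2 → ℂ) (h : Regular D.σ ξ) (q : Fin 2)
    (i l : Fin m) : D.kappa ξ ζ q i l + D.kappa ξ ζ q l i = D.dOmega ξ ζ q i l := by
  simp only [Kin.kappa, Kin.dOmega]
  rw [D.brW_swap (Sum.inr l), smul_neg, ← neg_smul, ← add_smul]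
  congr 1
  have h₁ := h.2 i
  have h₂ := h.2 l
  have h₃ := h.1 (Sum.inl q) (Sum.inr i) (by simp)
  have h₄ := h.1 (Sum.inl q) (Sum.inr l) (by simp)
  simp only [Kin.dirScale]
  generalize D.σ (Sum.inr i) = s at *
  generalize D.σ (Sum.inr l) = t at *
  generalize D.σ (Sum.inl q) = a at *
  rw [spin_swap s ξ, spin_swap t ξ, spin_swap s a, spin_swap t a, spin_swap ξ a]
  field_simp
  have hI := Complex.I_sq
  simp only [hI]
  simp only [spin]
  ring

theorem dTheta_pow {g : Gr m} (hc : g ∈ Subalgebra.center ℂ (Gr m)) (hg : g ∈ leibniz m)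
    (a : Fin 4) (A : Fin 2) (n : ℕ) :
    dTheta a A (g ^ (n + 1)) = ((n : ℂ) + 1) • (dTheta a A g * g ^ n) := by
  have hc := Subalgebra.mem_center_iff.1 hc
  induction n with
  | zero => simp
  | succ n ih =>
    rw [pow_succ', hg, ih, mul_smul_comm, ← mul_assoc, ← hc, mul_assoc, ← pow_succ',
      Nat.cast_add, Nat.cast_one, add_smul ((n : ℂ) + 1), one_smul, add_comm]

theorem dTheta_nilpotentExp {g : Gr m} (hc : g ∈ Subalgebra.center ℂ (Gr m)) (hg : g ∈ leibniz m)
    (hn : IsNilpotent g) (a : Fin 4) (A : Fin 2) :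
    dTheta a A (IsNilpotent.exp g) = dTheta a A g * IsNilpotent.exp g := by
  obtain ⟨k, hk⟩ := hn
  -- The left side is expanded one term further, since differentiation lowers the degree by one and
  -- kills the constant term.
  have hk' : g ^ (k + 1) = 0 := by rw [pow_succ, hk, zero_mul]
  conv_lhs => rw [nilpotentExp_eq_sum hk', Finset.sum_range_succ']
  conv_rhs => rw [nilpotentExp_eq_sum hk]
  rw [map_add, map_sum, Finset.mul_sum, pow_zero, map_smul, ← map_one (algebraMap ℂ (Gr m)),
    dTheta_algebraMap, smul_zero, add_zero]
  refine Finset.sum_congr rfl fun n _ => ?_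
  rw [map_smul, dTheta_pow hc hg, smul_smul, mul_smul_comm]
  congr 1
  rw [Nat.factorial_succ]
  have : ((n : ℂ) + 1) ≠ 0 := by exact_mod_cast n.succ_ne_zero
  have : (n.factorial : ℂ) ≠ 0 := by exact_mod_cast n.factorial_ne_zero
  push_cast
  field_simp

theorem nilpotentExp_mem {g : Gr m} (hn : IsNilpotent g) {S : Subalgebra ℂ (Gr m)} (hg : g ∈ S) :
    IsNilpotent.exp g ∈ S := by
  obtain ⟨k, hk⟩ := hn
  rw [nilpotentExp_eq_sum hk]
  exact sum_mem fun i _ => Subalgebra.smul_mem _ (pow_mem hg _) _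

/-- The wave function as an even element. -/
def Kin.waveBos (D : Kin m) (x : BosX) : Bos m :=
  ⟨D.wave x, by
    rw [D.wave_eq]
    exact Subalgebra.smul_mem _ (nilpotentExp_mem D.isNilpotent_soul D.soul_mem_center) _⟩

/-- The exponent is a sum of terms Z(σ_j)·W_j, so it changes by ∑_j (jξ)[W_l, W_j], the bracket of
W_l with 𝒫·ξ. With the normalization of `Kin.dir` this is exactly d_ξ ℍ_ll. -/
theorem Kin.hasSuperDerivAt_wave (D : Kin m) (ξ ζ : Fin 2 → ℂ) (l : Fin m) (x : BosX) :
    HasSuperDerivAt (D.dir ξ ζ l) D.waveBos (D.dHodges ξ ζ l * D.waveBos x) x := by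
  have hE : HasSuperDerivAt (D.dir ξ ζ l) (fun y => Complex.I • ∑ i, D.ZW y (D.σ i) i)
      (D.dHodges ξ ζ l) x := by
    have h := (HasSuperDerivAt.sum (s := Finset.univ) fun i _ =>
      D.hasSuperDerivAt_ZW ξ ζ l (D.σ i) i x).const_smul Complex.I
    refine h.congr_deriv ?_
    rw [Kin.dHodges, Finset.smul_sum, Finset.smul_sum]
    refine Finset.sum_congr rfl fun i _ => ?_
    rw [smul_smul, smul_smul, Kin.dirScale]
    congr 1
    linear_combination (-2 * spin ξ ζ / spin (D.σ (Sum.inr l)) ξ ^ 3 * spin (D.σ i) ξ) *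
      Complex.I_sq
  obtain ⟨-, Ed, hE₁, hE₂⟩ := hE
  have hexp (y : BosX) : ((Complex.I • ∑ i, D.ZW y (D.σ i) i : Bos m) : Gr m)
      = algebraMap ℂ (Gr m) (D.phase y) + D.soul := D.exponent_eq y
  have hphase (α : Fin 4) (A : Fin 2) :
      HasDerivAt (fun t => D.phase (Function.update x α (Function.update (x α) A t)))
        (body (Ed α A)) (x α A) := by
    -- The body is itself a linear coordinate; it annihilates the soul and so isolates the
    -- derivative of the phase.
    have h := hE₁ α A (ExteriorAlgebra.algebraMapInv (R := ℂ) (M := OddVar m → ℂ)).toLinearMap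
    have hb := D.body_soul
    simp only [body] at hb
    simp only [hexp, AlgHom.toLinearMap_apply, map_add, hb, add_zero, AlgHom.commutes,
      Algebra.algebraMap_self, RingHom.id_apply] at h
    exact h
  -- The soul is constant in `x`, so the bosonic derivatives of the exponent are scalars.
  have hEd (α : Fin 4) (A : Fin 2) : Ed α A = algebraMap ℂ (Gr m) (body (Ed α A)) := by
    refine (hE₁ α A).unique ?_
    simp only [hexp]
    have h := (HasGrDerivAt.algebraMap (m := m) (hphase α A)).add (.const D.soul _)
    rwa [add_zero] at h
  have hl : D.wave x ∈ leibniz m := by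
    rw [D.wave_eq]
    exact Subalgebra.smul_mem _ (nilpotentExp_mem D.isNilpotent_soul D.soul_mem_leibniz) _
  refine ⟨hl, fun α A => Ed α A * D.wave x, fun α A => ?_, ?_⟩
  · have h := HasGrDerivAt.smul (hphase α A).cexp (.const (IsNilpotent.exp D.soul) (x α A))
    simp only [Kin.waveBos, D.wave_eq]
    simp only [Function.update_eq_self, smul_zero, add_zero] at h
    rw [hEd, ← Algebra.smul_def, smul_smul, mul_comm]
    exact h
  · have hθ (a : Fin 4) (A : Fin 2) : dTheta a A (D.wave x)
        = dTheta a A ((Complex.I • ∑ i, D.ZW x (D.σ i) i : Bos m) : Gr m) * D.wave x := by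
      rw [hexp, map_add, dTheta_algebraMap, zero_add, D.wave_eq, map_smul,
        dTheta_nilpotentExp D.soul_mem_center D.soul_mem_leibniz D.isNilpotent_soul, mul_smul_comm]
    rw [MulMemClass.coe_mul, hE₂]
    simp only [Kin.waveBos, hθ, ← mul_assoc, ← Finset.sum_mul, sub_mul]

/-! ### The variation as a divergence -/

section Symmetrization

variable {R : Type*} [CommRing R] {k : ℕ} {Δ : (Fin k → Fin m) → R}

/-- If f and g differ by terms h and their relabellings h∘π, the weighted sums agree, because Δ is
symmetric. Each application only has to name the terms to be moved and the permutations that move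
them. -/
theorem sum_mul_eq_of_perm {ι : Type*} [Fintype ι]
    (hΔ : ∀ (π : Equiv.Perm (Fin k)) p, Δ (p ∘ π) = Δ p) {f g : (Fin k → Fin m) → R}
    (π : ι → Equiv.Perm (Fin k)) (h : ι → (Fin k → Fin m) → R)
    (H : ∀ p, f p + ∑ i, h i (p ∘ π i) = g p + ∑ i, h i p) :
    ∑ p : Fin k ↪ Fin m, Δ p * f p = ∑ p : Fin k ↪ Fin m, Δ p * g p := by
  have hp (i : ι) : ∑ p : Fin k ↪ Fin m, Δ p * h i (p ∘ π i)
      = ∑ p : Fin k ↪ Fin m, Δ p * h i p := by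
    rw [← sum_embedding_perm (π i) fun p => Δ p * h i p]
    refine Finset.sum_congr rfl fun p _ => ?_
    rw [← hΔ (π i) p]
    rfl
  have key := Finset.sum_congr (rfl : (Finset.univ : Finset (Fin k ↪ Fin m)) = Finset.univ)
    fun p _ => congrArg (Δ p * ·) (H p)
  simp only [mul_add, Finset.sum_add_distrib, Finset.mul_sum] at key
  rw [Finset.sum_comm, Finset.sum_comm (f := fun (p : Fin k ↪ Fin m) i => Δ p * h i p)] at key
  simp only [hp] at key
  exact add_right_cancel key

variable [Algebra ℂ R] (X : R) (ψ : Fin 2 → Fin m → R) (dψ dH : Fin m → R)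
  (om dom κ : Fin 2 → Fin m → Fin m → R)

theorem sum_variation_two (hκ : ∀ q i l, κ q i l + κ q l i = dom q i l)
    {Δ : (Fin 2 → Fin m) → R}
    (hΔ : ∀ (π : Equiv.Perm (Fin 2)) p, Δ (p ∘ π) = Δ p) :
    ∑ p : Fin 2 ↪ Fin m, Δ p * ((dψ (p 1) * (ψ 0 (p 0) + ψ 1 (p 0))
        + X * (κ 0 (p 0) (p 1) + κ 1 (p 0) (p 1))) + X * (ψ 0 (p 0) + ψ 1 (p 0)) * dH (p 1))
    = ∑ p : Fin 2 ↪ Fin m, Δ p * (X * (ψ 0 (p 0) + ψ 1 (p 0)) * dH (p 1)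
          + (1 / 2 : ℂ) • (X * (dom 0 (p 0) (p 1) + dom 1 (p 0) (p 1)))
          + dψ (p 0) * ψ 1 (p 1) + ψ 0 (p 0) * dψ (p 1)) := by
  have h2 : (2 : R) * algebraMap ℂ R (1 / 2) = 1 := by
    rw [← map_ofNat (algebraMap ℂ R) 2, ← map_mul]
    norm_num
  refine sum_mul_eq_of_perm hΔ
    (f := fun p => (dψ (p 1) * (ψ 0 (p 0) + ψ 1 (p 0))
        + X * (κ 0 (p 0) (p 1) + κ 1 (p 0) (p 1))) + X * (ψ 0 (p 0) + ψ 1 (p 0)) * dH (p 1))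
    (g := fun p => X * (ψ 0 (p 0) + ψ 1 (p 0)) * dH (p 1)
          + (1 / 2 : ℂ) • (X * (dom 0 (p 0) (p 1) + dom 1 (p 0) (p 1)))
          + dψ (p 0) * ψ 1 (p 1) + ψ 0 (p 0) * dψ (p 1))
    -- The swap turns half of each κ into its transpose, so that the two halves make up ½ d_ξ ω, and
    -- it exchanges the two particles in the product of d_ξ ψ with ψ^2.
    ![Equiv.swap 0 1]
    ![fun p => algebraMap ℂ R (1 / 2) * (X * (κ 0 (p 0) (p 1) + κ 1 (p 0) (p 1)))
      + dψ (p 1) * ψ 1 (p 0)] fun p => ?_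
  simp only [Fin.sum_univ_one, Matrix.cons_val_zero, Function.comp_apply, Equiv.swap_apply_left,
    Equiv.swap_apply_right, Algebra.smul_def, ← hκ]
  linear_combination (-X * (κ 0 (p 0) (p 1) + κ 1 (p 0) (p 1))) * h2

theorem sum_variation_three (hκ : ∀ q i l, κ q i l + κ q l i = dom q i l)
    {Δ : (Fin 3 → Fin m) → R}
    (hΔ : ∀ (π : Equiv.Perm (Fin 3)) p, Δ (p ∘ π) = Δ p) :
    ∑ p : Fin 3 ↪ Fin m, Δ p * (((1 / 2 : ℂ) • (dψ (p 2) * (om 0 (p 0) (p 1) + om 1 (p 0) (p 1)))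
          + (κ 0 (p 0) (p 2) * ψ 1 (p 1) + ψ 0 (p 0) * κ 1 (p 1) (p 2)))
        + ((1 / 2 : ℂ) • (X * (om 0 (p 0) (p 1) + om 1 (p 0) (p 1))) + ψ 0 (p 0) * ψ 1 (p 1))
          * dH (p 2))
    = ∑ p : Fin 3 ↪ Fin m, Δ p *
        ((1 / 2 : ℂ) • (X * (om 0 (p 0) (p 1) + om 1 (p 0) (p 1)) * dH (p 2))
          + ψ 0 (p 0) * ψ 1 (p 1) * dH (p 2)
          + (1 / 2 : ℂ) • (dψ (p 0) * (om 1 (p 1) (p 2) + om 0 (p 1) (p 2)))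
          + (1 / 2 : ℂ) • (ψ 0 (p 0) * dom 1 (p 1) (p 2) + ψ 1 (p 0) * dom 0 (p 1) (p 2))) := by
  have h2 : (2 : R) * algebraMap ℂ R (1 / 2) = 1 := by
    rw [← map_ofNat (algebraMap ℂ R) 2, ← map_mul]
    norm_num
  refine sum_mul_eq_of_perm hΔ
    (f := fun p => ((1 / 2 : ℂ) • (dψ (p 2) * (om 0 (p 0) (p 1) + om 1 (p 0) (p 1)))
          + (κ 0 (p 0) (p 2) * ψ 1 (p 1) + ψ 0 (p 0) * κ 1 (p 1) (p 2)))
        + ((1 / 2 : ℂ) • (X * (om 0 (p 0) (p 1) + om 1 (p 0) (p 1))) + ψ 0 (p 0) * ψ 1 (p 1))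
          * dH (p 2))
    (g := fun p => (1 / 2 : ℂ) • (X * (om 0 (p 0) (p 1) + om 1 (p 0) (p 1)) * dH (p 2))
          + ψ 0 (p 0) * ψ 1 (p 1) * dH (p 2)
          + (1 / 2 : ℂ) • (dψ (p 0) * (om 1 (p 1) (p 2) + om 0 (p 1) (p 2)))
          + (1 / 2 : ℂ) • (ψ 0 (p 0) * dom 1 (p 1) (p 2) + ψ 1 (p 0) * dom 0 (p 1) (p 2)))
    -- Two transpositions of the last places symmetrize half of κ^2 and of κ^1; the swap of the
    -- first two places puts ψ^2 first; the 3-cycle moves d_ξ ψ from the last place to the first.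
    ![⟨![0, 2, 1], ![0, 2, 1], by decide, by decide⟩,
      ⟨![1, 0, 2], ![1, 0, 2], by decide, by decide⟩,
      ⟨![0, 2, 1], ![0, 2, 1], by decide, by decide⟩,
      ⟨![1, 2, 0], ![2, 0, 1], by decide, by decide⟩]
    ![fun p => algebraMap ℂ R (1 / 2) * (ψ 0 (p 0) * κ 1 (p 1) (p 2)),
      fun p => κ 0 (p 0) (p 2) * ψ 1 (p 1),
      fun p => algebraMap ℂ R (1 / 2) * (ψ 1 (p 0) * κ 0 (p 1) (p 2)),
      fun p => algebraMap ℂ R (1 / 2) * (dψ (p 2) * (om 0 (p 0) (p 1) + om 1 (p 0) (p 1)))]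
    fun p => ?_
  simp only [Fin.sum_univ_four, Matrix.cons_val, Function.comp_apply, Equiv.coe_fn_mk,
    Algebra.smul_def, ← hκ]
  linear_combination
    (-(ψ 0 (p 0) * κ 1 (p 1) (p 2)) - ψ 1 (p 0) * κ 0 (p 1) (p 2)) * h2

theorem sum_variation_four (hκ : ∀ q i l, κ q i l + κ q l i = dom q i l)
    {Δ : (Fin 4 → Fin m) → R}
    (hΔ : ∀ (π : Equiv.Perm (Fin 4)) p, Δ (p ∘ π) = Δ p) :
    ∑ p : Fin 4 ↪ Fin m, Δ p * ((1 / 2 : ℂ) • (κ 0 (p 0) (p 3) * om 1 (p 1) (p 2)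
          + κ 1 (p 0) (p 3) * om 0 (p 1) (p 2))
        + (1 / 2 : ℂ) • (ψ 0 (p 0) * om 1 (p 1) (p 2) + ψ 1 (p 0) * om 0 (p 1) (p 2)) * dH (p 3))
    = ∑ p : Fin 4 ↪ Fin m, Δ p *
        ((1 / 2 : ℂ) • ((ψ 0 (p 0) * om 1 (p 1) (p 2) + ψ 1 (p 0) * om 0 (p 1) (p 2)) * dH (p 3))
          + (1 / 4 : ℂ) • (dom 0 (p 0) (p 1) * om 1 (p 2) (p 3)
              + om 0 (p 0) (p 1) * dom 1 (p 2) (p 3))) := by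
  have h2 : algebraMap ℂ R (1 / 2) = 2 * algebraMap ℂ R (1 / 4) := by
    rw [← map_ofNat (algebraMap ℂ R) 2, ← map_mul]
    norm_num
  refine sum_mul_eq_of_perm hΔ
    (f := fun p => (1 / 2 : ℂ) • (κ 0 (p 0) (p 3) * om 1 (p 1) (p 2)
          + κ 1 (p 0) (p 3) * om 0 (p 1) (p 2))
        + (1 / 2 : ℂ) • (ψ 0 (p 0) * om 1 (p 1) (p 2) + ψ 1 (p 0) * om 0 (p 1) (p 2)) * dH (p 3))
    (g := fun p =>
        (1 / 2 : ℂ) • ((ψ 0 (p 0) * om 1 (p 1) (p 2) + ψ 1 (p 0) * om 0 (p 1) (p 2)) * dH (p 3))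
          + (1 / 4 : ℂ) • (dom 0 (p 0) (p 1) * om 1 (p 2) (p 3)
              + om 0 (p 0) (p 1) * dom 1 (p 2) (p 3)))
    -- The first and third permutations bring the two indices of κ next to each other, for q = 1 and
    -- q = 2 respectively. The second and fourth then symmetrize half of the result.
    ![⟨![0, 2, 3, 1], ![0, 3, 1, 2], by decide, by decide⟩,
      ⟨![1, 0, 2, 3], ![1, 0, 2, 3], by decide, by decide⟩,
      ⟨![2, 0, 1, 3], ![1, 2, 0, 3], by decide, by decide⟩,
      ⟨![0, 1, 3, 2], ![0, 1, 3, 2], by decide, by decide⟩]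
    ![fun p => algebraMap ℂ R (1 / 2) * (κ 0 (p 0) (p 3) * om 1 (p 1) (p 2)),
      fun p => algebraMap ℂ R (1 / 4) * (κ 0 (p 0) (p 1) * om 1 (p 2) (p 3)),
      fun p => algebraMap ℂ R (1 / 2) * (κ 1 (p 0) (p 3) * om 0 (p 1) (p 2)),
      fun p => algebraMap ℂ R (1 / 4) * (κ 1 (p 2) (p 3) * om 0 (p 0) (p 1))]
    fun p => ?_
  simp only [Fin.sum_univ_four, Matrix.cons_val, Function.comp_apply, Equiv.coe_fn_mk,
    Algebra.smul_def, ← hκ, h2]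
  ring

end Symmetrization

/-- The polynomial part of the term of `Kin.field` that belongs to given distinct particles, with
reduced determinant removed. The value at `4` is that of the field whose divergence is the part of
the variation with seven rows and columns removed. -/
def Kin.seed (D : Kin m) (ξ : Fin 2 → ℂ) (x : BosX) : (k : ℕ) → (Fin (k + 1) → Fin m) → Bos m
  | 0, _ => D.X2 x ^ 2
  | 1, p => D.X2 x * (D.psi ξ x 0 (p 0) + D.psi ξ x 1 (p 0))
  | 2, p => (1 / 2 : ℂ) • (D.X2 x * (D.omega ξ 0 (p 0) (p 1) + D.omega ξ 1 (p 0) (p 1)))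
            + D.psi ξ x 0 (p 0) * D.psi ξ x 1 (p 1)
  | 3, p => (1 / 2 : ℂ) • (D.psi ξ x 0 (p 0) * D.omega ξ 1 (p 1) (p 2)
            + D.psi ξ x 1 (p 0) * D.omega ξ 0 (p 1) (p 2))
  | 4, p => (1 / 4 : ℂ) • (D.omega ξ 0 (p 0) (p 1) * D.omega ξ 1 (p 2) (p 3))
  | _, _ => 0

/-- The vector field `Kin.field`, extended by a field whose divergence is the part of the variation
with seven rows and columns removed. -/
def Kin.divField (D : Kin m) (ξ ζ : Fin 2 → ℂ) (k : ℕ) (x : BosX) (J : SIdx) (A : Fin 2) : Gr m :=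
  ∑ p : Fin (k + 1) ↪ Fin m, D.dir ξ ζ (p (Fin.last k)) J A *
    ((D.redDet ξ p * D.seed ξ x k p * D.waveBos x : Bos m) : Gr m)

theorem Kin.field_eq (D : Kin m) (ξ ζ : Fin 2 → ℂ) {k : ℕ} (hk : k < 4) :
    D.field ξ ζ (k + 3) = D.divField ξ ζ k := by
  have e (k : ℕ) (x : BosX) (J : SIdx) (A : Fin 2) : D.divField ξ ζ k x J A
      = (∑ p : Fin (k + 1) ↪ Fin m, D.dir ξ ζ (p (Fin.last k)) J A *
        ((D.redDet ξ p * D.seed ξ x k p : Bos m) : Gr m)) * D.wave x := by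
    rw [Finset.sum_mul]
    exact Finset.sum_congr rfl fun p _ => (mul_assoc _ _ _).symm
  funext x J A
  rw [e]
  obtain rfl | rfl | rfl | rfl : k = 0 ∨ k = 1 ∨ k = 2 ∨ k = 3 := by omega
  all_goals rfl

/-- The determinants are independent of X and the wave function always contributes d_ξ ℍ at the last
index. For each order only the polynomial seed remains to be differentiated. -/
theorem Kin.hasSuperDivAt_divField_of_seed (D : Kin m) (ξ ζ : Fin 2 → ℂ) (k : ℕ) (x : BosX)
    {S' : (Fin (k + 1) → Fin m) → Bos m}
    (hS : ∀ p : Fin (k + 1) ↪ Fin m,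
      HasSuperDerivAt (D.dir ξ ζ (p (Fin.last k))) (fun y => D.seed ξ y k p) (S' p) x) :
    HasSuperDivAt (D.divField ξ ζ k) (((∑ p : Fin (k + 1) ↪ Fin m, D.redDet ξ p *
      (S' p + D.seed ξ x k p * D.dHodges ξ ζ (p (Fin.last k)))) : Bos m) * D.wave x : Gr m) x := by
  have h (p : Fin (k + 1) ↪ Fin m) := (((hS p).const_mul (D.redDet_mem_thetaFree ξ p)).mul
    (D.hasSuperDerivAt_wave ξ ζ (p (Fin.last k)) x)).hasSuperDivAt (D.isThetaFreeDir ξ ζ _)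
  have h' := HasSuperDivAt.sum (s := Finset.univ) fun p _ => h p
  have e : (((∑ p : Fin (k + 1) ↪ Fin m, D.redDet ξ p *
      (S' p + D.seed ξ x k p * D.dHodges ξ ζ (p (Fin.last k)))) : Bos m) * D.wave x : Gr m)
      = ((∑ p : Fin (k + 1) ↪ Fin m, (D.redDet ξ p * S' p * D.waveBos x
        + D.redDet ξ p * D.seed ξ x k p * (D.dHodges ξ ζ (p (Fin.last k)) * D.waveBos x)) :
          Bos m) : Gr m) := by
    change (((∑ p : Fin (k + 1) ↪ Fin m, D.redDet ξ p *
      (S' p + D.seed ξ x k p * D.dHodges ξ ζ (p (Fin.last k)))) * D.waveBos x : Bos m) : Gr m) = _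
    rw [Finset.sum_mul]
    congr 1
    refine Finset.sum_congr rfl fun p _ => ?_
    rw [mul_add, add_mul, mul_assoc (D.redDet ξ p) _ (_ * _), mul_assoc, mul_assoc, mul_assoc]
  rw [e, AddSubmonoidClass.coe_finsetSum]
  exact h'

theorem Kin.hasSuperDivAt_divField_zero (D : Kin m) (hr : D.r ^ 2 = D.Λ) (ξ ζ : Fin 2 → ℂ)
    (x : BosX) : HasSuperDivAt (D.divField ξ ζ 0) (D.variation ξ ζ 3 x) x := by
  have hX (l : Fin m) := D.hasSuperDerivAt_X2 hr ξ ζ l x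
  have hS := D.hasSuperDivAt_divField_of_seed ξ ζ 0 x
    (S' := fun p => D.dPsi ξ ζ x (p 0) * D.X2 x + D.X2 x * D.dPsi ξ ζ x (p 0)) fun p => by
      simp only [Kin.seed, sq]
      exact (hX (p 0)).mul (hX (p 0))
  have e : D.variationFactor ξ ζ 3 x = ∑ p : Fin 1 ↪ Fin m, D.redDet ξ p *
      ((D.dPsi ξ ζ x (p 0) * D.X2 x + D.X2 x * D.dPsi ξ ζ x (p 0))
        + D.X2 x ^ 2 * D.dHodges ξ ζ (p 0)) := by
    refine Finset.sum_congr rfl fun p _ => ?_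
    rw [mul_comm (D.dPsi ξ ζ x (p 0)), ← two_mul, add_comm]
  rw [D.variation_eq, e]
  exact hS

theorem Kin.hasSuperDivAt_divField_one (D : Kin m) (hr : D.r ^ 2 = D.Λ) (ξ ζ : Fin 2 → ℂ)
    (h : Regular D.σ ξ) (x : BosX) :
    HasSuperDivAt (D.divField ξ ζ 1) (D.variation ξ ζ 4 x) x := by
  have hψ (q : Fin 2) (i l : Fin m) := D.hasSuperDerivAt_psi ξ ζ l q i x
  have hS := D.hasSuperDivAt_divField_of_seed ξ ζ 1 x
    (S' := fun p => D.dPsi ξ ζ x (p 1) * (D.psi ξ x 0 (p 0) + D.psi ξ x 1 (p 0))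
        + D.X2 x * (D.kappa ξ ζ 0 (p 0) (p 1) + D.kappa ξ ζ 1 (p 0) (p 1))) fun p =>
      (D.hasSuperDerivAt_X2 hr ξ ζ (p 1) x).mul ((hψ 0 (p 0) (p 1)).add (hψ 1 (p 0) (p 1)))
  have e := sum_variation_two (D.X2 x) (D.psi ξ x) (D.dPsi ξ ζ x) (D.dHodges ξ ζ) (D.dOmega ξ ζ)
    (D.kappa ξ ζ) (D.kappa_add_kappa ξ ζ h) (Δ := D.redDet ξ) (D.redDet_perm ξ)
  rw [D.variation_eq, show D.variationFactor ξ ζ 4 x = _ from e.symm]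
  exact hS

theorem Kin.hasSuperDivAt_divField_two (D : Kin m) (hr : D.r ^ 2 = D.Λ) (ξ ζ : Fin 2 → ℂ)
    (h : Regular D.σ ξ) (x : BosX) :
    HasSuperDivAt (D.divField ξ ζ 2) (D.variation ξ ζ 5 x) x := by
  have hψ (q : Fin 2) (i l : Fin m) := D.hasSuperDerivAt_psi ξ ζ l q i x
  have ho (q : Fin 2) (i j : Fin m) := D.omega_mem_thetaFree ξ q i j
  have hS := D.hasSuperDivAt_divField_of_seed ξ ζ 2 x
    (S' := fun p => (1 / 2 : ℂ) • (D.dPsi ξ ζ x (p 2)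
          * (D.omega ξ 0 (p 0) (p 1) + D.omega ξ 1 (p 0) (p 1)))
        + (D.kappa ξ ζ 0 (p 0) (p 2) * D.psi ξ x 1 (p 1)
          + D.psi ξ x 0 (p 0) * D.kappa ξ ζ 1 (p 1) (p 2))) fun p =>
      (((D.hasSuperDerivAt_X2 hr ξ ζ (p 2) x).mul_const
        (add_mem (ho 0 (p 0) (p 1)) (ho 1 (p 0) (p 1)))).const_smul
        (1 / 2)).add ((hψ 0 (p 0) (p 2)).mul (hψ 1 (p 1) (p 2)))
  have e := sum_variation_three (D.X2 x) (D.psi ξ x) (D.dPsi ξ ζ x) (D.dHodges ξ ζ) (D.omega ξ)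
    (D.dOmega ξ ζ) (D.kappa ξ ζ) (D.kappa_add_kappa ξ ζ h) (Δ := D.redDet ξ) (D.redDet_perm ξ)
  rw [D.variation_eq, show D.variationFactor ξ ζ 5 x = _ from e.symm]
  exact hS

theorem Kin.hasSuperDivAt_divField_three (D : Kin m) (ξ ζ : Fin 2 → ℂ)
    (h : Regular D.σ ξ) (x : BosX) :
    HasSuperDivAt (D.divField ξ ζ 3) (D.variation ξ ζ 6 x) x := by
  have hψ (q : Fin 2) (i l : Fin m) := D.hasSuperDerivAt_psi ξ ζ l q i x
  have ho (q : Fin 2) (i j : Fin m) := D.omega_mem_thetaFree ξ q i j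
  have hS := D.hasSuperDivAt_divField_of_seed ξ ζ 3 x
    (S' := fun p => (1 / 2 : ℂ) • (D.kappa ξ ζ 0 (p 0) (p 3) * D.omega ξ 1 (p 1) (p 2)
          + D.kappa ξ ζ 1 (p 0) (p 3) * D.omega ξ 0 (p 1) (p 2))) fun p =>
      (((hψ 0 (p 0) (p 3)).mul_const (ho 1 (p 1) (p 2))).add
        ((hψ 1 (p 0) (p 3)).mul_const (ho 0 (p 1) (p 2)))).const_smul (1 / 2)
  have e := sum_variation_four (D.psi ξ x) (D.dHodges ξ ζ) (D.omega ξ)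
    (D.dOmega ξ ζ) (D.kappa ξ ζ) (D.kappa_add_kappa ξ ζ h) (Δ := D.redDet ξ) (D.redDet_perm ξ)
  rw [D.variation_eq, show D.variationFactor ξ ζ 6 x = _ from e.symm]
  exact hS

/-- The seed ωω is constant in X, so only the wave function varies. This is momentum conservation:
the factor [W_p, 𝒫·ξ] is a derivative of e^{i𝒫·X}. -/
theorem Kin.hasSuperDivAt_divField_four (D : Kin m) (ξ ζ : Fin 2 → ℂ) (x : BosX) :
    HasSuperDivAt (D.divField ξ ζ 4) (D.variation ξ ζ 7 x) x := by
  have ho (q : Fin 2) (i j : Fin m) := D.omega_mem_thetaFree ξ q i j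
  have hS := D.hasSuperDivAt_divField_of_seed ξ ζ 4 x (S' := fun _ => 0) fun p => .const
    (Subalgebra.smul_mem _ (mul_mem (ho 0 (p 0) (p 1)) (ho 1 (p 2) (p 3))) _) x
  have e : D.variationFactor ξ ζ 7 x = ∑ p : Fin 5 ↪ Fin m, D.redDet ξ p * (0 +
      (1 / 4 : ℂ) • (D.omega ξ 0 (p 0) (p 1) * D.omega ξ 1 (p 2) (p 3)) * D.dHodges ξ ζ (p 4)) := by
    refine Finset.sum_congr rfl fun p _ => ?_
    rw [zero_add, smul_mul_assoc]
  rw [D.variation_eq, e]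
  exact hS

theorem Kin.hasSuperDivAt_divField (D : Kin m) (hr : D.r ^ 2 = D.Λ) (ξ ζ : Fin 2 → ℂ)
    (h : Regular D.σ ξ) {k : ℕ} (hk : k < 5) (x : BosX) :
    HasSuperDivAt (D.divField ξ ζ k) (D.variation ξ ζ (k + 3) x) x := by
  obtain rfl | rfl | rfl | rfl | rfl : k = 0 ∨ k = 1 ∨ k = 2 ∨ k = 3 ∨ k = 4 := by omega
  · exact D.hasSuperDivAt_divField_zero hr ξ ζ x
  · exact D.hasSuperDivAt_divField_one hr ξ ζ h x
  · exact D.hasSuperDivAt_divField_two hr ξ ζ h x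
  · exact D.hasSuperDivAt_divField_three ξ ζ h x
  · exact D.hasSuperDivAt_divField_four ξ ζ x

/-! ### Polynomial dependence on the dual twistors and on the coordinates -/

/-- The polynomial functions of a complex matrix of coordinates. -/
def coordPolynomials (κ κ' : Type*) : Subalgebra ℂ ((κ → κ' → ℂ) → ℂ) :=
  Algebra.adjoin ℂ (Set.range fun (p : κ × κ') x => x p.1 p.2)

theorem coord_mem_coordPolynomials {κ κ' : Type*} (i : κ) (j : κ') :
    (fun x : κ → κ' → ℂ => x i j) ∈ coordPolynomials κ κ' :=
  Algebra.subset_adjoin ⟨(i, j), rfl⟩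

theorem hasTemperateGrowth_coordPolynomials {κ κ' : Type*} [Fintype κ] [Fintype κ']
    {b : (κ → κ' → ℂ) → ℂ} (hb : b ∈ coordPolynomials κ κ') :
    (fun x : κ → κ' → ℝ => b fun i j => (x i j : ℂ)).HasTemperateGrowth := by
  induction hb using Algebra.adjoin_induction with
  | mem b hb =>
    obtain ⟨⟨i, j⟩, rfl⟩ := hb
    exact (Complex.ofRealCLM.comp ((ContinuousLinearMap.proj (R := ℝ) (φ := fun _ : κ' => ℝ) j).comp
      (ContinuousLinearMap.proj (R := ℝ) (φ := fun _ : κ => κ' → ℝ) i))).hasTemperateGrowth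
  | algebraMap c => exact .const c
  | add a b _ _ ha hb => exact ha.add hb
  | mul a b _ _ ha hb => exact ha.mul hb

theorem contDiff_coordPolynomials {κ κ' : Type*} [Fintype κ] [Fintype κ']
    {b : (κ → κ' → ℂ) → ℂ} (hb : b ∈ coordPolynomials κ κ') : ContDiff ℂ ∞ b := by
  induction hb using Algebra.adjoin_induction with
  | mem b hb =>
    obtain ⟨⟨i, j⟩, rfl⟩ := hb
    fun_prop
  | algebraMap c => exact contDiff_const
  | add a b _ _ ha hb => exact ha.add hb
  | mul a b _ _ ha hb => exact ha.mul hb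

theorem exists_partialDeriv_coordPolynomials {b : BosX → ℂ} (hb : b ∈ coordPolynomials (Fin 4) (Fin 2))
    (α : Fin 4) (A : Fin 2) : ∃ b' ∈ coordPolynomials (Fin 4) (Fin 2), ∀ x : BosX,
      HasDerivAt (fun t => b (Function.update x α (Function.update (x α) A t))) (b' x) (x α A) := by
  induction hb using Algebra.adjoin_induction with
  | mem b hb =>
    obtain ⟨⟨i, j⟩, rfl⟩ := hb
    exact ⟨fun _ => if i = α ∧ j = A then 1 else 0, Subalgebra.algebraMap_mem _ _,
      fun x => hasDerivAt_coord x α i A j⟩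
  | algebraMap c => exact ⟨0, zero_mem _, fun x => hasDerivAt_const _ _⟩
  | add a b _ _ ha hb =>
    obtain ⟨a', ha', ha⟩ := ha
    obtain ⟨b', hb', hb⟩ := hb
    exact ⟨a' + b', add_mem ha' hb', fun x => (ha x).add (hb x)⟩
  | mul a b ha₀ hb₀ ha hb =>
    obtain ⟨a', ha', ha⟩ := ha
    obtain ⟨b', hb', hb⟩ := hb
    refine ⟨a' * b + a * b', add_mem (mul_mem ha' hb₀) (mul_mem ha₀ hb'), fun x => ?_⟩
    have h := (ha x).mul (hb x)
    simp only [Function.update_eq_self] at h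
    exact h

/-- Configurations of marked points together with a reference spinor. -/
abbrev Config (m : ℕ) : Type := (Pt m → Fin 2 → ℂ) × (Fin 2 → ℂ)

/-- The functions of the marked points and of the reference spinor that are holomorphic at the
regular configurations. -/
def regularFunctions (m : ℕ) : Subalgebra ℂ (Config m → ℂ) where
  carrier := {c | ∀ p : Config m, Regular p.1 p.2 → DifferentiableAt ℂ c p}
  mul_mem' {_ _} ha hb p hp := (ha p hp).mul (hb p hp)
  add_mem' {_ _} ha hb p hp := (ha p hp).add (hb p hp)
  algebraMap_mem' c _ _ := differentiableAt_const c

/-- Bosonic parameters: a configuration, the dual twistors and the coordinates. -/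
abbrev Param (m : ℕ) : Type := Config m × (Pt m → Fin 4 → ℂ) × BosX

/-- The polynomials in the dual twistors and the coordinates whose coefficients are holomorphic at
the regular configurations. -/
def paramPolynomials (m : ℕ) : Subalgebra ℂ (Param m → ℂ) where
  carrier := {f | ∃ (ι : Type) (_ : Fintype ι) (c : ι → Config m → ℂ)
    (a : ι → (Pt m → Fin 4 → ℂ) → ℂ) (b : ι → BosX → ℂ), (∀ i, c i ∈ regularFunctions m) ∧
      (∀ i, a i ∈ coordPolynomials (Pt m) (Fin 4)) ∧
      (∀ i, b i ∈ coordPolynomials (Fin 4) (Fin 2)) ∧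
      ∀ p, f p = ∑ i, c i p.1 * (a i p.2.1 * b i p.2.2)}
  mul_mem' := by
    rintro f g ⟨ι, _, c, a, b, hc, ha, hb, hf⟩ ⟨κ, _, c', a', b', hc', ha', hb', hg⟩
    refine ⟨ι × κ, inferInstance, fun i => c i.1 * c' i.2, fun i => a i.1 * a' i.2,
      fun i => b i.1 * b' i.2, fun i => mul_mem (hc _) (hc' _), fun i => mul_mem (ha _) (ha' _),
      fun i => mul_mem (hb _) (hb' _), fun p => ?_⟩
    rw [Pi.mul_apply, hf, hg, Finset.sum_mul_sum, ← Fintype.sum_prod_type']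
    refine Finset.sum_congr rfl fun i _ => ?_
    simp only [Pi.mul_apply]
    ring
  add_mem' := by
    rintro f g ⟨ι, _, c, a, b, hc, ha, hb, hf⟩ ⟨κ, _, c', a', b', hc', ha', hb', hg⟩
    refine ⟨ι ⊕ κ, inferInstance, Sum.elim c c', Sum.elim a a', Sum.elim b b',
      Sum.forall.2 ⟨hc, hc'⟩, Sum.forall.2 ⟨ha, ha'⟩, Sum.forall.2 ⟨hb, hb'⟩, fun p => ?_⟩
    simp [hf, hg]
  algebraMap_mem' c := ⟨Unit, inferInstance, fun _ _ => c, fun _ => 1, fun _ => 1,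
    fun _ => Subalgebra.algebraMap_mem _ c, fun _ => one_mem _, fun _ => one_mem _, fun p => by simp⟩

theorem coeff_mem_paramPolynomials {c : Config m → ℂ} (hc : c ∈ regularFunctions m) :
    (fun p : Param m => c p.1) ∈ paramPolynomials m :=
  ⟨Unit, inferInstance, fun _ => c, fun _ => 1, fun _ => 1, fun _ => hc, fun _ => one_mem _,
    fun _ => one_mem _, fun p => by simp⟩

theorem w_mem_paramPolynomials (i : Pt m) (α : Fin 4) :
    (fun p : Param m => p.2.1 i α) ∈ paramPolynomials m :=
  ⟨Unit, inferInstance, fun _ => 1, fun _ w => w i α, fun _ => 1, fun _ => one_mem _,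
    fun _ => coord_mem_coordPolynomials i α, fun _ => one_mem _, fun p => by simp⟩

theorem x_mem_paramPolynomials (α : Fin 4) (A : Fin 2) :
    (fun p : Param m => p.2.2 α A) ∈ paramPolynomials m :=
  ⟨Unit, inferInstance, fun _ => 1, fun _ => 1, fun _ x => x α A, fun _ => one_mem _,
    fun _ => one_mem _, fun _ => coord_mem_coordPolynomials α A, fun p => by simp⟩

/-- The kinematic data at given values of the parameters. -/
def Param.kin (Λ r : ℂ) (p : Param m) : Kin m := ⟨Λ, r, p.1.1, p.2.1⟩

section Membership

variable (Λ r : ℂ) (ζ : Fin 2 → ℂ)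

theorem brW_mem (i j : Pt m) :
    (fun p : Param m => (p.kin Λ r).brW i j) ∈ bosFunctions m (paramPolynomials m) := by
  rw [mem_bosFunctions]
  simp only [Kin.coe_brW]
  have hw := w_mem_paramPolynomials (m := m)
  refine add_mem (algebraMap_mem_grFunctions ?_)
    (const_mem_grFunctions (r • ∑ a, gen (Sum.inl (j, a)) * gen (Sum.inl (i, a))))
  exact add_mem (sub_mem (Subalgebra.smul_mem _ (sub_mem (mul_mem (hw j 1) (hw i 0))
    (mul_mem (hw j 0) (hw i 1))) Λ) (mul_mem (hw j 3) (hw i 2))) (mul_mem (hw j 2) (hw i 3))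

theorem X2_mem :
    (fun p : Param m => (p.kin Λ r).X2 p.2.2) ∈ bosFunctions m (paramPolynomials m) := by
  rw [mem_bosFunctions]
  simp only [Kin.coe_X2]
  have hx := x_mem_paramPolynomials (m := m)
  refine add_mem (algebraMap_mem_grFunctions ?_)
    (const_mem_grFunctions (r • ∑ a, gen (Sum.inr (a, 1)) * gen (Sum.inr (a, 0))))
  exact add_mem (sub_mem (mul_mem (hx 0 0) (hx 1 1)) (mul_mem (hx 0 1) (hx 1 0)))
    (Subalgebra.smul_mem _ (sub_mem (mul_mem (hx 2 1) (hx 3 0)) (mul_mem (hx 3 1) (hx 2 0))) Λ)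

theorem ZW_mem {s : Config m → Fin 2 → ℂ} (hs : ∀ A, (fun c => s c A) ∈ regularFunctions m)
    (i : Pt m) : (fun p : Param m => (p.kin Λ r).ZW p.2.2 (s p.1) i)
      ∈ bosFunctions m (paramPolynomials m) := by
  rw [mem_bosFunctions]
  simp only [Kin.coe_ZW]
  have hw := w_mem_paramPolynomials (m := m)
  have hx := x_mem_paramPolynomials (m := m)
  have hs' (A : Fin 2) := coeff_mem_paramPolynomials (hs A)
  refine add_mem (algebraMap_mem_grFunctions ?_) ?_
  · have h := sum_mem (S := paramPolynomials m) (t := Finset.univ) fun α _ =>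
      mul_mem (sub_mem (mul_mem (hs' 0) (hx α 1)) (mul_mem (hs' 1) (hx α 0))) (hw i α)
    convert h using 1
    funext p
    simp [Param.kin]
  · have h := sum_mem (S := grFunctions m (paramPolynomials m)) (t := Finset.univ) fun a _ =>
      mul_mem (sub_mem
        (smul_mem_grFunctions (hs' 0) (const_mem_grFunctions (m := m) (gen (Sum.inr (a, 1)))))
        (smul_mem_grFunctions (hs' 1) (const_mem_grFunctions (gen (Sum.inr (a, 0))))))
        (const_mem_grFunctions (gen (Sum.inl (i, a))))
    convert h using 1
    funext p
    simp [gen]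

theorem soul_mem : (fun p : Param m => (p.kin Λ r).soul) ∈ grFunctions m (paramPolynomials m) := by
  have hs (j : Pt m) (A : Fin 2) : (fun p : Param m => p.1.1 j A) ∈ paramPolynomials m :=
    coeff_mem_paramPolynomials (c := fun c => c.1 j A) fun p _ => by fun_prop
  have h := (grFunctions m (paramPolynomials m)).smul_mem
    (sum_mem (S := grFunctions m (paramPolynomials m)) (t := Finset.univ) fun j _ =>
      sum_mem (t := Finset.univ) fun a _ => mul_mem (sub_mem
        (smul_mem_grFunctions (hs j 0) (const_mem_grFunctions (m := m) (gen (Sum.inr (a, 1)))))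
        (smul_mem_grFunctions (hs j 1) (const_mem_grFunctions (gen (Sum.inr (a, 0))))))
        (const_mem_grFunctions (gen (Sum.inl (j, a))))) Complex.I
  convert h using 1
  funext p
  simp [gen, Kin.soul, Param.kin]

theorem exp_soul_mem : (fun p : Param m => IsNilpotent.exp (p.kin Λ r).soul)
    ∈ grFunctions m (paramPolynomials m) := by
  have h := sum_mem (S := grFunctions m (paramPolynomials m))
    (t := Finset.range (Module.finrank ℂ (Gr m))) fun i _ =>
      (grFunctions m (paramPolynomials m)).smul_mem (pow_mem (soul_mem (m := m) Λ r) i)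
        ((i.factorial : ℂ)⁻¹)
  convert h using 1
  funext p
  rw [nilpotentExp_eq_sum (pow_finrank_eq_zero (p.kin Λ r).isNilpotent_soul)]
  simp

theorem redDet_mem {k : ℕ} (q : Fin k → Fin m) :
    (fun p : Param m => (p.kin Λ r).redDet p.1.2 q) ∈ bosFunctions m (paramPolynomials m) := by
  refine det_mem_bosFunctions fun i j => ?_
  simp only [Matrix.submatrix_apply, Kin.hodges]
  have hsp (i j : Pt m) (hij : i ≠ j) :
      (fun c : Config m => -(1 / spin (c.1 i) (c.1 j))) ∈ regularFunctions m := fun c hc => by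
    have := hc.1 i j hij
    simp only [spin] at *
    fun_prop (disch := assumption)
  have hoff (i j : Pt m) (hij : i ≠ j) := smul_mem_bosFunctions
    (coeff_mem_paramPolynomials (hsp i j hij)) (brW_mem (m := m) Λ r i j)
  split_ifs with h
  · have h' := neg_mem (s := bosFunctions m (paramPolynomials m))
      (sum_mem (S := bosFunctions m (paramPolynomials m))
        (t := Finset.univ.erase (Sum.inr i.1 : Pt m)) fun l hl => smul_mem_bosFunctions
          (coeff_mem_paramPolynomials (c := fun c => spin c.2 (c.1 l) ^ 2 /
            spin c.2 (c.1 (Sum.inr i.1)) ^ 2) fun c hc => by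
              have := pow_ne_zero 2 (hc.2 i.1)
              simp only [spin] at *
              fun_prop (disch := assumption))
          (hoff (Sum.inr i.1) l (Finset.ne_of_mem_erase hl).symm))
    convert h' using 1
    funext p
    rw [Pi.neg_apply, Finset.sum_apply]
    rfl
  · exact hoff _ _ h

theorem psi_mem (q : Fin 2) (i : Fin m) :
    (fun p : Param m => (p.kin Λ r).psi p.1.2 p.2.2 q i) ∈ bosFunctions m (paramPolynomials m) := by
  refine smul_mem_bosFunctions (coeff_mem_paramPolynomials (c := fun c =>
      Complex.I * Λ * spin c.2 (c.1 (Sum.inl q)) / ((spin (c.1 (Sum.inl q)) (c.1 (Sum.inr i))) ^ 2 *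
        (spin c.2 (c.1 (Sum.inr i))) ^ 2)) fun c hc => ?_)
    (add_mem (smul_mem_bosFunctions (coeff_mem_paramPolynomials
      (c := fun c => spin c.2 (c.1 (Sum.inr i))) fun c hc => ?_)
      (ZW_mem Λ r (s := fun c => c.1 (Sum.inl q)) (fun A c _ => ?_) (Sum.inr i)))
    (smul_mem_bosFunctions (coeff_mem_paramPolynomials
      (c := fun c => spin (c.1 (Sum.inl q)) (c.1 (Sum.inr i))) fun c hc => ?_)
      (ZW_mem Λ r (s := fun c => c.2) (fun A c _ => ?_) (Sum.inr i))))
  · have := mul_ne_zero (pow_ne_zero 2 (hc.1 (Sum.inl q) (Sum.inr i) (by simp)))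
      (pow_ne_zero 2 (hc.2 i))
    simp only [spin] at *
    fun_prop (disch := assumption)
  all_goals
    try simp only [spin]
    fun_prop

theorem dPsi_mem (i : Fin m) :
    (fun p : Param m => (p.kin Λ r).dPsi p.1.2 ζ p.2.2 i)
      ∈ bosFunctions m (paramPolynomials m) := by
  refine smul_mem_bosFunctions (coeff_mem_paramPolynomials (c := fun c =>
      2 * Complex.I * Λ * spin c.2 ζ / (spin (c.1 (Sum.inr i)) c.2) ^ 3) fun c hc => ?_)
    (ZW_mem Λ r (s := fun c => c.2) (fun A c _ => ?_) (Sum.inr i))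
  · have := pow_ne_zero 3 (spin_ne_zero_swap (hc.2 i))
    simp only [spin] at *
    fun_prop (disch := assumption)
  · fun_prop

theorem omega_mem (q : Fin 2) (i j : Fin m) :
    (fun p : Param m => (p.kin Λ r).omega p.1.2 q i j) ∈ bosFunctions m (paramPolynomials m) := by
  refine smul_mem_bosFunctions (coeff_mem_paramPolynomials (c := fun c =>
      (Λ * (spin (c.1 (Sum.inl q)) c.2) ^ 4 * spin (c.1 (Sum.inr i)) (c.1 (Sum.inr j)) /
      ((spin (c.1 (Sum.inl q)) (c.1 (Sum.inr i))) ^ 2 *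
        (spin (c.1 (Sum.inl q)) (c.1 (Sum.inr j))) ^ 2 * (spin c.2 (c.1 (Sum.inr i))) ^ 2 *
        (spin c.2 (c.1 (Sum.inr j))) ^ 2))) fun c hc => ?_) (brW_mem Λ r _ _)
  have := mul_ne_zero (mul_ne_zero (mul_ne_zero
      (pow_ne_zero 2 (hc.1 (Sum.inl q) (Sum.inr i) (by simp)))
      (pow_ne_zero 2 (hc.1 (Sum.inl q) (Sum.inr j) (by simp))))
      (pow_ne_zero 2 (hc.2 i))) (pow_ne_zero 2 (hc.2 j))
  simp only [spin] at *
  fun_prop (disch := assumption)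

theorem dOmega_mem (q : Fin 2) (i j : Fin m) :
    (fun p : Param m => (p.kin Λ r).dOmega p.1.2 ζ q i j)
      ∈ bosFunctions m (paramPolynomials m) := by
  refine smul_mem_bosFunctions (coeff_mem_paramPolynomials (c := fun c =>
      (2 * Λ * spin (c.1 (Sum.inr i)) (c.1 (Sum.inr j)) * (spin (c.1 (Sum.inl q)) c.2) ^ 3 /
      ((spin (c.1 (Sum.inl q)) (c.1 (Sum.inr i))) ^ 2 *
        (spin (c.1 (Sum.inl q)) (c.1 (Sum.inr j))) ^ 2 * (spin (c.1 (Sum.inr i)) c.2) ^ 3 *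
        (spin (c.1 (Sum.inr j)) c.2) ^ 3) *
      (spin (c.1 (Sum.inr j)) c.2 * spin (c.1 (Sum.inr i)) (c.1 (Sum.inl q))
        + spin (c.1 (Sum.inr i)) c.2 * spin (c.1 (Sum.inr j)) (c.1 (Sum.inl q)))
        * spin c.2 ζ)) fun c hc => ?_) (brW_mem Λ r _ _)
  have := mul_ne_zero (mul_ne_zero (mul_ne_zero
      (pow_ne_zero 2 (hc.1 (Sum.inl q) (Sum.inr i) (by simp)))
      (pow_ne_zero 2 (hc.1 (Sum.inl q) (Sum.inr j) (by simp))))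
      (pow_ne_zero 3 (spin_ne_zero_swap (hc.2 i)))) (pow_ne_zero 3 (spin_ne_zero_swap (hc.2 j)))
  simp only [spin] at *
  fun_prop (disch := assumption)

theorem dHodges_mem (i : Fin m) :
    (fun p : Param m => (p.kin Λ r).dHodges p.1.2 ζ i) ∈ bosFunctions m (paramPolynomials m) := by
  have hs := sum_mem (S := bosFunctions m (paramPolynomials m)) (t := Finset.univ) fun j _ =>
    smul_mem_bosFunctions (coeff_mem_paramPolynomials (c := fun c => spin (c.1 j) c.2)
      fun c hc => by simp only [spin]; fun_prop) (brW_mem (m := m) Λ r (Sum.inr i) j)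
  have h := smul_mem_bosFunctions (coeff_mem_paramPolynomials (c := fun c =>
      2 * spin c.2 ζ / (spin (c.1 (Sum.inr i)) c.2) ^ 3) fun c hc => by
        have := pow_ne_zero 3 (spin_ne_zero_swap (hc.2 i))
        simp only [spin] at *
        fun_prop (disch := assumption)) hs
  convert h using 1
  funext p
  rw [Finset.sum_apply]
  rfl

theorem dir_mem (i : Fin m) (J : SIdx) (A : Fin 2) :
    (fun p : Param m => (p.kin Λ r).dir p.1.2 ζ i J A) ∈ grFunctions m (paramPolynomials m) := by
  have hc : (fun c : Config m => -2 * Complex.I * spin c.2 ζ / (spin (c.1 (Sum.inr i)) c.2) ^ 3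
      * c.2 A) ∈ regularFunctions m := fun c hc => by
    have := pow_ne_zero 3 (spin_ne_zero_swap (hc.2 i))
    simp only [spin] at *
    fun_prop (disch := assumption)
  rcases J with α | a
  · simp only [Kin.dir_inl]
    refine algebraMap_mem_grFunctions (mul_mem (coeff_mem_paramPolynomials hc) ?_)
    have hw := w_mem_paramPolynomials (m := m) (Sum.inr i)
    fin_cases α
    · exact Subalgebra.smul_mem _ (hw 1) (-Λ)
    · exact Subalgebra.smul_mem _ (hw 0) Λ
    · exact hw 3
    · exact neg_mem (hw 2)
  · simp only [Kin.dir_inr]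
    exact smul_mem_grFunctions (mul_mem (coeff_mem_paramPolynomials hc)
      (Subalgebra.algebraMap_mem _ r)) (const_mem_grFunctions _)

theorem fun_sum_mem {P R ι : Type*} [CommRing R] [Algebra ℂ R] [Fintype ι]
    {S : Subalgebra ℂ (P → R)} {F : ι → P → R} (hF : ∀ i, F i ∈ S) :
    (fun p => ∑ i, F i p) ∈ S := by
  have h := sum_mem (t := Finset.univ) fun i _ => hF i
  convert h using 1
  funext p
  rw [Finset.sum_apply]

theorem integrandFactor_mem : (fun p : Param m => (p.kin Λ r).integrandFactor p.2.2 p.1.2)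
    ∈ bosFunctions m (paramPolynomials m) := by
  have hX := X2_mem (m := m) Λ r
  have hψ := psi_mem (m := m) Λ r
  have ho := omega_mem (m := m) Λ r
  have hΔ {k : ℕ} (q : Fin k → Fin m) := redDet_mem Λ r q
  exact add_mem (add_mem (add_mem (add_mem (add_mem (mul_mem (pow_mem hX 2) (hΔ ![]))
    (mul_mem hX (fun_sum_mem fun q => mul_mem (add_mem (hψ 0 (q 0)) (hψ 1 (q 0))) (hΔ q))))
    (mul_mem hX (fun_sum_mem fun q => Subalgebra.smul_mem _
      (mul_mem (add_mem (ho 0 (q 0) (q 1)) (ho 1 (q 0) (q 1))) (hΔ q)) _)))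
    (fun_sum_mem fun q => mul_mem (mul_mem (hψ 0 (q 0)) (hψ 1 (q 1))) (hΔ q)))
    (fun_sum_mem fun q => Subalgebra.smul_mem _ (mul_mem (add_mem
      (mul_mem (hψ 0 (q 0)) (ho 1 (q 1) (q 2))) (mul_mem (hψ 1 (q 0)) (ho 0 (q 1) (q 2))))
        (hΔ q)) _))
    (fun_sum_mem fun q => Subalgebra.smul_mem _
      (mul_mem (mul_mem (ho 0 (q 0) (q 1)) (ho 1 (q 2) (q 3))) (hΔ q)) _)

theorem seed_mem (k : ℕ) (q : Fin (k + 1) → Fin m) :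
    (fun p : Param m => (p.kin Λ r).seed p.1.2 p.2.2 k q)
      ∈ bosFunctions m (paramPolynomials m) := by
  have hX := X2_mem (m := m) Λ r
  have hψ := psi_mem (m := m) Λ r
  have ho := omega_mem (m := m) Λ r
  match k, q with
  | 0, q => exact pow_mem hX 2
  | 1, q => exact mul_mem hX (add_mem (hψ 0 (q 0)) (hψ 1 (q 0)))
  | 2, q =>
    exact add_mem (Subalgebra.smul_mem _
      (mul_mem hX (add_mem (ho 0 (q 0) (q 1)) (ho 1 (q 0) (q 1)))) _)
      (mul_mem (hψ 0 (q 0)) (hψ 1 (q 1)))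
  | 3, q => exact Subalgebra.smul_mem _ (add_mem
      (mul_mem (hψ 0 (q 0)) (ho 1 (q 1) (q 2))) (mul_mem (hψ 1 (q 0)) (ho 0 (q 1) (q 2)))) _
  | 4, q => exact Subalgebra.smul_mem _ (mul_mem (ho 0 (q 0) (q 1)) (ho 1 (q 2) (q 3))) _
  | k + 5, q => exact zero_mem _

theorem variationFactor_mem (k : ℕ) :
    (fun p : Param m => (p.kin Λ r).variationFactor p.1.2 ζ k p.2.2)
      ∈ bosFunctions m (paramPolynomials m) := by
  have hX := X2_mem (m := m) Λ r
  have hψ := psi_mem (m := m) Λ r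
  have ho := omega_mem (m := m) Λ r
  have hΔ {k : ℕ} (q : Fin k → Fin m) := redDet_mem Λ r q
  have dψ := dPsi_mem (m := m) Λ r ζ
  have dH := dHodges_mem (m := m) Λ r ζ
  have dO := dOmega_mem (m := m) Λ r ζ
  have h2 : (fun _ : Param m => (2 : Bos m)) ∈ bosFunctions m (paramPolynomials m) :=
    const_mem_grFunctions ((2 : Bos m) : Gr m)
  match k with
  | 0 => exact zero_mem _
  | 1 => exact zero_mem _
  | 2 => exact zero_mem _
  | 3 =>
    have h (q : Fin 1 ↪ Fin m) := mul_mem (hΔ q) (add_mem (mul_mem (pow_mem hX 2) (dH (q 0)))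
      (mul_mem h2 (mul_mem hX (dψ (q 0)))))
    exact fun_sum_mem h
  | 4 =>
    have h (q : Fin 2 ↪ Fin m) := mul_mem (hΔ q) (add_mem (add_mem (add_mem
      (mul_mem (mul_mem hX (add_mem (hψ 0 (q 0)) (hψ 1 (q 0)))) (dH (q 1)))
      (Subalgebra.smul_mem _ (mul_mem hX (add_mem (dO 0 (q 0) (q 1)) (dO 1 (q 0) (q 1)))) (1 / 2)))
      (mul_mem (dψ (q 0)) (hψ 1 (q 1)))) (mul_mem (hψ 0 (q 0)) (dψ (q 1))))
    exact fun_sum_mem h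
  | 5 =>
    have h (q : Fin 3 ↪ Fin m) := mul_mem (hΔ q) (add_mem (add_mem (add_mem
      (Subalgebra.smul_mem _ (mul_mem (mul_mem hX (add_mem (ho 0 (q 0) (q 1)) (ho 1 (q 0) (q 1))))
        (dH (q 2))) (1 / 2))
      (mul_mem (mul_mem (hψ 0 (q 0)) (hψ 1 (q 1))) (dH (q 2))))
      (Subalgebra.smul_mem _ (mul_mem (dψ (q 0))
        (add_mem (ho 1 (q 1) (q 2)) (ho 0 (q 1) (q 2)))) (1 / 2)))
      (Subalgebra.smul_mem _ (add_mem (mul_mem (hψ 0 (q 0)) (dO 1 (q 1) (q 2)))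
        (mul_mem (hψ 1 (q 0)) (dO 0 (q 1) (q 2)))) (1 / 2)))
    exact fun_sum_mem h
  | 6 =>
    have h (q : Fin 4 ↪ Fin m) := mul_mem (hΔ q) (add_mem
      (Subalgebra.smul_mem _ (mul_mem (add_mem
      (mul_mem (hψ 0 (q 0)) (ho 1 (q 1) (q 2))) (mul_mem (hψ 1 (q 0)) (ho 0 (q 1) (q 2))))
        (dH (q 3))) (1 / 2))
      (Subalgebra.smul_mem _ (add_mem (mul_mem (dO 0 (q 0) (q 1)) (ho 1 (q 2) (q 3)))
        (mul_mem (ho 0 (q 0) (q 1)) (dO 1 (q 2) (q 3)))) (1 / 4)))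
    exact fun_sum_mem h
  | 7 =>
    have h (q : Fin 5 ↪ Fin m) := mul_mem (hΔ q) (Subalgebra.smul_mem _
      (mul_mem (mul_mem (ho 0 (q 0) (q 1)) (ho 1 (q 2) (q 3))) (dH (q 4))) (1 / 4))
    exact fun_sum_mem h
  | k + 8 => exact zero_mem _

end Membership

theorem Kin.integrand_eq_smul (D : Kin m) (x : BosX) (ξ : Fin 2 → ℂ) :
    D.integrand x ξ = Complex.exp (D.phase x) •
      ((D.integrandFactor x ξ : Gr m) * IsNilpotent.exp D.soul) := by
  rw [D.integrand_eq, D.wave_eq, mul_smul_comm]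

theorem Kin.variation_eq_smul (D : Kin m) (ξ ζ : Fin 2 → ℂ) (k : ℕ) (x : BosX) :
    D.variation ξ ζ k x = Complex.exp (D.phase x) •
      ((D.variationFactor ξ ζ k x : Gr m) * IsNilpotent.exp D.soul) := by
  rw [D.variation_eq, D.wave_eq, mul_smul_comm]

/-- The field `Kin.divField` without the oscillating factor. -/
def Kin.divFieldFactor (D : Kin m) (ξ ζ : Fin 2 → ℂ) (k : ℕ) (x : BosX) (J : SIdx) (A : Fin 2) :
    Gr m :=
  (∑ p : Fin (k + 1) ↪ Fin m, D.dir ξ ζ (p (Fin.last k)) J A *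
    ((D.redDet ξ p * D.seed ξ x k p : Bos m) : Gr m)) * IsNilpotent.exp D.soul

theorem Kin.divField_eq_smul (D : Kin m) (ξ ζ : Fin 2 → ℂ) (k : ℕ) (x : BosX) (J : SIdx)
    (A : Fin 2) : D.divField ξ ζ k x J A
      = Complex.exp (D.phase x) • D.divFieldFactor ξ ζ k x J A := by
  rw [Kin.divFieldFactor, ← mul_smul_comm, ← D.wave_eq, Finset.sum_mul]
  exact Finset.sum_congr rfl fun p _ => (mul_assoc _ _ _).symm

theorem divFieldFactor_mem (Λ r : ℂ) (ζ : Fin 2 → ℂ) (k : ℕ) (J : SIdx) (A : Fin 2) :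
    (fun p : Param m => (p.kin Λ r).divFieldFactor p.1.2 ζ k p.2.2 J A)
      ∈ grFunctions m (paramPolynomials m) := by
  have h := sum_mem (t := Finset.univ) fun (q : Fin (k + 1) ↪ Fin m) _ =>
    mul_mem (dir_mem Λ r ζ (q (Fin.last k)) J A)
      (mem_bosFunctions.1 (mul_mem (redDet_mem Λ r q) (seed_mem Λ r k q)))
  have h' := mul_mem h (exp_soul_mem Λ r)
  convert h' using 1
  funext p
  rw [Pi.mul_apply, Finset.sum_apply]
  rfl

theorem Kin.contDiff_divField (D : Kin m) (ξ ζ : Fin 2 → ℂ) (k : ℕ) (J : SIdx) (A : Fin 2)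
    (l : Gr m →ₗ[ℂ] ℂ) : ContDiff ℂ ∞ fun x => l (D.divField ξ ζ k x J A) := by
  obtain ⟨ι, _, c, a, b, -, -, hb, h⟩ := divFieldFactor_mem D.Λ D.r ζ k J A l
  have e (x : BosX) : l (D.divField ξ ζ k x J A)
      = Complex.exp (D.phase x) * ∑ i, c i (D.σ, ξ) * (a i D.w * b i x) := by
    rw [D.divField_eq_smul, map_smul, smul_eq_mul]
    exact congrArg _ (h ((D.σ, ξ), D.w, x))
  simp only [e]
  have hb' (i : ι) := contDiff_coordPolynomials (hb i)
  simp only [Kin.phase]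
  fun_prop

/-! ### Oscillatory integrals over the dual twistors -/

instance isAddHaarMeasure_volume_matrix {ι κ : Type*} [Fintype ι] [Fintype κ] :
    (volume : Measure (ι → κ → ℝ)).IsAddHaarMeasure :=
  Measure.pi.isAddHaarMeasure _

/-- The phase of the wave function on the real slice. -/
def phaseForm (σ : Pt m → Fin 2 → ℝ) (w : Pt m → Fin 4 → ℝ) (x : Fin 4 → Fin 2 → ℝ) : ℝ :=
  ∑ j, ∑ α, (σ j 0 * x α 1 - σ j 1 * x α 0) * w j α

theorem phaseForm_add (σ : Pt m → Fin 2 → ℝ) (w : Pt m → Fin 4 → ℝ) (x y : Fin 4 → Fin 2 → ℝ) :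
    phaseForm σ w (x + y) = phaseForm σ w x + phaseForm σ w y := by
  simp only [phaseForm, ← Finset.sum_add_distrib, Pi.add_apply]
  exact Finset.sum_congr rfl fun j _ => Finset.sum_congr rfl fun α _ => by ring

theorem phaseForm_smul (σ : Pt m → Fin 2 → ℝ) (w : Pt m → Fin 4 → ℝ) (t : ℝ)
    (x : Fin 4 → Fin 2 → ℝ) : phaseForm σ w (t • x) = t * phaseForm σ w x := by
  simp only [phaseForm, Finset.mul_sum, Pi.smul_apply, smul_eq_mul]
  exact Finset.sum_congr rfl fun j _ => Finset.sum_congr rfl fun α _ => by ring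

theorem phaseForm_single (σ : Pt m → Fin 2 → ℝ) (j : Pt m) (α : Fin 4) (x : Fin 4 → Fin 2 → ℝ) :
    phaseForm σ (Pi.single j (Pi.single α 1)) x = σ j 0 * x α 1 - σ j 1 * x α 0 := by
  rw [phaseForm, Finset.sum_eq_single j, Finset.sum_eq_single α]
  · simp
  · intro β _ hβ
    simp [hβ]
  · simp
  · intro i _ hi
    simp [hi]
  · simp

/-- The phase as a pairing, normalized as in the Fourier transform. -/
def pairing (σ : Pt m → Fin 2 → ℝ) :
    (Pt m → Fin 4 → ℝ) →L[ℝ] (Fin 4 → Fin 2 → ℝ) →L[ℝ] ℝ :=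
  ∑ j, ∑ α, ((ContinuousLinearMap.proj (R := ℝ) (φ := fun _ : Fin 4 => ℝ) α).comp
      (ContinuousLinearMap.proj (R := ℝ) (φ := fun _ : Pt m => Fin 4 → ℝ) j)).smulRight
    ((-(1 / (2 * Real.pi))) •
      (σ j 0 • (ContinuousLinearMap.proj (R := ℝ) (φ := fun _ : Fin 2 => ℝ) 1).comp
          (ContinuousLinearMap.proj (R := ℝ) (φ := fun _ : Fin 4 => Fin 2 → ℝ) α)
        - σ j 1 • (ContinuousLinearMap.proj (R := ℝ) (φ := fun _ : Fin 2 => ℝ) 0).comp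
          (ContinuousLinearMap.proj (R := ℝ) (φ := fun _ : Fin 4 => Fin 2 → ℝ) α)))

theorem pairing_apply (σ : Pt m → Fin 2 → ℝ) (w : Pt m → Fin 4 → ℝ) (x : Fin 4 → Fin 2 → ℝ) :
    pairing σ w x = -(1 / (2 * Real.pi)) * phaseForm σ w x := by
  simp only [pairing, phaseForm, sum_apply, Finset.mul_sum]
  refine Finset.sum_congr rfl fun j _ => Finset.sum_congr rfl fun α _ => ?_
  simp only [ContinuousLinearMap.smulRight_apply, ContinuousLinearMap.comp_apply,
    ContinuousLinearMap.proj_apply, smul_apply, sub_apply,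
    smul_eq_mul]
  ring

/-- The integral of `F` against the wave function over the dual twistors. -/
def oscInt (F : (Pt m → Fin 4 → ℝ) → ℂ) (σ : Pt m → Fin 2 → ℝ) (x : Fin 4 → Fin 2 → ℝ) : ℂ :=
  ∫ w, F w * Complex.exp (Complex.I * phaseForm σ w x)

theorem norm_exp_I_mul (t : ℝ) : ‖Complex.exp (Complex.I * t)‖ = 1 := by
  rw [mul_comm, Complex.norm_exp_ofReal_mul_I]

theorem oscInt_eq_fourierIntegral (F : (Pt m → Fin 4 → ℝ) → ℂ) (σ : Pt m → Fin 2 → ℝ) :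
    oscInt F σ = VectorFourier.fourierIntegral Real.fourierChar volume
      (pairing σ).toLinearMap₁₂ F := by
  funext x
  refine integral_congr_ae (Filter.Eventually.of_forall fun w => ?_)
  have e : (pairing σ).toLinearMap₁₂ w x = pairing σ w x := rfl
  simp only [e]
  rw [pairing_apply, Circle.smul_def, Real.fourierChar_apply, smul_eq_mul, mul_comm]
  congr 2
  have := Real.pi_ne_zero
  push_cast
  field_simp

/-- The gauge-fixed spinors are a basis of ℝ², so the contractions of `x` with them determine `x`;
one of these contractions must be comparable to the norm of `x`. -/
theorem exists_norm_le_gauge {s : Fin 2 → Fin 2 → ℝ} (hs : s 0 0 * s 1 1 - s 0 1 * s 1 0 ≠ 0) :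
    ∃ c : ℝ, 0 < c ∧ ∀ x : Fin 4 → Fin 2 → ℝ, ∃ q α,
      ‖x‖ ≤ c * |s q 0 * x α 1 - s q 1 * x α 0| := by
  set δ := s 0 0 * s 1 1 - s 0 1 * s 1 0 with hδ
  set S := ∑ q, ∑ A, |s q A| with hS
  have hS0 : 0 ≤ S := Finset.sum_nonneg fun q _ => Finset.sum_nonneg fun A _ => abs_nonneg _
  have hδ0 : 0 < |δ| := abs_pos.2 hs
  -- The estimate works with S in place of S + 1; the excess gives the strict inequality for the
  -- contradiction and keeps the constant positive.
  refine ⟨(S + 1) / |δ|, by positivity, fun x => ?_⟩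
  by_contra! h
  have h0 : 0 < ‖x‖ := lt_of_le_of_lt (by positivity) (h 0 0)
  have hu (q : Fin 2) (α : Fin 4) :
      (S + 1) * |s q 0 * x α 1 - s q 1 * x α 0| ≤ ‖x‖ * |δ| := by
    have := (h q α).le
    rwa [div_mul_eq_mul_div, div_le_iff₀ hδ0] at this
  have key (α : Fin 4) (A : Fin 2) : ‖x α A‖ < ‖x‖ := by
    -- Cramer's rule.
    have e : δ * x α A = s 1 A * (s 0 0 * x α 1 - s 0 1 * x α 0)
        - s 0 A * (s 1 0 * x α 1 - s 1 1 * x α 0) := by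
      fin_cases A <;> simp [hδ] <;> ring
    have hA : |s 1 A| + |s 0 A| ≤ S := by
      simp only [hS, Fin.sum_univ_two]
      fin_cases A <;> simp <;> linarith [abs_nonneg (s 0 0), abs_nonneg (s 0 1),
        abs_nonneg (s 1 0), abs_nonneg (s 1 1)]
    have h1 : (S + 1) * (|δ| * |x α A|) ≤ S * (‖x‖ * |δ|) := by
      rw [← abs_mul, e]
      calc (S + 1) * |s 1 A * (s 0 0 * x α 1 - s 0 1 * x α 0)
            - s 0 A * (s 1 0 * x α 1 - s 1 1 * x α 0)|
          ≤ (S + 1) * (|s 1 A| * |s 0 0 * x α 1 - s 0 1 * x α 0|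
            + |s 0 A| * |s 1 0 * x α 1 - s 1 1 * x α 0|) := by
              rw [← abs_mul, ← abs_mul]
              gcongr
              exact abs_sub _ _
        _ = |s 1 A| * ((S + 1) * |s 0 0 * x α 1 - s 0 1 * x α 0|)
            + |s 0 A| * ((S + 1) * |s 1 0 * x α 1 - s 1 1 * x α 0|) := by ring
        _ ≤ |s 1 A| * (‖x‖ * |δ|) + |s 0 A| * (‖x‖ * |δ|) := by
              exact add_le_add (mul_le_mul_of_nonneg_left (hu 0 α) (abs_nonneg _))
                (mul_le_mul_of_nonneg_left (hu 1 α) (abs_nonneg _))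
        _ = (|s 1 A| + |s 0 A|) * (‖x‖ * |δ|) := by ring
        _ ≤ S * (‖x‖ * |δ|) := by gcongr
    rw [Real.norm_eq_abs]
    by_contra! h2
    have h3 : S * (‖x‖ * |δ|) < (S + 1) * (|δ| * |x α A|) := by
      have : ‖x‖ * |δ| ≤ |δ| * |x α A| := by
        rw [mul_comm]
        gcongr
      nlinarith [mul_pos h0 hδ0]
    linarith
  exact lt_irrefl _ ((pi_norm_lt_iff h0).2 fun α => (pi_norm_lt_iff h0).2 fun A => key α A)

/-- The frequency dual to w_{qα}, q = 1, 2, is the contraction of `x` with the fixed spinor `s q`.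
Smoothness of `F` in that one variable gives decay in the contraction, and a suitable choice of q
and α controls the norm of `x`. The moving points play no role, so the constant does not depend on
`σ`. -/
theorem exists_oscInt_decay {s : Fin 2 → Fin 2 → ℝ} (hs : s 0 0 * s 1 1 - s 0 1 * s 1 0 ≠ 0)
    (F : 𝓢(Pt m → Fin 4 → ℝ, ℂ)) (n : ℕ) :
    ∃ C : ℝ, ∀ (σ : Fin m → Fin 2 → ℝ) x, ‖x‖ ^ n * ‖oscInt F (Sum.elim s σ) x‖ ≤ C := by
  obtain ⟨c, hc, h⟩ := exists_norm_le_gauge hs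
  set B := ∑ p ∈ Finset.range (0 + 1) ×ˢ Finset.range (n + 1),
          ∫ v, ‖v‖ ^ p.1 * ‖iteratedFDeriv ℝ p.2 F v‖ with hB
  refine ⟨(c * (2 * Real.pi)) ^ n * (1 * (2 * (0 : ℕ) + 2) ^ n * B), fun σ x => ?_⟩
  obtain ⟨q, α, hx⟩ := h x
  have key := VectorFourier.pow_mul_norm_iteratedFDeriv_fourierIntegral_le
    (pairing (Sum.elim s σ : Pt m → Fin 2 → ℝ)) (μ := volume) (f := F) (K := ⊤) (N := ⊤)
    (F.smooth _) (fun k n _ _ => F.integrable_pow_mul_iteratedFDeriv volume k n) (k := 0) (n := n)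
    le_top le_top (Pi.single (Sum.inl q) (Pi.single α 1)) x
  rw [norm_iteratedFDeriv_zero, ← oscInt_eq_fourierIntegral, pairing_apply, phaseForm_single,
    ← hB, pow_zero, mul_one, Pi.norm_single, Pi.norm_single, norm_one, one_pow] at key
  have hx' : ‖x‖ ≤ c * (2 * Real.pi) *
      |-(1 / (2 * Real.pi)) * (s q 0 * x α 1 - s q 1 * x α 0)| := by
    rw [abs_mul, abs_neg, abs_of_pos (by positivity : 0 < 1 / (2 * Real.pi))]
    refine hx.trans (le_of_eq ?_)
    have := Real.pi_ne_zero
    field_simp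
  calc ‖x‖ ^ n * ‖oscInt F (Sum.elim s σ) x‖
      ≤ (c * (2 * Real.pi) * |-(1 / (2 * Real.pi)) * (s q 0 * x α 1 - s q 1 * x α 0)|) ^ n
        * ‖oscInt F (Sum.elim s σ) x‖ := by gcongr
    _ = (c * (2 * Real.pi)) ^ n * (|-(1 / (2 * Real.pi)) * (s q 0 * x α 1 - s q 1 * x α 0)| ^ n
        * ‖oscInt F (Sum.elim s σ) x‖) := by rw [mul_pow, mul_assoc]
    _ ≤ _ := mul_le_mul_of_nonneg_left key (by positivity)

theorem continuous_phaseForm_uncurry (w : Pt m → Fin 4 → ℝ) :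
    Continuous fun p : (Pt m → Fin 2 → ℝ) × (Fin 4 → Fin 2 → ℝ) => phaseForm p.1 w p.2 := by
  unfold phaseForm
  fun_prop

theorem continuous_phaseForm_w (σ : Pt m → Fin 2 → ℝ) (x : Fin 4 → Fin 2 → ℝ) :
    Continuous fun w : Pt m → Fin 4 → ℝ => phaseForm σ w x := by
  unfold phaseForm
  fun_prop

theorem integrable_mul_exp_phase (F : 𝓢(Pt m → Fin 4 → ℝ, ℂ)) (σ : Pt m → Fin 2 → ℝ)
    (x : Fin 4 → Fin 2 → ℝ) :
    Integrable fun w => F w * Complex.exp (Complex.I * phaseForm σ w x) := by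
  have hm : AEStronglyMeasurable (fun w => F w * Complex.exp (Complex.I * phaseForm σ w x))
      volume := by
    have := continuous_phaseForm_w σ x
    have := F.continuous
    exact (by fun_prop : Continuous fun w =>
      F w * Complex.exp (Complex.I * phaseForm σ w x)).aestronglyMeasurable
  refine (F.integrable (μ := volume)).mono hm (Filter.Eventually.of_forall fun w => ?_)
  rw [norm_mul, norm_exp_I_mul, mul_one]

theorem continuous_oscInt (F : 𝓢(Pt m → Fin 4 → ℝ, ℂ)) :
    Continuous fun p : (Pt m → Fin 2 → ℝ) × (Fin 4 → Fin 2 → ℝ) => oscInt F p.1 p.2 := by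
  refine continuous_of_dominated (bound := fun w => ‖F w‖)
    (fun p => (integrable_mul_exp_phase F p.1 p.2).aestronglyMeasurable)
    (fun p => Filter.Eventually.of_forall fun w => ?_) F.integrable.norm
    (Filter.Eventually.of_forall fun w => ?_)
  · rw [norm_mul, norm_exp_I_mul, mul_one]
  · have := continuous_phaseForm_uncurry w
    fun_prop

theorem phaseForm_hasTemperateGrowth (σ : Pt m → Fin 2 → ℝ) (v : Fin 4 → Fin 2 → ℝ) :
    (fun w => Complex.I * (phaseForm σ w v : ℂ)).HasTemperateGrowth := by
  have h : (fun w => Complex.I * (phaseForm σ w v : ℂ)) = fun w =>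
      (Complex.I * (-(2 * Real.pi) : ℝ)) * ((pairing σ).flip v w : ℂ) := by
    funext w
    rw [ContinuousLinearMap.flip_apply, pairing_apply]
    have := Real.pi_ne_zero
    push_cast
    field_simp
  rw [h]
  exact (Function.HasTemperateGrowth.const _).mul
    (Complex.ofRealCLM.comp ((pairing σ).flip v)).hasTemperateGrowth

/-- `F` times the derivative of the phase in the direction `v`. -/
def phaseDeriv (F : 𝓢(Pt m → Fin 4 → ℝ, ℂ)) (σ : Pt m → Fin 2 → ℝ) (v : Fin 4 → Fin 2 → ℝ) :
    𝓢(Pt m → Fin 4 → ℝ, ℂ) :=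
  SchwartzMap.smulLeftCLM ℂ (fun w => Complex.I * (phaseForm σ w v : ℂ)) F

theorem phaseDeriv_apply (F : 𝓢(Pt m → Fin 4 → ℝ, ℂ)) (σ : Pt m → Fin 2 → ℝ)
    (v : Fin 4 → Fin 2 → ℝ) (w : Pt m → Fin 4 → ℝ) :
    phaseDeriv F σ v w = Complex.I * phaseForm σ w v * F w := by
  rw [phaseDeriv, SchwartzMap.smulLeftCLM_apply_apply (phaseForm_hasTemperateGrowth σ v),
    smul_eq_mul]

theorem hasLineDerivAt_oscInt (F : 𝓢(Pt m → Fin 4 → ℝ, ℂ)) (σ : Pt m → Fin 2 → ℝ)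
    (v x : Fin 4 → Fin 2 → ℝ) :
    HasLineDerivAt ℝ (oscInt F σ) (oscInt (phaseDeriv F σ v) σ x) x v := by
  have h := hasDerivAt_integral_of_dominated_loc_of_deriv_le (μ := volume) (𝕜 := ℝ)
    (F := fun (t : ℝ) w => F w * Complex.exp (Complex.I * phaseForm σ w (x + t • v)))
    (F' := fun (t : ℝ) w => phaseDeriv F σ v w
      * Complex.exp (Complex.I * phaseForm σ w (x + t • v)))
    (x₀ := 0) (s := Set.univ) (bound := fun w => ‖phaseDeriv F σ v w‖) Filter.univ_mem
    (Filter.Eventually.of_forall fun t => (integrable_mul_exp_phase F σ _).aestronglyMeasurable)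
    (integrable_mul_exp_phase F σ _) (integrable_mul_exp_phase _ σ _).aestronglyMeasurable
    (Filter.Eventually.of_forall fun w t _ => by rw [norm_mul, norm_exp_I_mul, mul_one])
    (phaseDeriv F σ v).integrable.norm
    (Filter.Eventually.of_forall fun w t _ => by
      have h₁ : HasDerivAt (fun t : ℝ => phaseForm σ w (x + t • v)) (phaseForm σ w v) t := by
        simp only [phaseForm_add, phaseForm_smul]
        simpa using ((hasDerivAt_id t).mul_const (phaseForm σ w v)).const_add (phaseForm σ w x)
      have h₂ := ((h₁.ofReal_comp.const_mul Complex.I).cexp).const_mul (F w)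
      refine h₂.congr_deriv ?_
      rw [phaseDeriv_apply]
      ring)
  have hderiv := h.2
  simp only [zero_smul, add_zero] at hderiv
  exact hderiv

/-! ### Integration over the coordinates -/

/-- The power 9 exceeds the real dimension 8 of the space of `x`, so the bound is integrable; being
uniform in `σ`, it also serves for dominated convergence. -/
theorem exists_bound_mul_oscInt {s : Fin 2 → Fin 2 → ℝ}
    (hs : s 0 0 * s 1 1 - s 0 1 * s 1 0 ≠ 0) {b : (Fin 4 → Fin 2 → ℝ) → ℂ}
    (hb : b.HasTemperateGrowth) (F : 𝓢(Pt m → Fin 4 → ℝ, ℂ)) :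
    ∃ C : ℝ, ∀ (σ : Fin m → Fin 2 → ℝ) x,
      ‖b x * oscInt F (Sum.elim s σ) x‖ ≤ C * (1 + ‖x‖) ^ (-(9 : ℝ)) := by
  obtain ⟨k, C, hC⟩ := hb.2 0
  obtain ⟨C₀, h₀⟩ := exists_oscInt_decay hs F 0
  -- Order k pays for the growth of `b` and nine further orders remain; order 0 covers small `x`.
  obtain ⟨C₁, h₁⟩ := exists_oscInt_decay hs F (k + 9)
  refine ⟨C * (2 ^ (k + 9 - 1) * (C₀ + C₁)), fun σ x => ?_⟩
  have hx : 0 < 1 + ‖x‖ := by positivity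
  have hbx : ‖b x‖ ≤ C * (1 + ‖x‖) ^ k := by
    have := hC x
    rwa [norm_iteratedFDeriv_zero] at this
  have hosc : (1 + ‖x‖) ^ (k + 9) * ‖oscInt F (Sum.elim s σ) x‖ ≤ 2 ^ (k + 9 - 1) * (C₀ + C₁) := by
    have h := add_pow_le zero_le_one (norm_nonneg x) (k + 9)
    rw [one_pow] at h
    calc (1 + ‖x‖) ^ (k + 9) * ‖oscInt F (Sum.elim s σ) x‖
        ≤ 2 ^ (k + 9 - 1) * (1 + ‖x‖ ^ (k + 9)) * ‖oscInt F (Sum.elim s σ) x‖ := by gcongr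
      _ = 2 ^ (k + 9 - 1) * (‖x‖ ^ 0 * ‖oscInt F (Sum.elim s σ) x‖
          + ‖x‖ ^ (k + 9) * ‖oscInt F (Sum.elim s σ) x‖) := by
            rw [pow_zero]
            ring
      _ ≤ _ := mul_le_mul_of_nonneg_left (add_le_add (h₀ σ x) (h₁ σ x)) (by positivity)
  have hCn : 0 ≤ C := by
    by_contra! hn
    have : C * (1 + ‖x‖) ^ k < 0 := mul_neg_of_neg_of_pos hn (by positivity)
    linarith [norm_nonneg (b x)]
  rw [norm_mul, Real.rpow_neg hx.le, ← div_eq_mul_inv, le_div_iff₀ (by positivity),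
    show (1 + ‖x‖) ^ (9 : ℝ) = (1 + ‖x‖) ^ 9 by exact_mod_cast Real.rpow_natCast (1 + ‖x‖) 9]
  calc ‖b x‖ * ‖oscInt F (Sum.elim s σ) x‖ * (1 + ‖x‖) ^ 9
      ≤ C * (1 + ‖x‖) ^ k * ‖oscInt F (Sum.elim s σ) x‖ * (1 + ‖x‖) ^ 9 := by gcongr
    _ = C * ((1 + ‖x‖) ^ (k + 9) * ‖oscInt F (Sum.elim s σ) x‖) := by
        rw [pow_add]
        ring
    _ ≤ _ := mul_le_mul_of_nonneg_left hosc hCn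

theorem integrable_one_add_norm_bound :
    Integrable fun x : Fin 4 → Fin 2 → ℝ => (1 + ‖x‖) ^ (-(9 : ℝ)) := by
  refine integrable_one_add_norm ?_
  have : Module.finrank ℝ (Fin 4 → Fin 2 → ℝ) = 8 := by
    rw [Module.finrank_pi_fintype]
    simp
  rw [this]
  norm_num

theorem aestronglyMeasurable_mul_oscInt {b : (Fin 4 → Fin 2 → ℝ) → ℂ}
    (hb : b.HasTemperateGrowth) (F : 𝓢(Pt m → Fin 4 → ℝ, ℂ)) (σ : Pt m → Fin 2 → ℝ) :
    AEStronglyMeasurable (fun x => b x * oscInt F σ x) volume := by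
  have h₁ := hb.1.continuous
  have h₂ : Continuous fun x => oscInt F σ x :=
    Continuous.comp (g := fun p : (Pt m → Fin 2 → ℝ) × (Fin 4 → Fin 2 → ℝ) => oscInt F p.1 p.2)
      (f := fun x => (σ, x)) (continuous_oscInt F) (continuous_const.prodMk continuous_id)
  exact (h₁.mul h₂).aestronglyMeasurable

theorem integrable_mul_oscInt {s : Fin 2 → Fin 2 → ℝ}
    (hs : s 0 0 * s 1 1 - s 0 1 * s 1 0 ≠ 0) {b : (Fin 4 → Fin 2 → ℝ) → ℂ}
    (hb : b.HasTemperateGrowth) (F : 𝓢(Pt m → Fin 4 → ℝ, ℂ)) (σ : Fin m → Fin 2 → ℝ) :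
    Integrable fun x => b x * oscInt F (Sum.elim s σ) x := by
  obtain ⟨C, hC⟩ := exists_bound_mul_oscInt hs hb F
  exact (integrable_one_add_norm_bound.const_mul C).mono'
    (aestronglyMeasurable_mul_oscInt hb F _) (Filter.Eventually.of_forall fun x => hC σ x)

theorem continuous_integral_mul_oscInt {s : Fin 2 → Fin 2 → ℝ}
    (hs : s 0 0 * s 1 1 - s 0 1 * s 1 0 ≠ 0) {b : (Fin 4 → Fin 2 → ℝ) → ℂ}
    (hb : b.HasTemperateGrowth) (F : 𝓢(Pt m → Fin 4 → ℝ, ℂ)) :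
    Continuous fun σ : Fin m → Fin 2 → ℝ => ∫ x, b x * oscInt F (Sum.elim s σ) x := by
  obtain ⟨C, hC⟩ := exists_bound_mul_oscInt hs hb F
  refine continuous_of_dominated (fun σ => aestronglyMeasurable_mul_oscInt hb F _)
    (fun σ => Filter.Eventually.of_forall fun x => hC σ x)
    (integrable_one_add_norm_bound.const_mul C) (Filter.Eventually.of_forall fun x => ?_)
  have h : Continuous fun σ : Fin m → Fin 2 → ℝ => oscInt F (Sum.elim s σ) x :=
    Continuous.comp (g := fun p : (Pt m → Fin 2 → ℝ) × (Fin 4 → Fin 2 → ℝ) => oscInt F p.1 p.2)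
      (f := fun σ => (Sum.elim s σ, x)) (continuous_oscInt F)
      (Continuous.prodMk (continuous_pi fun i => by
        rcases i with i | i
        · exact continuous_const
        · exact continuous_apply i) continuous_const)
  exact continuous_const.mul h

/-! ### Smeared integrals in separated variables -/

/-- A Schwartz function times a polynomial. -/
def polyMul (φ : 𝓢(Pt m → Fin 4 → ℝ, ℂ)) (a : (Pt m → Fin 4 → ℂ) → ℂ) :
    𝓢(Pt m → Fin 4 → ℝ, ℂ) :=
  SchwartzMap.smulLeftCLM ℂ (fun w : Pt m → Fin 4 → ℝ => a fun i α => (w i α : ℂ)) φ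

theorem polyMul_apply (φ : 𝓢(Pt m → Fin 4 → ℝ, ℂ)) {a : (Pt m → Fin 4 → ℂ) → ℂ}
    (ha : a ∈ coordPolynomials (Pt m) (Fin 4)) (w : Pt m → Fin 4 → ℝ) :
    polyMul φ a w = a (fun i α => (w i α : ℂ)) * φ w := by
  rw [polyMul, SchwartzMap.smulLeftCLM_apply_apply (hasTemperateGrowth_coordPolynomials ha),
    smul_eq_mul]

/-- Real values of the parameters. -/
def realParam (s : Fin 2 → Fin 2 → ℝ) (σ : Fin m → Fin 2 → ℝ) (ξ : Fin 2 → ℂ)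
    (w : Pt m → Fin 4 → ℝ) (x : Fin 4 → Fin 2 → ℝ) : Param m :=
  ((points s σ, ξ), (fun i α => (w i α : ℂ), fun α A => (x α A : ℂ)))

/-- The oscillating factor of the wave function. -/
def Param.osc (p : Param m) : ℂ := Complex.exp ((p.kin 0 0).phase p.2.2)

theorem osc_realParam (s : Fin 2 → Fin 2 → ℝ) (σ : Fin m → Fin 2 → ℝ) (ξ : Fin 2 → ℂ)
    (w : Pt m → Fin 4 → ℝ) (x : Fin 4 → Fin 2 → ℝ) :
    (realParam s σ ξ w x).osc = Complex.exp (Complex.I * phaseForm (Sum.elim s σ) w x) := by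
  simp only [Param.osc, Kin.phase, Param.kin, realParam, points, phaseForm]
  push_cast
  rfl

/-- The integral over the dual twistors of `f` times the wave function. -/
def wInt (φ : 𝓢(Pt m → Fin 4 → ℝ, ℂ)) (f : Param m → ℂ) (s : Fin 2 → Fin 2 → ℝ) (ξ : Fin 2 → ℂ)
    (σ : Fin m → Fin 2 → ℝ) (x : Fin 4 → Fin 2 → ℝ) : ℂ :=
  ∫ w, φ w * ((realParam s σ ξ w x).osc * f (realParam s σ ξ w x))

section Sum

variable {ι : Type} [Fintype ι] (φ : 𝓢(Pt m → Fin 4 → ℝ, ℂ)) {c : ι → ℂ}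
  {a : ι → (Pt m → Fin 4 → ℂ) → ℂ} {b : ι → BosX → ℂ} {f : Param m → ℂ}
  {s : Fin 2 → Fin 2 → ℝ} {σ : Fin m → Fin 2 → ℝ} {ξ : Fin 2 → ℂ} {x : Fin 4 → Fin 2 → ℝ}

theorem integrand_wInt_eq_sum (ha : ∀ i, a i ∈ coordPolynomials (Pt m) (Fin 4))
    (hf : ∀ w, f (realParam s σ ξ w x) = ∑ i, c i *
      (a i (fun j α => (w j α : ℂ)) * b i fun α A => (x α A : ℂ))) (w : Pt m → Fin 4 → ℝ) :
    φ w * ((realParam s σ ξ w x).osc * f (realParam s σ ξ w x))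
      = ∑ i, c i * (b i fun α A => (x α A : ℂ)) *
        (polyMul φ (a i) w * Complex.exp (Complex.I * phaseForm (Sum.elim s σ) w x)) := by
  rw [hf, osc_realParam, Finset.mul_sum, Finset.mul_sum]
  refine Finset.sum_congr rfl fun i _ => ?_
  rw [polyMul_apply φ (ha i)]
  ring

theorem integrable_wInt_integrand (ha : ∀ i, a i ∈ coordPolynomials (Pt m) (Fin 4))
    (hf : ∀ w, f (realParam s σ ξ w x) = ∑ i, c i *
      (a i (fun j α => (w j α : ℂ)) * b i fun α A => (x α A : ℂ))) :
    Integrable fun w => φ w * ((realParam s σ ξ w x).osc * f (realParam s σ ξ w x)) := by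
  simp only [integrand_wInt_eq_sum φ ha hf]
  exact integrable_finsetSum _ fun i _ => (integrable_mul_exp_phase _ _ x).const_mul _

theorem wInt_eq_sum (ha : ∀ i, a i ∈ coordPolynomials (Pt m) (Fin 4))
    (hf : ∀ w, f (realParam s σ ξ w x) = ∑ i, c i *
      (a i (fun j α => (w j α : ℂ)) * b i fun α A => (x α A : ℂ))) :
    wInt φ f s ξ σ x = ∑ i, c i * ((b i fun α A => (x α A : ℂ)) *
      oscInt (polyMul φ (a i)) (Sum.elim s σ) x) := by
  rw [wInt]
  simp only [integrand_wInt_eq_sum φ ha hf]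
  rw [integral_finsetSum _ fun i _ => (integrable_mul_exp_phase _ _ x).const_mul _]
  refine Finset.sum_congr rfl fun i _ => ?_
  rw [integral_const_mul, mul_assoc]
  rfl

/-- In this form the integrals on the right do not involve ξ, which enters only through the finitely
many coefficients. -/
theorem integral_wInt_eq_sum (hs : s 0 0 * s 1 1 - s 0 1 * s 1 0 ≠ 0)
    (ha : ∀ i, a i ∈ coordPolynomials (Pt m) (Fin 4))
    (hb : ∀ i, b i ∈ coordPolynomials (Fin 4) (Fin 2))
    (hf : ∀ x w, f (realParam s σ ξ w x) = ∑ i, c i *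
      (a i (fun j α => (w j α : ℂ)) * b i fun α A => (x α A : ℂ))) :
    ∫ x, wInt φ f s ξ σ x = ∑ i, c i * ∫ x : Fin 4 → Fin 2 → ℝ, (b i fun α A => (x α A : ℂ)) *
      oscInt (polyMul φ (a i)) (Sum.elim s σ) x := by
  simp only [fun x => wInt_eq_sum φ ha (hf x)]
  rw [integral_finsetSum _ fun i _ => (integrable_mul_oscInt hs
    (hasTemperateGrowth_coordPolynomials (hb i)) _ σ).const_mul _]
  simp only [integral_const_mul]

end Sum

theorem integrable_w {f : Param m → ℂ} (hf : f ∈ paramPolynomials m)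
    (φ : 𝓢(Pt m → Fin 4 → ℝ, ℂ)) (s : Fin 2 → Fin 2 → ℝ) (ξ : Fin 2 → ℂ)
    (σ : Fin m → Fin 2 → ℝ) (x : Fin 4 → Fin 2 → ℝ) :
    Integrable fun w => φ w * ((realParam s σ ξ w x).osc * f (realParam s σ ξ w x)) := by
  obtain ⟨ι, _, c, a, b, -, ha, -, hf⟩ := hf
  exact integrable_wInt_integrand (c := fun i => c i (points s σ, ξ)) (b := b) φ ha fun w => hf _

theorem integrable_wInt {f : Param m → ℂ} (hf : f ∈ paramPolynomials m)
    (φ : 𝓢(Pt m → Fin 4 → ℝ, ℂ)) {s : Fin 2 → Fin 2 → ℝ}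
    (hs : s 0 0 * s 1 1 - s 0 1 * s 1 0 ≠ 0) (ξ : Fin 2 → ℂ) (σ : Fin m → Fin 2 → ℝ) :
    Integrable (wInt φ f s ξ σ) := by
  obtain ⟨ι, _, c, a, b, -, ha, hb, hf⟩ := hf
  have e : wInt φ f s ξ σ = fun x => ∑ i, c i (points s σ, ξ) * ((b i fun α A => (x α A : ℂ)) *
      oscInt (polyMul φ (a i)) (Sum.elim s σ) x) := 
    funext fun x => wInt_eq_sum (c := fun i => c i (points s σ, ξ)) φ ha fun w => hf _
  rw [e]
  exact integrable_finsetSum _ fun i _ => (integrable_mul_oscInt hs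
    (hasTemperateGrowth_coordPolynomials (hb i)) _ σ).const_mul _

theorem continuous_points (s : Fin 2 → Fin 2 → ℝ) :
    Continuous (points s : (Fin m → Fin 2 → ℝ) → Pt m → Fin 2 → ℂ) := by
  refine continuous_pi fun i => continuous_pi fun A => ?_
  simp only [points]
  rcases i with i | i
  · simp only [Sum.elim_inl]
    fun_prop
  · simp only [Sum.elim_inr]
    fun_prop

theorem continuousAt_integral_wInt {f : Param m → ℂ} (hf : f ∈ paramPolynomials m)
    (φ : 𝓢(Pt m → Fin 4 → ℝ, ℂ)) {s : Fin 2 → Fin 2 → ℝ}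
    (hs : s 0 0 * s 1 1 - s 0 1 * s 1 0 ≠ 0) (ξ : Fin 2 → ℂ) {σ : Fin m → Fin 2 → ℝ}
    (h : Regular (points s σ) ξ) :
    ContinuousAt (fun σ => ∫ x, wInt φ f s ξ σ x) σ := by
  obtain ⟨ι, _, c, a, b, hc, ha, hb, hf⟩ := hf
  have e (σ : Fin m → Fin 2 → ℝ) := integral_wInt_eq_sum (f := f) (σ := σ) (ξ := ξ)
    (c := fun i => c i (points s σ, ξ)) φ hs ha hb
    fun x w => hf (realParam s σ ξ w x)
  simp only [e]
  refine tendsto_finsetSum _ fun i _ => ContinuousAt.mul ?_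
    (continuous_integral_mul_oscInt hs (hasTemperateGrowth_coordPolynomials (hb i)) _).continuousAt
  exact ContinuousAt.comp (f := fun σ => (points s σ, ξ)) (hc i (points s σ, ξ) h).continuousAt
    ((continuous_points s).continuousAt.prodMk continuousAt_const)

/-- No differentiation under the integral is needed: only the coefficients outside it depend on ξ.
By uniqueness of derivatives `g` has the same separated form, with the differentiated coefficients.
-/
theorem hasDerivAt_integral_wInt {f g : Param m → ℂ} (hf : f ∈ paramPolynomials m)
    (φ : 𝓢(Pt m → Fin 4 → ℝ, ℂ)) {s : Fin 2 → Fin 2 → ℝ}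
    (hs : s 0 0 * s 1 1 - s 0 1 * s 1 0 ≠ 0) (ξ ζ : Fin 2 → ℂ) {σ : Fin m → Fin 2 → ℝ}
    (h : Regular (points s σ) ξ)
    (hg : ∀ w x, HasDerivAt (fun t : ℂ => f (realParam s σ (ξ + t • ζ) w x))
      (g (realParam s σ ξ w x)) 0) :
    HasDerivAt (fun t : ℂ => ∫ x, wInt φ f s (ξ + t • ζ) σ x) (∫ x, wInt φ g s ξ σ x) 0 := by
  obtain ⟨ι, _, c, a, b, hc, ha, hb, hf⟩ := hf
  have hc' (i : ι) : ∃ c', HasDerivAt (fun t : ℂ => c i (points s σ, ξ + t • ζ)) c' 0 := by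
    have hd : DifferentiableAt ℂ (c i) (points s σ, ξ + (0 : ℂ) • ζ) := by
      rw [zero_smul, add_zero]
      exact hc i (points s σ, ξ) h
    have h1 : DifferentiableAt ℂ (fun t : ℂ => (points s σ, ξ + t • ζ)) 0 := by fun_prop
    exact ⟨_, (DifferentiableAt.comp (f := fun t : ℂ => (points s σ, ξ + t • ζ)) (0 : ℂ) hd
      h1).hasDerivAt⟩
  choose c' hc' using hc'
  have e (ξ : Fin 2 → ℂ) := integral_wInt_eq_sum (f := f) (σ := σ) (ξ := ξ)
    (c := fun i => c i (points s σ, ξ)) φ hs ha hb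
    fun x w => hf (realParam s σ ξ w x)
  have e' := integral_wInt_eq_sum (f := g) (σ := σ) (ξ := ξ) (c := c') φ hs ha hb fun x w => by
    refine (hg w x).unique ?_
    simp only [hf, realParam]
    exact HasDerivAt.fun_sum fun i _ => (hc' i).mul_const _
  simp only [e, e']
  exact HasDerivAt.fun_sum fun i _ => (hc' i).mul_const _

theorem update_ofReal (x : Fin 4 → Fin 2 → ℝ) (α : Fin 4) (A : Fin 2) (t : ℝ) :
    Function.update (fun β B => (x β B : ℂ)) α
        (Function.update (fun B => (x α B : ℂ)) A ((x α A + t : ℝ) : ℂ))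
      = fun β B => ((x + t • (Pi.single α (Pi.single A 1) : Fin 4 → Fin 2 → ℝ)) β B : ℂ) := by
  funext β B
  by_cases h : β = α
  · subst h
    by_cases h' : B = A
    · subst h'
      simp
    · simp [h']
  · simp [h]

theorem hasLineDerivAt_of_coord {G : BosX → ℂ} {G' : ℂ} {x : Fin 4 → Fin 2 → ℝ} {α : Fin 4}
    {A : Fin 2} (h : HasDerivAt (fun t => G (Function.update (fun β B => (x β B : ℂ)) α
      (Function.update (fun B => (x α B : ℂ)) A t))) G' (x α A)) :
    HasLineDerivAt ℝ (fun y : Fin 4 → Fin 2 → ℝ => G fun β B => (y β B : ℂ)) G' x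
      (Pi.single α (Pi.single A 1)) := by
  have h₁ := h.comp_ofReal
  have h₂ : HasDerivAt (fun t : ℝ => x α A + t) 1 0 := (hasDerivAt_id (0 : ℝ)).const_add _
  rw [← add_zero (x α A)] at h₁
  have h₃ := HasDerivAt.scomp (0 : ℝ) h₁ h₂
  rw [one_smul] at h₃
  unfold HasLineDerivAt
  simp only [← update_ofReal]
  exact h₃

/-- Integration by parts against the constant function 1. -/
theorem integral_eq_zero_of_hasLineDerivAt {U U' : (Fin 4 → Fin 2 → ℝ) → ℂ}
    {v : Fin 4 → Fin 2 → ℝ} (hU : Integrable U) (hU' : Integrable U')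
    (h : ∀ x, HasLineDerivAt ℝ U (U' x) x v) : ∫ x, U' x = 0 := by
  have key := integral_bilinear_hasLineDerivAt_right_eq_neg_left_of_integrable (μ := volume)
    (f := fun _ : Fin 4 → Fin 2 → ℝ => (1 : ℂ)) (f' := fun _ => 0) (g := U) (g' := U') (v := v)
    (B := ContinuousLinearMap.mul ℝ ℂ) (by simp) (by simpa using hU') (by simpa using hU)
    (fun x _ => hasDerivAt_const _ _) (fun x _ => h x)
  simpa using key

/-- For fixed `w` there is no decay in `x`, so the integration by parts is done after the
`w`-integral. Differentiating the phase yields a polynomial in `w`, absorbed into the Schwartz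
function; hence the `w`-integral of `h` is the derivative of a rapidly decreasing function. -/
theorem integral_partialDeriv_eq_zero {f : Param m → ℂ} (hf : f ∈ paramPolynomials m)
    (φ : 𝓢(Pt m → Fin 4 → ℝ, ℂ)) {s : Fin 2 → Fin 2 → ℝ}
    (hs : s 0 0 * s 1 1 - s 0 1 * s 1 0 ≠ 0) (ξ : Fin 2 → ℂ) (σ : Fin m → Fin 2 → ℝ)
    (α : Fin 4) (A : Fin 2) {h : (Pt m → Fin 4 → ℝ) → (Fin 4 → Fin 2 → ℝ) → ℂ}
    (hh : ∀ w x, HasLineDerivAt ℝ (fun y => (realParam s σ ξ w y).osc * f (realParam s σ ξ w y))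
      (h w x) x (Pi.single α (Pi.single A 1))) :
    (∀ x, Integrable fun w => φ w * h w x) ∧ (Integrable fun x => ∫ w, φ w * h w x) ∧
      ∫ x, ∫ w, φ w * h w x = 0 := by
  obtain ⟨ι, _, c, a, b, -, ha, hb, hf⟩ := hf
  set v : Fin 4 → Fin 2 → ℝ := Pi.single α (Pi.single A 1) with hv
  set σ' : Pt m → Fin 2 → ℝ := Sum.elim s σ with hσ'
  choose b' hb' hbd using fun i => exists_partialDeriv_coordPolynomials (hb i) α A
  have hbl (i : ι) (x : Fin 4 → Fin 2 → ℝ) := hasLineDerivAt_of_coord (hbd i fun β B => (x β B : ℂ))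
  have hexp (w : Pt m → Fin 4 → ℝ) (x : Fin 4 → Fin 2 → ℝ) : HasLineDerivAt ℝ
      (fun y => Complex.exp (Complex.I * phaseForm σ' w y))
      (Complex.I * phaseForm σ' w v * Complex.exp (Complex.I * phaseForm σ' w x)) x v := by
    have h₁ : HasDerivAt (fun t : ℝ => phaseForm σ' w (x + t • v)) (phaseForm σ' w v) 0 := by
      simp only [phaseForm_add, phaseForm_smul]
      simpa using ((hasDerivAt_id (0 : ℝ)).mul_const (phaseForm σ' w v)).const_add
        (phaseForm σ' w x)
    have h₂ := (h₁.ofReal_comp.const_mul Complex.I).cexp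
    simp only [zero_smul, add_zero] at h₂
    rw [mul_comm] at h₂
    exact h₂
  -- `h` is known only as a derivative; uniqueness identifies it with the explicit product rule.
  have hform (w : Pt m → Fin 4 → ℝ) (x : Fin 4 → Fin 2 → ℝ) : φ w * h w x
      = ∑ i, c i (points s σ, ξ) * ((b i fun α A => (x α A : ℂ)) *
          (phaseDeriv (polyMul φ (a i)) σ' v w * Complex.exp (Complex.I * phaseForm σ' w x))
        + (b' i fun α A => (x α A : ℂ)) *
          (polyMul φ (a i) w * Complex.exp (Complex.I * phaseForm σ' w x))) := by
    have h₁ : HasLineDerivAt ℝ (fun y => (realParam s σ ξ w y).osc * f (realParam s σ ξ w y))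
        (Complex.I * phaseForm σ' w v * Complex.exp (Complex.I * phaseForm σ' w x)
          * ∑ i, c i (points s σ, ξ) * (a i (fun j α => (w j α : ℂ)) * b i fun α A => (x α A : ℂ))
        + Complex.exp (Complex.I * phaseForm σ' w x) * ∑ i, c i (points s σ, ξ) *
          (a i (fun j α => (w j α : ℂ)) * b' i fun α A => (x α A : ℂ))) x v := by
      simp only [osc_realParam, hf]
      have h₂ : HasDerivAt (fun t : ℝ => ∑ i, c i (points s σ, ξ) * (a i (fun j α => (w j α : ℂ)) *
          b i fun α A => ((x + t • v) α A : ℂ))) (∑ i, c i (points s σ, ξ) *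
          (a i (fun j α => (w j α : ℂ)) * b' i fun α A => (x α A : ℂ))) 0 :=
        HasDerivAt.fun_sum fun i _ => ((hbl i x).const_mul _).const_mul _
      have h₃ := HasDerivAt.fun_mul (hexp w x) h₂
      simp only [zero_smul, add_zero] at h₃
      exact h₃
    rw [(hh w x).unique h₁, Finset.mul_sum, Finset.mul_sum, ← Finset.sum_add_distrib,
      Finset.mul_sum]
    refine Finset.sum_congr rfl fun i _ => ?_
    rw [phaseDeriv_apply, polyMul_apply φ (ha i)]
    ring
  have hi₁ (i : ι) (x : Fin 4 → Fin 2 → ℝ) :=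
    integrable_mul_exp_phase (phaseDeriv (polyMul φ (a i)) σ' v) σ' x
  have hi₂ (i : ι) (x : Fin 4 → Fin 2 → ℝ) := integrable_mul_exp_phase (polyMul φ (a i)) σ' x
  have hi (i : ι) (x : Fin 4 → Fin 2 → ℝ) : Integrable fun w => c i (points s σ, ξ) *
      ((b i fun α A => (x α A : ℂ)) *
          (phaseDeriv (polyMul φ (a i)) σ' v w * Complex.exp (Complex.I * phaseForm σ' w x))
        + (b' i fun α A => (x α A : ℂ)) *
          (polyMul φ (a i) w * Complex.exp (Complex.I * phaseForm σ' w x))) :=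
    (((hi₁ i x).const_mul _).add ((hi₂ i x).const_mul _)).const_mul _
  have hint (x : Fin 4 → Fin 2 → ℝ) : ∫ w, φ w * h w x = ∑ i, c i (points s σ, ξ) *
      ((b i fun α A => (x α A : ℂ)) * oscInt (phaseDeriv (polyMul φ (a i)) σ' v) σ' x
        + (b' i fun α A => (x α A : ℂ)) * oscInt (polyMul φ (a i)) σ' x) := by
    simp only [hform]
    rw [integral_finsetSum _ fun i _ => hi i x]
    refine Finset.sum_congr rfl fun i _ => ?_
    rw [integral_const_mul]
    congr 1
    rw [integral_add ((hi₁ i x).const_mul _) ((hi₂ i x).const_mul _), integral_const_mul,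
      integral_const_mul]
    rfl
  have hU' : Integrable fun x => ∫ w, φ w * h w x := by
    simp only [hint]
    exact integrable_finsetSum _ fun i _ => ((integrable_mul_oscInt hs
      (hasTemperateGrowth_coordPolynomials (hb i)) _ σ).add (integrable_mul_oscInt hs
      (hasTemperateGrowth_coordPolynomials (hb' i)) _ σ)).const_mul _
  refine ⟨fun x => ?_, hU', ?_⟩
  · simp only [hform]
    exact integrable_finsetSum _ fun i _ => hi i x
  · refine integral_eq_zero_of_hasLineDerivAt (v := v)
      (U := fun x => ∑ i, c i (points s σ, ξ) * ((b i fun α A => (x α A : ℂ)) *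
        oscInt (polyMul φ (a i)) σ' x))
      (integrable_finsetSum _ fun i _ => (integrable_mul_oscInt hs
        (hasTemperateGrowth_coordPolynomials (hb i)) _ σ).const_mul _) hU' fun x => ?_
    rw [hint]
    have h₄ : HasDerivAt (fun t : ℝ => ∑ i, c i (points s σ, ξ) *
        ((b i fun α A => ((x + t • v) α A : ℂ)) * oscInt (polyMul φ (a i)) σ' (x + t • v)))
        (∑ i, c i (points s σ, ξ) * ((b' i fun α A => (x α A : ℂ)) *
          oscInt (polyMul φ (a i)) σ' (x + (0 : ℝ) • v) +
          (b i fun α A => ((x + (0 : ℝ) • v) α A : ℂ)) *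
            oscInt (phaseDeriv (polyMul φ (a i)) σ' v) σ' x)) 0 :=
      HasDerivAt.fun_sum fun i _ => (HasDerivAt.fun_mul (hbl i x)
        (hasLineDerivAt_oscInt (polyMul φ (a i)) σ' v x)).const_mul _
    refine HasDerivAt.congr_deriv h₄ (Finset.sum_congr rfl fun i _ => ?_)
    rw [zero_smul, add_zero, add_comm]

attribute [local irreducible] Kin.integrandFactor Kin.variationFactor Kin.integrand Kin.variation

/-! ### The smeared integrand and its variation -/

/-- A coordinate of the Berezin integral of the integrand, without the oscillating factor. -/
def integrandCoord (Λ r : ℂ) (l : Gr m →ₗ[ℂ] ℂ) (p : Param m) : ℂ :=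
  l (berezin (((p.kin Λ r).integrandFactor p.2.2 p.1.2 : Gr m)
    * IsNilpotent.exp (p.kin Λ r).soul))

/-- A coordinate of the Berezin integral of the variation, without the oscillating factor. -/
def variationCoord (Λ r : ℂ) (l : Gr m →ₗ[ℂ] ℂ) (ζ : Fin 2 → ℂ) (k : ℕ) (p : Param m) : ℂ :=
  l (berezin (((p.kin Λ r).variationFactor p.1.2 ζ k p.2.2 : Gr m)
    * IsNilpotent.exp (p.kin Λ r).soul))

theorem berezin_mul_exp_soul_mem (Λ r : ℂ) (l : Gr m →ₗ[ℂ] ℂ) {F : Param m → Bos m}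
    (hF : F ∈ bosFunctions m (paramPolynomials m)) :
    (fun p => l (berezin ((F p : Gr m) * IsNilpotent.exp (p.kin Λ r).soul)))
      ∈ paramPolynomials m :=
  mul_mem (mem_bosFunctions.1 hF) (exp_soul_mem Λ r) (l ∘ₗ berezin)

theorem integrandCoord_mem (Λ r : ℂ) (l : Gr m →ₗ[ℂ] ℂ) :
    integrandCoord Λ r l ∈ paramPolynomials m := by
  unfold integrandCoord
  exact berezin_mul_exp_soul_mem Λ r l (integrandFactor_mem Λ r)

theorem variationCoord_mem (Λ r : ℂ) (l : Gr m →ₗ[ℂ] ℂ) (ζ : Fin 2 → ℂ) (k : ℕ) :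
    variationCoord Λ r l ζ k ∈ paramPolynomials m := by
  unfold variationCoord
  exact berezin_mul_exp_soul_mem Λ r l (variationFactor_mem Λ r ζ k)

theorem berezin_exp_phase_smul (Λ r : ℂ) (l : Gr m →ₗ[ℂ] ℂ) (p : Param m) (g : Gr m) :
    l (berezin (Complex.exp ((p.kin Λ r).phase p.2.2) • g)) = p.osc * l (berezin g) := by
  rw [map_smul, map_smul]
  -- The phase does not involve Λ or r, so their values 0 in `Param.osc` are harmless.
  rfl

theorem berezin_integrand (Λ r : ℂ) (l : Gr m →ₗ[ℂ] ℂ) (p : Param m) :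
    l (berezin ((p.kin Λ r).integrand p.2.2 p.1.2)) = p.osc * integrandCoord Λ r l p := by
  rw [Kin.integrand_eq_smul, berezin_exp_phase_smul, integrandCoord]

theorem berezin_variation (Λ r : ℂ) (l : Gr m →ₗ[ℂ] ℂ) (ζ : Fin 2 → ℂ) (k : ℕ) (p : Param m) :
    l (berezin ((p.kin Λ r).variation p.1.2 ζ k p.2.2)) = p.osc * variationCoord Λ r l ζ k p := by
  rw [Kin.variation_eq_smul, berezin_exp_phase_smul, variationCoord]

section Smear

variable (Λ r : ℂ) (s : Fin 2 → Fin 2 → ℝ) (φ : 𝓢(Pt m → Fin 4 → ℝ, ℂ)) (l : Gr m →ₗ[ℂ] ℂ)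

theorem smear_integrand (ξ : Fin 2 → ℂ) (σ : Fin m → Fin 2 → ℝ) (x : Fin 4 → Fin 2 → ℝ) :
    smear Λ r s φ l (fun D x => D.integrand x ξ) σ x
      = wInt φ (integrandCoord Λ r l) s ξ σ x := by
  simp only [wInt, ← berezin_integrand]
  rfl

theorem integrable_integrand (ξ : Fin 2 → ℂ) (σ : Fin m → Fin 2 → ℝ) (x : Fin 4 → Fin 2 → ℝ) :
    Integrable fun w : Pt m → Fin 4 → ℝ =>
      φ w * l (berezin (Kin.integrand ⟨Λ, r, points s σ, fun i α => (w i α : ℂ)⟩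
        (fun α A => (x α A : ℂ)) ξ)) := by
  have hw := integrable_w (integrandCoord_mem Λ r l) φ s ξ σ x
  simp only [← berezin_integrand] at hw
  exact hw

theorem smear_variation (ξ ζ : Fin 2 → ℂ) (k : ℕ) (σ : Fin m → Fin 2 → ℝ)
    (x : Fin 4 → Fin 2 → ℝ) :
    smear Λ r s φ l (fun D => D.variation ξ ζ k) σ x
      = wInt φ (variationCoord Λ r l ζ k) s ξ σ x :=
  integral_congr_ae (Filter.Eventually.of_forall fun w =>
    congrArg (φ w * ·) (berezin_variation Λ r l ζ k (realParam s σ ξ w x)))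

theorem smear_sum_variation (ξ ζ : Fin 2 → ℂ) (σ : Fin m → Fin 2 → ℝ) (x : Fin 4 → Fin 2 → ℝ) :
    smear Λ r s φ l (fun D x => ∑ k ∈ Finset.Icc 3 7, D.variation ξ ζ k x) σ x
      = ∑ k ∈ Finset.Icc 3 7, wInt φ (variationCoord Λ r l ζ k) s ξ σ x := by
  simp only [wInt]
  rw [← integral_finsetSum _ fun k _ => integrable_w (variationCoord_mem Λ r l ζ k) φ s ξ σ x]
  refine integral_congr_ae (Filter.Eventually.of_forall fun w => ?_)
  simp only [map_sum, Finset.mul_sum]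
  exact Finset.sum_congr rfl fun k _ =>
    congrArg (φ w * ·) (berezin_variation Λ r l ζ k (realParam s σ ξ w x))

variable {s}

/-- The variation is a superdivergence. The Berezin integral annihilates its odd part, and each
bosonic partial derivative integrates to zero separately. -/
theorem integral_wInt_variationCoord (hr : r ^ 2 = Λ) (hs : s 0 0 * s 1 1 - s 0 1 * s 1 0 ≠ 0)
    {ξ : Fin 2 → ℂ} (ζ : Fin 2 → ℂ) {σ : Fin m → Fin 2 → ℝ} (h : Regular (points s σ) ξ) {k : ℕ}
    (hk : k < 5) : ∫ x, wInt φ (variationCoord Λ r l ζ (k + 3)) s ξ σ x = 0 := by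
  have hdiv (w : Pt m → Fin 4 → ℝ) (x : Fin 4 → Fin 2 → ℝ) :=
    Kin.hasSuperDivAt_divField ⟨Λ, r, points s σ, fun i α => (w i α : ℂ)⟩ hr ξ ζ h hk
      fun α A => (x α A : ℂ)
  choose V' hV' hd using hdiv
  have hp (α : Fin 4) (A : Fin 2) := integral_partialDeriv_eq_zero
    (divFieldFactor_mem Λ r ζ k (Sum.inl α) A (l ∘ₗ berezin)) φ hs ξ σ α A
    (h := fun w x => (l ∘ₗ berezin) (V' w x α A)) fun w x => by
      have h₁ := hasLineDerivAt_of_coord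
        (G := fun y => (l ∘ₗ berezin) ((⟨Λ, r, points s σ, fun i α => (w i α : ℂ)⟩ : Kin m).divField
          ξ ζ k y (Sum.inl α) A)) (hV' w x α A (l ∘ₗ berezin))
      simp only [Kin.divField_eq_smul, map_smul, smul_eq_mul] at h₁
      exact h₁
  have e (w : Pt m → Fin 4 → ℝ) (x : Fin 4 → Fin 2 → ℝ) : φ w * ((realParam s σ ξ w x).osc *
      variationCoord Λ r l ζ (k + 3) (realParam s σ ξ w x))
      = ∑ α, ∑ A, φ w * (l ∘ₗ berezin) (V' w x α A) := by
    rw [← berezin_variation]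
    have h₁ := congrArg (fun g => l (berezin g)) (hd w x)
    simp only [map_add, map_sum, berezin_dTheta, Finset.sum_const_zero, add_zero] at h₁
    simp only [← Finset.mul_sum]
    exact congrArg (φ w * ·) h₁
  have hw (x : Fin 4 → Fin 2 → ℝ) : wInt φ (variationCoord Λ r l ζ (k + 3)) s ξ σ x
      = ∑ α, ∑ A, ∫ w, φ w * (l ∘ₗ berezin) (V' w x α A) := by
    rw [wInt]
    simp only [e]
    rw [integral_finsetSum _ fun α _ => integrable_finsetSum _ fun A _ => (hp α A).1 x]
    exact Finset.sum_congr rfl fun α _ => integral_finsetSum _ fun A _ => (hp α A).1 x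
  simp only [hw]
  rw [integral_finsetSum _ fun α _ => integrable_finsetSum _ fun A _ => (hp α A).2.1]
  refine Finset.sum_eq_zero fun α _ => ?_
  rw [integral_finsetSum _ fun A _ => (hp α A).2.1]
  exact Finset.sum_eq_zero fun A _ => (hp α A).2.2

theorem integral_smear_variation (hr : r ^ 2 = Λ) (hs : s 0 0 * s 1 1 - s 0 1 * s 1 0 ≠ 0)
    {ξ : Fin 2 → ℂ} (ζ : Fin 2 → ℂ) {σ : Fin m → Fin 2 → ℝ} (h : Regular (points s σ) ξ) {k : ℕ}
    (hk : k ∈ Finset.Icc 3 7) :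
    Integrable (fun x => smear Λ r s φ l (fun D => D.variation ξ ζ k) σ x) ∧
      ∫ x, smear Λ r s φ l (fun D => D.variation ξ ζ k) σ x = 0 := by
  rw [Finset.mem_Icc] at hk
  obtain ⟨k, rfl⟩ : ∃ j, k = j + 3 := ⟨k - 3, by omega⟩
  simp only [smear_variation]
  exact ⟨integrable_wInt (variationCoord_mem Λ r l ζ _) φ hs ξ σ,
    integral_wInt_variationCoord Λ r φ l hr hs ζ h (by omega)⟩

theorem integral_smear_sum_variation (hr : r ^ 2 = Λ)
    (hs : s 0 0 * s 1 1 - s 0 1 * s 1 0 ≠ 0)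
    {ξ : Fin 2 → ℂ} (ζ : Fin 2 → ℂ) {σ : Fin m → Fin 2 → ℝ} (h : Regular (points s σ) ξ) :
    ∫ x, smear Λ r s φ l (fun D x => ∑ k ∈ Finset.Icc 3 7, D.variation ξ ζ k x) σ x = 0 := by
  simp only [smear_sum_variation]
  rw [integral_finsetSum _ fun k _ => integrable_wInt (variationCoord_mem Λ r l ζ _) φ hs ξ σ]
  refine Finset.sum_eq_zero fun k hk => ?_
  have h₁ := (integral_smear_variation Λ r φ l hr hs ζ h hk).2
  simp only [smear_variation] at h₁
  exact h₁

theorem hasDerivAt_integral_smear_integrand (hr : r ^ 2 = Λ)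
    (hs : s 0 0 * s 1 1 - s 0 1 * s 1 0 ≠ 0)
    {ξ : Fin 2 → ℂ} (ζ : Fin 2 → ℂ) {σ : Fin m → Fin 2 → ℝ} (h : Regular (points s σ) ξ) :
    HasDerivAt (fun t : ℂ => ∫ x, smear Λ r s φ l (fun D x => D.integrand x (ξ + t • ζ)) σ x)
      0 0 := by
  simp only [smear_integrand]
  have key := hasDerivAt_integral_wInt (g := fun p => ∑ k ∈ Finset.Icc 3 7,
    variationCoord Λ r l ζ k p) (integrandCoord_mem Λ r l) φ hs ξ ζ h fun w x => by
      have h₁ := (HasGrDerivAt.mul (Kin.hasBosDerivAt_integrandFactor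
        ⟨Λ, r, points s σ, fun i α => (w i α : ℂ)⟩ ξ ζ h fun α A => (x α A : ℂ))
        (.const (IsNilpotent.exp (Kin.soul ⟨Λ, r, points s σ, fun i α => (w i α : ℂ)⟩)) 0))
        (l ∘ₗ berezin)
      rw [mul_zero, add_zero] at h₁
      refine h₁.congr_deriv ?_
      rw [show Finset.Icc 3 7 = {3, 4, 5, 6, 7} from rfl]
      rw [Finset.sum_insert (by decide), Finset.sum_insert (by decide),
        Finset.sum_insert (by decide), Finset.sum_insert (by decide), Finset.sum_singleton]
      simp only [variationCoord, ← map_add, ← add_mul, ← add_assoc]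
      rfl
  refine key.congr_deriv ?_
  rw [← integral_smear_sum_variation Λ r φ l hr hs ζ h]
  refine integral_congr_ae (Filter.Eventually.of_forall fun x => ?_)
  simp only [smear_sum_variation, wInt]
  rw [← integral_finsetSum _ fun k _ => integrable_w (variationCoord_mem Λ r l ζ k) φ s ξ σ x]
  simp only [Finset.mul_sum]

/-- The X-integral is locally constant along the complex line from ξ to ξ'. It may be singular at
inadmissible parameters, but these are isolated points of ℂ and do not disconnect it. -/
theorem integral_smear_integrand_eq (hr : r ^ 2 = Λ) (hs : s 0 0 * s 1 1 - s 0 1 * s 1 0 ≠ 0)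
    {ξ ξ' : Fin 2 → ℂ} {σ : Fin m → Fin 2 → ℝ} (h : Regular (points s σ) ξ)
    (h' : Regular (points s σ) ξ') :
    ∫ x, smear Λ r s φ l (fun D x => D.integrand x ξ') σ x
      = ∫ x, smear Λ r s φ l (fun D x => D.integrand x ξ) σ x := by
  set J : (Fin 2 → ℂ) → ℂ := fun ξ => ∫ x, smear Λ r s φ l (fun D x => D.integrand x ξ) σ x with hJ
  set ζ := ξ' - ξ with hζ
  set Z : Set ℂ := ⋃ i : Fin m, {t | spin (ξ + t • ζ) (points s σ (Sum.inr i)) = 0} with hZ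
  have hlin (i : Fin m) (t : ℂ) : spin (ξ + t • ζ) (points s σ (Sum.inr i))
      = spin ξ (points s σ (Sum.inr i)) + t * spin ζ (points s σ (Sum.inr i)) := by
    simp only [spin, Pi.add_apply, Pi.smul_apply, smul_eq_mul]
    ring
  -- Each condition is affine in t and does not hold at t = 0, so it has at most one solution.
  have hfin : Z.Finite := by
    refine Set.finite_iUnion fun i => Set.Subsingleton.finite fun t ht u hu => ?_
    simp only [Set.mem_ofPred_eq, hlin] at ht hu
    have h₀ := h.2 i
    have hz : spin ζ (points s σ (Sum.inr i)) ≠ 0 := by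
      intro hz
      rw [hz, mul_zero, add_zero] at ht
      exact h₀ ht
    refine mul_right_cancel₀ hz ?_
    linear_combination ht - hu
  have hreg {t : ℂ} (ht : t ∈ Zᶜ) : Regular (points s σ) (ξ + t • ζ) :=
    ⟨h.1, fun i hi => ht (Set.mem_iUnion.2 ⟨i, hi⟩)⟩
  have hder {t : ℂ} (ht : t ∈ Zᶜ) : HasDerivAt (fun t : ℂ => J (ξ + t • ζ)) 0 t := by
    have h₁ := hasDerivAt_integral_smear_integrand Λ r φ l hr hs ζ (hreg ht)
    -- The derivative is known at parameter 0 only; recentering the line at ξ + tζ gives it at t.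
    have h₂ := HasDerivAt.comp_sub_const t t (f' := (0 : ℂ))
      (f := fun u : ℂ => J (ξ + t • ζ + u • ζ)) (by rw [sub_self]; exact h₁)
    refine h₂.congr_of_eventuallyEq (Filter.Eventually.of_forall fun u => ?_)
    simp only [hJ]
    rw [add_assoc, ← add_smul, add_sub_cancel]
  have hconn : IsPreconnected Zᶜ :=
    (hfin.countable.isConnected_compl_of_one_lt_rank (by
      rw [Complex.rank_real_complex]
      norm_num)).isPreconnected
  have hconst := hfin.isClosed.isOpen_compl.is_const_of_deriv_eq_zero hconn
    (fun t ht => (hder ht).differentiableAt.differentiableWithinAt)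
    (fun t ht => (hder ht).deriv) (x := 1) (y := 0)
  have e1 : ξ + (1 : ℂ) • ζ = ξ' := by rw [one_smul, hζ, add_sub_cancel]
  have e0 : ξ + (0 : ℂ) • ζ = ξ := by rw [zero_smul, add_zero]
  simp only [e1, e0] at hconst
  refine hconst ?_ ?_
  · intro hm
    obtain ⟨i, hi⟩ := Set.mem_iUnion.1 hm
    simp only [Set.mem_ofPred_eq, e1] at hi
    exact h'.2 i hi
  · intro hm
    obtain ⟨i, hi⟩ := Set.mem_iUnion.1 hm
    simp only [Set.mem_ofPred_eq, e0] at hi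
    exact h.2 i hi

end Smear

/-! ### The contour integral and the amplitude -/

theorem gauge_ne_zero {s : Fin 2 → Fin 2 → ℝ} {σ : Fin m → Fin 2 → ℝ} {ξ : Fin 2 → ℂ}
    (h : Regular (points s σ) ξ) : s 0 0 * s 1 1 - s 0 1 * s 1 0 ≠ 0 := by
  have h₁ := h.1 (Sum.inl 0) (Sum.inl 1) (by simp)
  simp only [spin, points, Sum.elim_inl] at h₁
  exact_mod_cast h₁

/-- Compactness of the contour makes the open condition (ξ i) ≠ 0 hold uniformly near ξ. -/
theorem eventually_admissible {s : Fin 2 → Fin 2 → ℝ} {K : Set (Fin m → Fin 2 → ℝ)}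
    (hK : IsCompact K) {ξ : Fin 2 → ℂ} (h : ∀ σ ∈ K, Regular (points s σ) ξ) :
    ∀ᶠ ξ' in nhds ξ, ∀ σ ∈ K, Regular (points s σ) ξ' := by
  have h₁ : ∀ᶠ ξ' in nhds ξ, ∀ σ ∈ K, ∀ i : Fin m, spin ξ' (points s σ (Sum.inr i)) ≠ 0 := by
    refine hK.eventually_forall_of_forall_eventually fun σ hσ => ?_
    rw [Filter.eventually_all]
    intro i
    have hc : Continuous fun p : (Fin 2 → ℂ) × (Fin m → Fin 2 → ℝ) =>
        spin p.1 (points s p.2 (Sum.inr i)) := by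
      simp only [spin, points, Sum.elim_inr]
      fun_prop
    exact hc.continuousAt.eventually_ne ((h σ hσ).2 i)
  filter_upwards [h₁] with ξ' hξ' σ hσ
  exact ⟨(h σ hσ).1, hξ' σ hσ⟩

section Amplitude

variable {Λ r : ℂ} {s : Fin 2 → Fin 2 → ℝ} (φ : 𝓢(Pt m → Fin 4 → ℝ, ℂ)) (l : Gr m →ₗ[ℂ] ℂ)
  {ν : Measure (Fin m → Fin 2 → ℝ)} {ρ : (Fin m → Fin 2 → ℝ) → ℂ}
  {K : Set (Fin m → Fin 2 → ℝ)} {ξ : Fin 2 → ℂ}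

theorem amplitude_eq (hr : r ^ 2 = Λ) (hν : ν Kᶜ = 0) (h : ∀ σ ∈ K, Regular (points s σ) ξ)
    {ξ' : Fin 2 → ℂ} (h' : ∀ σ ∈ K, Regular (points s σ) ξ') :
    amplitude Λ r s φ l ν ρ ξ' = amplitude Λ r s φ l ν ρ ξ := by
  have e : ∫ σ, ρ σ * (∫ x, smear Λ r s φ l (fun D x => D.integrand x ξ') σ x) ∂ν
      = ∫ σ, ρ σ * (∫ x, smear Λ r s φ l (fun D x => D.integrand x ξ) σ x) ∂ν := by
    refine integral_congr_ae ?_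
    filter_upwards [mem_ae_iff.2 hν] with σ hσ
    exact congrArg (ρ σ * ·) (integral_smear_integrand_eq Λ r φ l hr (gauge_ne_zero (h σ hσ))
      (h σ hσ) (h' σ hσ))
  rw [amplitude, amplitude, moduliIntegral, moduliIntegral, e]

theorem moduliIntegral_variation (hr : r ^ 2 = Λ) (hν : ν Kᶜ = 0)
    (h : ∀ σ ∈ K, Regular (points s σ) ξ) (ζ : Fin 2 → ℂ) :
    moduliIntegral Λ r s φ l ν ρ
      (fun D x => ∑ k ∈ Finset.Icc 3 7, D.variation ξ ζ k x) = 0 := by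
  unfold moduliIntegral
  rw [integral_eq_zero_of_ae, mul_zero]
  filter_upwards [mem_ae_iff.2 hν] with σ hσ
  rw [integral_smear_sum_variation Λ r φ l hr (gauge_ne_zero (h σ hσ)) ζ (h σ hσ), mul_zero]
  rfl

/-- The X-integral is continuous at regular configurations, hence bounded on the compact contour,
and the weight is integrable. -/
theorem integrable_mul_integral_smear (hK : IsCompact K) (hν : ν Kᶜ = 0) (hρ : Integrable ρ ν)
    (h : ∀ σ ∈ K, Regular (points s σ) ξ) :
    Integrable (fun σ => ρ σ * ∫ x : Fin 4 → Fin 2 → ℝ,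
      smear Λ r s φ l (fun D x => D.integrand x ξ) σ x) ν := by
  simp only [smear_integrand]
  have hc : ContinuousOn (fun σ => ∫ x, wInt φ (integrandCoord Λ r l) s ξ σ x) K := fun σ hσ =>
    (continuousAt_integral_wInt (integrandCoord_mem Λ r l) φ (gauge_ne_zero (h σ hσ)) ξ
      (h σ hσ)).continuousWithinAt
  obtain ⟨C, hC⟩ := hK.exists_bound_of_continuousOn hc
  have hres : ν.restrict K = ν := Measure.restrict_eq_self_of_ae_mem (mem_ae_iff.2 hν)
  have hm : AEStronglyMeasurable (fun σ => ∫ x, wInt φ (integrandCoord Λ r l) s ξ σ x) ν := by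
    rw [← hres]
    exact hc.aestronglyMeasurable hK.measurableSet
  refine hρ.mul_bdd (c := C) hm ?_
  filter_upwards [mem_ae_iff.2 hν] with σ hσ
  exact hC σ hσ

end Amplitude

end

end MHV

theorem mainTheorem2 (m : ℕ) (Λ r : ℂ) (hΛ : Λ ≠ 0) (hr : r ^ 2 = Λ) :
    (∀ (σ : Pt m → Fin 2 → ℂ) (w : Pt m → Fin 4 → ℂ) (ξ ζ : Fin 2 → ℂ), Regular σ ξ →
      ∀ D : Kin m, D = ⟨Λ, r, σ, w⟩ →
        (∀ x, HasGrDerivAt (fun t => D.integrand x (ξ + t • ζ))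
          (∑ k ∈ Finset.Icc 3 7, D.variation ξ ζ k x) 0) ∧
        (∀ k ∈ Finset.Icc 3 6, ∀ x,
          HasSuperDivAt (D.field ξ ζ k) (D.variation ξ ζ k x) x) ∧
        ∀ k ∈ Finset.Icc 3 6, ∀ (J : SIdx) (A : Fin 2) (l : Gr m →ₗ[ℂ] ℂ),
          ContDiff ℂ ∞ fun x => l (D.field ξ ζ k x J A)) ∧
    ∀ (s : Fin 2 → Fin 2 → ℝ) (φ : 𝓢(Pt m → Fin 4 → ℝ, ℂ)) (l : Gr m →ₗ[ℂ] ℂ)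
      (ν : Measure (Fin m → Fin 2 → ℝ)) (ρ : (Fin m → Fin 2 → ℝ) → ℂ)
      (K : Set (Fin m → Fin 2 → ℝ)),
      IsCompact K → ν Kᶜ = 0 → Integrable ρ ν →
      ∀ ξ : Fin 2 → ℂ, (∀ σ ∈ K, Regular (points s σ) ξ) →
        ((∀ σ ∈ K, ∀ x : Fin 4 → Fin 2 → ℝ, Integrable fun w : Pt m → Fin 4 → ℝ =>
            φ w * l (berezin (Kin.integrand ⟨Λ, r, points s σ, fun i α => (w i α : ℂ)⟩
              (fun α A => (x α A : ℂ)) ξ))) ∧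
          (∀ σ ∈ K, Integrable fun x : Fin 4 → Fin 2 → ℝ =>
            smear Λ r s φ l (fun D x => D.integrand x ξ) σ x) ∧
          Integrable (fun σ => ρ σ * ∫ x : Fin 4 → Fin 2 → ℝ,
            smear Λ r s φ l (fun D x => D.integrand x ξ) σ x) ν) ∧
        (∀ ζ : Fin 2 → ℂ,
          (∀ σ ∈ K, ∀ k ∈ Finset.Icc 3 7,
            Integrable (fun x : Fin 4 → Fin 2 → ℝ =>
              smear Λ r s φ l (fun D => D.variation ξ ζ k) σ x) ∧
            ∫ x : Fin 4 → Fin 2 → ℝ, smear Λ r s φ l (fun D => D.variation ξ ζ k) σ x = 0) ∧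
          HasDerivAt (fun t : ℂ => amplitude Λ r s φ l ν ρ (ξ + t • ζ))
            (moduliIntegral Λ r s φ l ν ρ
              fun D x => ∑ k ∈ Finset.Icc 3 7, D.variation ξ ζ k x) 0 ∧
          moduliIntegral Λ r s φ l ν ρ
            (fun D x => ∑ k ∈ Finset.Icc 3 7, D.variation ξ ζ k x) = 0) ∧
        HasFDerivAt (amplitude Λ r s φ l ν ρ) (0 : (Fin 2 → ℂ) →L[ℂ] ℂ) ξ ∧
        ∀ ξ' : Fin 2 → ℂ, (∀ σ ∈ K, Regular (points s σ) ξ') →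
          amplitude Λ r s φ l ν ρ ξ' = amplitude Λ r s φ l ν ρ ξ := by
  constructor
  · rintro σ w ξ ζ h D rfl
    refine ⟨fun x => Kin.hasGrDerivAt_integrand _ ξ ζ h x, fun k hk x => ?_, fun k hk J A l => ?_⟩
    all_goals
      rw [Finset.mem_Icc] at hk
      obtain ⟨k, rfl⟩ : ∃ j, k = j + 3 := ⟨k - 3, by omega⟩
      rw [Kin.field_eq _ ξ ζ (by omega : k < 4)]
    · exact Kin.hasSuperDivAt_divField _ hr ξ ζ h (by omega) x
    · exact Kin.contDiff_divField _ ξ ζ k J A l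
  · intro s φ l ν ρ K hK hν hρ ξ h
    -- Independence of ξ comes first: local constancy gives the derivative of the amplitude without
    -- differentiating under the contour integral.
    have hconst : amplitude Λ r s φ l ν ρ =ᶠ[nhds ξ] fun _ => amplitude Λ r s φ l ν ρ ξ := by
      filter_upwards [eventually_admissible hK h] with ξ' h'
      exact amplitude_eq φ l hr hν h h'
    have hF : HasFDerivAt (amplitude Λ r s φ l ν ρ) (0 : (Fin 2 → ℂ) →L[ℂ] ℂ) ξ :=
      (hasFDerivAt_const _ ξ).congr_of_eventuallyEq hconst
    refine ⟨⟨fun σ hσ x => ?_, fun σ hσ => ?_, integrable_mul_integral_smear φ l hK hν hρ h⟩,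
      fun ζ => ⟨fun σ hσ k hk => integral_smear_variation Λ r φ l hr (gauge_ne_zero (h σ hσ)) ζ
        (h σ hσ) hk, ?_, moduliIntegral_variation φ l hr hν h ζ⟩, hF,
      fun ξ' h' => amplitude_eq φ l hr hν h h'⟩
    · exact integrable_integrand Λ r s φ l ξ σ x
    · simp only [smear_integrand]
      exact integrable_wInt (integrandCoord_mem Λ r l) φ (gauge_ne_zero (h σ hσ)) ξ σ
    -- The integrated variation is zero, so the claimed derivative is that of a locally constant
    -- function.
    · rw [moduliIntegral_variation φ l hr hν h ζ]
      have hl : HasDerivAt (fun t : ℂ => ξ + t • ζ) ζ 0 := by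
        simpa using ((hasDerivAt_id (0 : ℂ)).smul_const ζ).const_add ξ
      have hF' : HasFDerivAt (amplitude Λ r s φ l ν ρ) (0 : (Fin 2 → ℂ) →L[ℂ] ℂ)
          (ξ + (0 : ℂ) • ζ) := by
        rwa [zero_smul, add_zero]
      exact hF'.comp_hasDerivAt (0 : ℂ) hl
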